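/- Let $k$ be a commutative ring, $A$ a $k$-algebra, and $(U,A,\Delta,\varepsilon,s,t)$ a left bialgebroid over $A$, with commuting source and target maps $s\colon A\to U$, $t\colon A^{\mathrm{op}}\to U$. Write $a\rhd u\lhd b=s(a)t(b)u$, and more generally $a\rhd n\lhd b=s(a)t(b)n$ for elements $n$ of a left $U$-module. Tensor products $\otimes_A$ are taken with respect to these bimodule structures, so $u\lhd a\otimes_A v=u\otimes_A a\rhd v$. Elements of $U^{\otimes_A n}$ are written $(u^1|\dots|u^n)$, with $U^{\otimes_A 0}=A$. The algebra $U$ acts on $U^{\otimes_A n}$ diagonally, $u\cdot(v^1|\dots|v^n)=(u_{(1)}v^1|\dots|u_{(n)}v^n)$, and on $A$ by $u\cdot a=\varepsilon(u\,s(a))$. Assume that $U$ is both left and right Hopf, i.e. that both maps $u\otimes v\mapsto u_{(1)}\otimes_A u_{(2)}v$ on $U\otimes U/(u\,t(a)\otimes v-u\otimes t(a)v)$ and $u\otimes v\mapsto u_{(1)}v\otimes_A u_{(2)}$ on $U\otimes U/(u\,s(a)\otimes v-u\otimes s(a)v)$ are bijective onto $U\otimes_AU$. Write $u_+\otimes u_-$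 for the preimage of $u\otimes_A1$ under the first map and $u_{[+]}\otimes u_{[-]}$ for the preimage of $1\otimes_Au$ under the second. Let $M$ be a stable anti Yetter–Drinfel'd (aYD) contramodule. That is, $M$ is a left $U$-module and a right $A$-module with a $k$-linear contraaction $\gamma\colon\mathrm{Hom}_{A^{\mathrm{op}}}(U_\lhd,M)\to M$, written $\gamma(f)=\gamma(f(-))$ (nested contraactions are distinguished by dots), such that * $\gamma$ is a right contraaction: $\gamma(f(s(a)-))=\gamma(f)a$; $\dot\gamma(\ddot\gamma(g(\cdot\otimes_A\cdot\cdot)))=\gamma(g(-_{(1)}\otimes_A-_{(2)}))$ for $g\in\mathrm{Hom}_{A^{\mathrm{op}}}((U\otimes_AU)_\lhd,M)$, where $(x\otimes_A y)\lhd a=x\otimes_A t(a)y$; and $\gamma(m\,\varepsilon(-))=m$; * the two $A$-bimodule structures on $M$ agree: $t(a)m=ma$ and $s(a)m=\gamma(m\,\varepsilon(-\,s(a)))$; * action and contraaction are compatible: $u\,\gamma(f)=\gamma\big(u_{+(2)}f(u_-\,-\,u_{+(1)})\big)$; * $M$ is stable: $\gamma(u\mapsto um)=m$. For a left $U$-module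 $N$ let $U$ act on $\mathrm{Hom}_A(N,M)$ (left $A$-linear maps) by $(u\blacktriangleright f)(x)=u_{[+]}f(u_{[-]}x)$. Put $\mathcal O(p)=U^{\otimes_Ap}$, the cochain spaces of the cobar complex that computes $\mathrm{Cotor}_U(A,A)$. Then $\mathcal O$ is an operad with multiplication under $$(u^1|\dots|u^p)\circ_i(v^1|\dots|v^q)=(u^1|\dots|u^{i-1}|u^i\cdot(v^1|\dots|v^q)|u^{i+1}|\dots|u^p),\quad 1\le i\le p,$$ with identity, multiplication and unit $\mathbb 1=1_U$, $\mu=(1_U|1_U)$, $e=1_A$. Put $\mathcal M(n)=\mathrm{Hom}_A(U^{\otimes_An},M)$. For $w\in\mathcal O(p)$ and $f\in\mathcal M(n)$ define $w\bullet_if\in\mathcal M(n-p+1)$ by $$(w\bullet_if)(v^1|\dots|v^{n-p+1})=f(v^1|\dots|v^{i-1}|v^i\cdot w|v^{i+1}|\dots|v^{n-p+1}),\quad 1\le i\le n-p+1,\ 0\le p\le n,$$ $$((u^1|\dots|u^p)\bullet_0f)(v^1|\dots|v^{n-p+1})=\gamma\big(-_{[+]}\,(u^1\blacktriangleright f)(-_{[-]}\cdot(u^2|\dots|u^p)\,|\,v^1|\dots|v^{n-p+1})\big),\quad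 1\le p\le n+1,$$ $$(a\bullet_0f)(v^1|\dots|v^{n+1})=\gamma\big(((-\,v^1)\blacktriangleright f)(t(a)\cdot(v^2|\dots|v^{n+1}))\big),\quad a\in\mathcal O(0)=A,$$ and $w\bullet_if=0$ for $i\geq1$ when $p>n$ or $i>n-p+1$, and $w\bullet_0f=0$ when $p>n+1$. Define $t\colon\mathcal M(n)\to\mathcal M(n)$ by $t=\mathrm{id}$ for $n=0$ and $$(tf)(v^1|\dots|v^n)=\gamma\big(((-\,v^1)\blacktriangleright f)(v^2|\dots|v^n|1)\big),\quad n\ge1.$$ **Theorem.** These formulas are well defined and turn $(\mathcal M,t)$ into a cyclic unital opposite module over $(\mathcal O,\mu,e)$. That is, for all $\varphi\in\mathcal O(p)$, $\psi\in\mathcal O(q)$, $f\in\mathcal M(n)$ and all indices $i,j\ge0$ for which the operations on the left are in range, $$\varphi\bullet_i(\psi\bullet_jf)=\begin{cases}\psi\bullet_j(\varphi\bullet_{i+q-1}f)&j<i,\\(\varphi\circ_{j-i+1}\psi)\bullet_if&j-p<i\le j,\\\psi\bullet_{j-p+1}(\varphi\bullet_if)&i\le j-p;\end{cases}$$ $\mathbb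 1\bullet_if=f$ for $0\le i\le n$; $t(\varphi\bullet_if)=\varphi\bullet_{i+1}t(f)$ for $0\le i\le n-p$; and $t^{n+1}=\mathrm{id}$ on $\mathcal M(n)$. Moreover, the induced operators $d_i=\mu\bullet_i(-)$ for $0\le i<n$, $d_n=\mu\bullet_0t(-)$ and $s_j=e\bullet_{j+1}(-)$ for $0\le j\le n$, on $\mathcal M(n)$, form together with $t$ a cyclic $k$-module. In degree $n$ it is given by the structure maps of the cyclic dual of the cocyclic $k$-module computing $\mathrm{Ext}_U(A,M)$, which are the above $t$ and $$(d_if)(u^1|\dots|u^{n-1})=\begin{cases}\gamma\big(-_{[+]}f(-_{[-]}|u^1|\dots|u^{n-1})\big)&i=0,\\f(u^1|\dots|\Delta u^i|\dots|u^{n-1})&1\le i\le n-1,\\f(u^1|\dots|u^{n-1}|1)&i=n,\end{cases}$$ $$(s_jf)(u^1|\dots|u^{n+1})=f(u^1|\dots|\varepsilon(u^{j+1})|\dots|u^{n+1}),\quad 0\le j\le n.$$ -/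

import Mathlib

open scoped TensorProduct

universe u v w

namespace CycOpp

/-! ### Balanced tensor products over a noncommutative ring -/

section Balanced

variable {k : Type*} [CommRing k] {A : Type*}
  {N : Type*} [AddCommGroup N] [Module k N]
  {P : Type*} [AddCommGroup P] [Module k P]
  {Q : Type*} [AddCommGroup Q] [Module k Q]

/-- The relations `ρ a n ⊗ p = n ⊗ σ a p`, for two families of `k`-linear operators
`ρ` on `N` and `σ` on `P` indexed by `A`. -/
def balRel (ρ : A → N →ₗ[k] N) (σ : A → P →ₗ[k] P) : Submodule k (N ⊗[k] P) :=
  Submodule.span k {z | ∃ a n p, z = ρ a n ⊗ₜ[k] p - n ⊗ₜ[k] σ a p}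

/-- The balanced tensor product of `N` (with operators `ρ`) and `P` (with operators `σ`). If `ρ` is a
right and `σ` a left action of a `k`-algebra `A` this is the tensor product `N ⊗_A P`. -/
abbrev BalTensor (ρ : A → N →ₗ[k] N) (σ : A → P →ₗ[k] P) : Type _ :=
  (N ⊗[k] P) ⧸ balRel ρ σ

/-- The projection `N ⊗[k] P → N ⊗_A P`. -/
abbrev BalTensor.mk (ρ : A → N →ₗ[k] N) (σ : A → P →ₗ[k] P) :
    N ⊗[k] P →ₗ[k] BalTensor ρ σ :=
  (balRel ρ σ).mkQ

theorem BalTensor.mk_balanced (ρ : A → N →ₗ[k] N) (σ : A → P →ₗ[k] P) (a : A) (n : N) (p : P) :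
    BalTensor.mk ρ σ (ρ a n ⊗ₜ p) = BalTensor.mk ρ σ (n ⊗ₜ σ a p) := by
  rw [← sub_eq_zero, ← map_sub]
  exact (Submodule.Quotient.mk_eq_zero _).2 (Submodule.subset_span ⟨a, n, p, rfl⟩)

/-- The universal property of the balanced tensor product. -/
def BalTensor.lift (ρ : A → N →ₗ[k] N) (σ : A → P →ₗ[k] P) (φ : N →ₗ[k] P →ₗ[k] Q)
    (h : ∀ a n p, φ (ρ a n) p = φ n (σ a p)) : BalTensor ρ σ →ₗ[k] Q :=
  (balRel ρ σ).liftQ (TensorProduct.lift φ) <| by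
    refine Submodule.span_le.2 ?_
    rintro _ ⟨a, n, p, rfl⟩
    simp [h a n p]

@[simp] theorem BalTensor.lift_mk (ρ : A → N →ₗ[k] N) (σ : A → P →ₗ[k] P)
    (φ : N →ₗ[k] P →ₗ[k] Q) (h : ∀ a n p, φ (ρ a n) p = φ n (σ a p)) (x : N ⊗[k] P) :
    BalTensor.lift ρ σ φ h (BalTensor.mk ρ σ x) = TensorProduct.lift φ x := rfl

theorem BalTensor.hom_ext {ρ : A → N →ₗ[k] N} {σ : A → P →ₗ[k] P}
    {f g : BalTensor ρ σ →ₗ[k] Q}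
    (h : ∀ n p, f (BalTensor.mk ρ σ (n ⊗ₜ p)) = g (BalTensor.mk ρ σ (n ⊗ₜ p))) : f = g :=
  Submodule.linearMap_qext _ (TensorProduct.ext' h)

end Balanced

/-! ### Left bialgebroids -/

/-- Source and target maps `s : A → U` and `t : Aᵒᵖ → U` with commuting images: the structure of an
`A ⊗ Aᵒᵖ`-ring on `U`. -/
structure AeRing (k : Type v) (A U : Type u) [CommRing k] [Ring A] [Algebra k A]
    [Ring U] [Algebra k U] where
  src : A →ₐ[k] U
  tgt : Aᵐᵒᵖ →ₐ[k] U
  src_tgt_comm : ∀ a b, src a * tgt b = tgt b * src a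

section AeRing

variable {k : Type v} {A U : Type u} [CommRing k] [Ring A] [Algebra k A] [Ring U] [Algebra k U]

/-- The target map as an antimultiplicative map `A → U`. -/
def AeRing.t (R : AeRing k A U) (a : A) : U := R.tgt (MulOpposite.op a)

/-- `N ⊗_A P` for left `U`-modules `N` and `P`, which are `A`-bimodules through
`a ⊳ n ⊲ b = s(a) t(b) n`: here `t(a) n ⊗ p = n ⊗ s(a) p`. -/
abbrev AeRing.Tens (R : AeRing k A U)
    (N : Type*) [AddCommGroup N] [Module k N] [Module U N] [IsScalarTower k U N]
    (P : Type*) [AddCommGroup P] [Module k P] [Module U P] [IsScalarTower k U P] : Type _ :=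
  BalTensor (k := k) (fun a : A => Algebra.lsmul k k N (R.t a))
    (fun a : A => Algebra.lsmul k k P (R.src a))

/-- The class `n ⊗_A p`. -/
abbrev AeRing.proj (R : AeRing k A U)
    (N : Type*) [AddCommGroup N] [Module k N] [Module U N] [IsScalarTower k U N]
    (P : Type*) [AddCommGroup P] [Module k P] [Module U P] [IsScalarTower k U P] :
    N ⊗[k] P →ₗ[k] R.Tens N P :=
  BalTensor.mk (k := k) (fun a : A => Algebra.lsmul k k N (R.t a))
    (fun a : A => Algebra.lsmul k k P (R.src a))

/-- The relations defining `U ⊗_A U ⊗_A U` as a quotient of `U ⊗ (U ⊗ U)`. -/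
def AeRing.rel₃ (R : AeRing k A U) : Submodule k (U ⊗[k] (U ⊗[k] U)) :=
  Submodule.span k
    ({z | ∃ a x y w, z = (R.t a * x) ⊗ₜ[k] (y ⊗ₜ[k] w) - x ⊗ₜ[k] ((R.src a * y) ⊗ₜ[k] w)} ∪
     {z | ∃ a x y w, z = x ⊗ₜ[k] ((R.t a * y) ⊗ₜ[k] w) - x ⊗ₜ[k] (y ⊗ₜ[k] (R.src a * w))})

/-- The triple tensor product `U ⊗_A U ⊗_A U`. -/
abbrev AeRing.Tens₃ (R : AeRing k A U) : Type _ := (U ⊗[k] (U ⊗[k] U)) ⧸ R.rel₃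

/-- `x ↦ (y ⊗_A w ↦ x ⊗_A y ⊗_A w)`. -/
def AeRing.insL (R : AeRing k A U) : U →ₗ[k] R.Tens U U →ₗ[k] R.Tens₃ where
  toFun x := BalTensor.lift _ _
    ((LinearMap.mk₂ k (fun y w => R.rel₃.mkQ (x ⊗ₜ (y ⊗ₜ w)))
      (fun y y' w => by rw [TensorProduct.add_tmul, TensorProduct.tmul_add, map_add])
      (fun c y w => by rw [← TensorProduct.smul_tmul', TensorProduct.tmul_smul, map_smul])
      (fun y w w' => by rw [TensorProduct.tmul_add, TensorProduct.tmul_add, map_add])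
      (fun c y w => by rw [TensorProduct.tmul_smul, TensorProduct.tmul_smul, map_smul]))) <| by
    intro a y w
    exact (Submodule.Quotient.eq _).2 (Submodule.subset_span (Or.inr ⟨a, x, y, w, rfl⟩))
  map_add' x x' := BalTensor.hom_ext fun y w => by
    change R.rel₃.mkQ ((x + x') ⊗ₜ (y ⊗ₜ w)) =
      R.rel₃.mkQ (x ⊗ₜ (y ⊗ₜ w)) + R.rel₃.mkQ (x' ⊗ₜ (y ⊗ₜ w))
    rw [TensorProduct.add_tmul, map_add]
  map_smul' c x := BalTensor.hom_ext fun y w => by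
    change R.rel₃.mkQ ((c • x) ⊗ₜ (y ⊗ₜ w)) = c • R.rel₃.mkQ (x ⊗ₜ (y ⊗ₜ w))
    rw [← TensorProduct.smul_tmul', map_smul]

/-- `w ↦ (x ⊗_A y ↦ x ⊗_A y ⊗_A w)`. -/
def AeRing.insR (R : AeRing k A U) : U →ₗ[k] R.Tens U U →ₗ[k] R.Tens₃ where
  toFun w := BalTensor.lift _ _
    ((LinearMap.mk₂ k (fun x y => R.rel₃.mkQ (x ⊗ₜ (y ⊗ₜ w)))
      (fun x x' y => by rw [TensorProduct.add_tmul, map_add])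
      (fun c x y => by rw [← TensorProduct.smul_tmul', map_smul])
      (fun x y y' => by rw [TensorProduct.add_tmul, TensorProduct.tmul_add, map_add])
      (fun c x y => by
        rw [← TensorProduct.smul_tmul', TensorProduct.tmul_smul, map_smul]))) <| by
    intro a x y
    exact (Submodule.Quotient.eq _).2 (Submodule.subset_span (Or.inl ⟨a, x, y, w, rfl⟩))
  map_add' w w' := BalTensor.hom_ext fun x y => by
    change R.rel₃.mkQ (x ⊗ₜ (y ⊗ₜ (w + w'))) =
      R.rel₃.mkQ (x ⊗ₜ (y ⊗ₜ w)) + R.rel₃.mkQ (x ⊗ₜ (y ⊗ₜ w'))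
    rw [TensorProduct.tmul_add, TensorProduct.tmul_add, map_add]
  map_smul' c w := BalTensor.hom_ext fun x y => by
    change R.rel₃.mkQ (x ⊗ₜ (y ⊗ₜ (c • w))) = c • R.rel₃.mkQ (x ⊗ₜ (y ⊗ₜ w))
    rw [TensorProduct.tmul_smul, TensorProduct.tmul_smul, map_smul]

end AeRing

/-- A left bialgebroid `(U, A, Δ, ε, s, t)`. The axioms that involve `Δ u = u₍₁₎ ⊗_A u₍₂₎` are stated
for every `X` in `U ⊗ U` that represents `Δ u`. -/
structure LeftBialgebroid (k : Type v) (A U : Type u) [CommRing k] [Ring A] [Algebra k A]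
    [Ring U] [Algebra k U] extends AeRing k A U where
  /-- the coproduct `U → U ⊗_A U` -/
  comul : U →ₗ[k] toAeRing.Tens U U
  /-- the counit `U → A` -/
  counit : U →ₗ[k] A
  /-- the coproduct is a morphism of `A`-bimodules -/
  comul_bimod : ∀ (a b : A) (u : U) (X : U ⊗[k] U), toAeRing.proj U U X = comul u →
    comul (src a * toAeRing.t b * u) = toAeRing.proj U U ((src a ⊗ₜ toAeRing.t b) * X)
  /-- the counit is a morphism of `A`-bimodules -/
  counit_bimod : ∀ (a b : A) (u : U), counit (src a * toAeRing.t b * u) = a * counit u * b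
  /-- coassociativity -/
  coassoc : ∀ (u : U) (X : U ⊗[k] U), toAeRing.proj U U X = comul u →
    TensorProduct.lift (toAeRing.insL.compl₂ comul) X =
      TensorProduct.lift (toAeRing.insR.compl₂ comul).flip X
  /-- `s(ε(u₍₁₎)) u₍₂₎ = u` -/
  counit_left : ∀ (u : U) (X : U ⊗[k] U), toAeRing.proj U U X = comul u →
    TensorProduct.lift ((LinearMap.mul k U).comp (src.toLinearMap.comp counit)) X = u
  /-- `t(ε(u₍₂₎)) u₍₁₎ = u` -/
  counit_right : ∀ (u : U) (X : U ⊗[k] U), toAeRing.proj U U X = comul u →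
    TensorProduct.lift ((LinearMap.mul k U).flip.compl₂ (tgt.toLinearMap.comp
      ((MulOpposite.opLinearEquiv k).toLinearMap.comp counit))) X = u
  /-- `Δ u` lies in the Sweedler-Takeuchi product: `u₍₁₎ t(a) ⊗_A u₍₂₎ = u₍₁₎ ⊗_A u₍₂₎ s(a)` -/
  takeuchi : ∀ (a : A) (u : U) (X : U ⊗[k] U), toAeRing.proj U U X = comul u →
    toAeRing.proj U U (X * (toAeRing.t a ⊗ₜ 1)) = toAeRing.proj U U (X * (1 ⊗ₜ src a))
  comul_one : comul 1 = toAeRing.proj U U (1 ⊗ₜ 1)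
  /-- the coproduct is multiplicative -/
  comul_mul : ∀ (u v : U) (X Y : U ⊗[k] U), toAeRing.proj U U X = comul u →
    toAeRing.proj U U Y = comul v → comul (u * v) = toAeRing.proj U U (X * Y)
  counit_one : counit 1 = 1
  counit_mul_src : ∀ u v, counit (u * v) = counit (u * src (counit v))
  counit_mul_tgt : ∀ u v, counit (u * v) = counit (u * toAeRing.t (counit v))

namespace LeftBialgebroid

variable {k : Type v} {A U : Type u} [CommRing k] [Ring A] [Algebra k A] [Ring U] [Algebra k U]

theorem t_mul (R : AeRing k A U) (a b : A) : R.t (a * b) = R.t b * R.t a := by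
  simp [AeRing.t]

theorem t_one (R : AeRing k A U) : R.t 1 = 1 := by
  simp [AeRing.t]

theorem src_t (R : AeRing k A U) (a b : A) : R.src a * R.t b = R.t b * R.src a :=
  R.src_tgt_comm _ _

theorem exists_rep (B : LeftBialgebroid k A U) (u : U) :
    ∃ X : U ⊗[k] U, B.proj U U X = B.comul u :=
  Submodule.mkQ_surjective _ _

theorem comul_src (B : LeftBialgebroid k A U) (a : A) :
    B.comul (B.src a) = B.proj U U (B.src a ⊗ₜ 1) := by
  have h := B.comul_bimod a 1 1 (1 ⊗ₜ 1) B.comul_one.symm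
  simpa [t_one, Algebra.TensorProduct.tmul_mul_tmul] using h

theorem comul_t (B : LeftBialgebroid k A U) (a : A) :
    B.comul (B.t a) = B.proj U U (1 ⊗ₜ B.t a) := by
  have h := B.comul_bimod 1 a 1 (1 ⊗ₜ 1) B.comul_one.symm
  simpa [Algebra.TensorProduct.tmul_mul_tmul] using h

/-! ### The monoidal structure on left `U`-modules -/

section Diag

variable (N : Type*) [AddCommGroup N] [Module k N] [Module U N] [IsScalarTower k U N]
  (P : Type*) [AddCommGroup P] [Module k P] [Module U P] [IsScalarTower k U P]

/-- The factorwise action of `U ⊗ U` on `N ⊗ P`. -/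
def opOn : U ⊗[k] U →ₗ[k] (N ⊗[k] P →ₗ[k] N ⊗[k] P) :=
  TensorProduct.lift ((TensorProduct.mapBilinear (RingHom.id k) N P N P).compl₁₂
    (Algebra.lsmul k k N).toLinearMap (Algebra.lsmul k k P).toLinearMap)

variable {N P}

@[simp] theorem opOn_tmul (x y : U) (n : N) (p : P) :
    opOn (k := k) N P (x ⊗ₜ y) (n ⊗ₜ p) = (x • n) ⊗ₜ (y • p) := rfl

theorem opOn_mul (X Y : U ⊗[k] U) (z : N ⊗[k] P) :
    opOn N P (X * Y) z = opOn N P X (opOn N P Y z) := by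
  induction X with
  | zero => simp
  | add X X' h h' => simp [add_mul, h, h']
  | tmul x x' =>
    induction Y with
    | zero => simp
    | add Y Y' h h' => simp [mul_add, h, h']
    | tmul y y' =>
      induction z with
      | zero => simp
      | add z z' h h' => simp only [map_add, h, h']
      | tmul n p => simp [Algebra.TensorProduct.tmul_mul_tmul, mul_smul]

/-- `x ⊗_A y ↦ x n ⊗_A y p`. -/
def mulOn (B : LeftBialgebroid k A U) (n : N) (p : P) : B.Tens U U →ₗ[k] B.Tens N P :=
  BalTensor.lift _ _ (LinearMap.mk₂ k (fun x y => B.proj N P ((x • n) ⊗ₜ (y • p)))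
    (fun x x' y => by rw [add_smul, TensorProduct.add_tmul, map_add])
    (fun c x y => by rw [smul_assoc, ← TensorProduct.smul_tmul', map_smul])
    (fun x y y' => by rw [add_smul, TensorProduct.tmul_add, map_add])
    (fun c x y => by rw [smul_assoc, TensorProduct.tmul_smul, map_smul])) <| by
    intro a x y
    have := BalTensor.mk_balanced (k := k) (fun a : A => Algebra.lsmul k k N (B.t a))
      (fun a : A => Algebra.lsmul k k P (B.src a)) a (x • n) (y • p)
    simpa only [LinearMap.mk₂_apply, Algebra.lsmul_coe, smul_eq_mul, mul_smul] using this

theorem mulOn_proj (B : LeftBialgebroid k A U) (n : N) (p : P) (X : U ⊗[k] U) :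
    B.mulOn n p (B.proj U U X) = B.proj N P (opOn N P X (n ⊗ₜ p)) := by
  induction X with
  | zero => simp
  | add X X' h h' => simp only [map_add, h, h', LinearMap.add_apply]
  | tmul x y => rfl

/-- The diagonal action `u ⊳ (n ⊗_A p) = u₍₁₎ n ⊗_A u₍₂₎ p` on `N ⊗_A P`. -/
def diag (B : LeftBialgebroid k A U) (u : U) : B.Tens N P →ₗ[k] B.Tens N P :=
  BalTensor.lift _ _ (LinearMap.mk₂ k (fun n p => B.mulOn n p (B.comul u))
    (fun n n' p => by
      obtain ⟨X, hX⟩ := B.exists_rep u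
      simp only [← hX, mulOn_proj, TensorProduct.add_tmul, map_add])
    (fun c n p => by
      obtain ⟨X, hX⟩ := B.exists_rep u
      simp only [← hX, mulOn_proj, ← TensorProduct.smul_tmul', map_smul])
    (fun n p p' => by
      obtain ⟨X, hX⟩ := B.exists_rep u
      simp only [← hX, mulOn_proj, TensorProduct.tmul_add, map_add])
    (fun c n p => by
      obtain ⟨X, hX⟩ := B.exists_rep u
      simp only [← hX, mulOn_proj, TensorProduct.tmul_smul, map_smul])) <| by
    intro a n p
    obtain ⟨X, hX⟩ := B.exists_rep u
    have h := congrArg (B.mulOn n p) (B.takeuchi a u X hX)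
    simpa only [mulOn_proj, opOn_mul, opOn_tmul, one_smul, ← hX, LinearMap.mk₂_apply,
      Algebra.lsmul_coe] using h

theorem diag_tmul (B : LeftBialgebroid k A U) (u : U) (n : N) (p : P) :
    B.diag u (B.proj N P (n ⊗ₜ p)) = B.mulOn n p (B.comul u) := rfl

theorem diag_proj (B : LeftBialgebroid k A U) (u : U) (X : U ⊗[k] U)
    (hX : B.proj U U X = B.comul u) (z : N ⊗[k] P) :
    B.diag u (B.proj N P z) = B.proj N P (opOn N P X z) := by
  induction z with
  | zero => simp
  | add z z' h h' => simp only [map_add, h, h']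
  | tmul n p => rw [diag_tmul, ← hX, mulOn_proj]

variable (N P)

/-- `N ⊗_A P` is a left `U`-module by the diagonal action. -/
abbrev tensModule (B : LeftBialgebroid k A U) : Module U (B.Tens N P) where
  smul u z := B.diag u z
  one_smul z := by
    obtain ⟨z, rfl⟩ := Submodule.mkQ_surjective _ z
    change B.diag 1 (B.proj N P z) = B.proj N P z
    rw [B.diag_proj 1 _ B.comul_one.symm]
    congr 1
    induction z with
    | zero => simp
    | add z z' h h' => rw [map_add, h, h']
    | tmul n p => simp
  mul_smul u v z := by
    obtain ⟨z, rfl⟩ := Submodule.mkQ_surjective _ z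
    obtain ⟨X, hX⟩ := B.exists_rep u
    obtain ⟨Y, hY⟩ := B.exists_rep v
    change B.diag (u * v) (B.proj N P z) = B.diag u (B.diag v (B.proj N P z))
    rw [B.diag_proj v Y hY, B.diag_proj u X hX,
      B.diag_proj (u * v) (X * Y) (B.comul_mul u v X Y hX hY).symm, opOn_mul]
  smul_zero u := map_zero (B.diag u)
  smul_add u z z' := map_add (B.diag u) z z'
  add_smul u v z := by
    obtain ⟨z, rfl⟩ := Submodule.mkQ_surjective _ z
    obtain ⟨X, hX⟩ := B.exists_rep u
    obtain ⟨Y, hY⟩ := B.exists_rep v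
    change B.diag (u + v) (B.proj N P z) =
      B.diag u (B.proj N P z) + B.diag v (B.proj N P z)
    rw [B.diag_proj v Y hY, B.diag_proj u X hX,
      B.diag_proj (u + v) (X + Y) (by rw [map_add, map_add, hX, hY]), map_add,
      LinearMap.add_apply, map_add]
  zero_smul z := by
    obtain ⟨z, rfl⟩ := Submodule.mkQ_surjective _ z
    change B.diag 0 (B.proj N P z) = 0
    rw [B.diag_proj 0 0 (by rw [map_zero, map_zero]), map_zero, LinearMap.zero_apply, map_zero]

theorem tens_isScalarTower (B : LeftBialgebroid k A U) :
    @IsScalarTower k U (B.Tens N P) _ (B.tensModule N P).toSMul _ := by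
  let _ := B.tensModule N P
  refine ⟨fun c u z => ?_⟩
  obtain ⟨z, rfl⟩ := Submodule.mkQ_surjective _ z
  obtain ⟨X, hX⟩ := B.exists_rep u
  change B.diag (c • u) (B.proj N P z) = c • B.diag u (B.proj N P z)
  rw [B.diag_proj u X hX, B.diag_proj (c • u) (c • X) (by rw [map_smul, map_smul, hX]), map_smul,
    LinearMap.smul_apply, map_smul]

end Diag

end LeftBialgebroid

/-- Bundled left `U`-modules, with the `k`-module structure made explicit. -/
structure LMod (k : Type v) (U : Type u) [CommRing k] [Ring U] [Algebra k U] where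
  carrier : Type u
  [addCommGroup : AddCommGroup carrier]
  [modk : Module k carrier]
  [modU : Module U carrier]
  [tower : IsScalarTower k U carrier]

attribute [instance] LMod.addCommGroup LMod.modk LMod.modU LMod.tower

namespace LeftBialgebroid

section TensorPowers

variable {k : Type v} {A U : Type u} [CommRing k] [Ring A] [Algebra k A] [Ring U] [Algebra k U]

theorem counit_src_mul (B : LeftBialgebroid k A U) (a : A) (u : U) :
    B.counit (B.src a * u) = a * B.counit u := by
  simpa [t_one] using B.counit_bimod a 1 u

theorem counit_t_mul (B : LeftBialgebroid k A U) (a : A) (u : U) :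
    B.counit (B.t a * u) = B.counit u * a := by
  simpa using B.counit_bimod 1 a u

theorem counit_src (B : LeftBialgebroid k A U) (a : A) : B.counit (B.src a) = a := by
  simpa [B.counit_one] using B.counit_src_mul a 1

/-- The base algebra as a left `U`-module, `u ⊳ a = ε(u s(a))`. -/
abbrev unitModule (B : LeftBialgebroid k A U) : Module U A where
  smul u a := B.counit (u * B.src a)
  one_smul a := by
    change B.counit (1 * B.src a) = a
    rw [one_mul, counit_src]
  mul_smul u v a := by
    change B.counit (u * v * B.src a) = B.counit (u * B.src (B.counit (v * B.src a)))
    rw [mul_assoc, B.counit_mul_src]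
  smul_zero u := by
    change B.counit (u * B.src 0) = 0
    rw [map_zero, mul_zero, map_zero]
  smul_add u a b := by
    change B.counit (u * B.src (a + b)) = B.counit (u * B.src a) + B.counit (u * B.src b)
    rw [map_add, mul_add, map_add]
  add_smul u v a := by
    change B.counit ((u + v) * B.src a) = B.counit (u * B.src a) + B.counit (v * B.src a)
    rw [add_mul, map_add]
  zero_smul a := by
    change B.counit (0 * B.src a) = 0
    rw [zero_mul, map_zero]

/-- The unit object `A`. -/
def unitObj (B : LeftBialgebroid k A U) : LMod k U :=
  letI := B.unitModule
  { carrier := A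
    tower := ⟨fun c u a => by
      change B.counit ((c • u) * B.src a) = c • B.counit (u * B.src a)
      rw [smul_mul_assoc, map_smul]⟩ }

/-- The left `U`-module `U ⊗_A N` with the diagonal action. -/
def tensObj (B : LeftBialgebroid k A U) (N : LMod k U) : LMod k U :=
  letI := B.tensModule U N.carrier
  { carrier := B.Tens U N.carrier
    tower := B.tens_isScalarTower U N.carrier }

/-- The left `U`-module `U^{⊗_A n}` with the diagonal action, realised as
`U ⊗_A (U ⊗_A ( ⋯ (U ⊗_A A)))`. In degree `0` this is `A`. -/
def tpow (B : LeftBialgebroid k A U) : ℕ → LMod k U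
  | 0 => B.unitObj
  | n + 1 => B.tensObj (tpow B n)

/-- The `k`-module `U^{⊗_A n}`. It is a left `U`-module, `u • x` is the diagonal action `u ⊳ x`. -/
abbrev T (B : LeftBialgebroid k A U) (n : ℕ) : Type u := (B.tpow n).carrier

/-- The identification of `A` with `U^{⊗_A 0}`. -/
def scalar (B : LeftBialgebroid k A U) : A →ₗ[k] B.T 0 := LinearMap.id (R := k) (M := A)

/-- `(u, x) ↦ (u | x)`. -/
def cons (B : LeftBialgebroid k A U) {n : ℕ} (u : U) : B.T n →ₗ[k] B.T (n + 1) :=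
  (B.proj U (B.T n)).comp (TensorProduct.mk k U (B.T n) u)

theorem smul_scalar (B : LeftBialgebroid k A U) (u : U) (a : A) :
    u • B.scalar a = B.scalar (B.counit (u * B.src a)) := rfl

theorem smul_cons (B : LeftBialgebroid k A U) {n : ℕ} (u v : U) (x : B.T n) :
    u • B.cons v x = (B.mulOn v x (B.comul u) : B.Tens U (B.T n)) := rfl

theorem src_smul_cons (B : LeftBialgebroid k A U) {n : ℕ} (a : A) (v : U) (x : B.T n) :
    B.src a • B.cons v x = B.cons (B.src a * v) x := by
  rw [smul_cons, comul_src, mulOn_proj, opOn_tmul, one_smul]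
  rfl

theorem cons_balanced (B : LeftBialgebroid k A U) {n : ℕ} (a : A) (v : U) (x : B.T n) :
    B.cons (B.t a * v) x = B.cons v (B.src a • x) :=
  BalTensor.mk_balanced (k := k) (fun a : A => Algebra.lsmul k k U (B.t a))
      (fun a : A => Algebra.lsmul k k (B.T n) (B.src a)) a v x

theorem cons_add (B : LeftBialgebroid k A U) {n : ℕ} (u v : U) (x : B.T n) :
    B.cons (u + v) x = B.cons u x + B.cons v x := by
  have h : B.proj U (B.T n) ((u + v) ⊗ₜ x) = B.proj U (B.T n) (u ⊗ₜ x) + B.proj U (B.T n) (v ⊗ₜ x) := by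
    rw [TensorProduct.add_tmul, map_add]
  exact h

theorem cons_smul (B : LeftBialgebroid k A U) {n : ℕ} (c : k) (v : U) (x : B.T n) :
    B.cons (c • v) x = c • B.cons v x := by
  have h : B.proj U (B.T n) ((c • v) ⊗ₜ x) = c • B.proj U (B.T n) (v ⊗ₜ x) := by
    rw [← TensorProduct.smul_tmul', map_smul]
  exact h

theorem T_succ_induction (B : LeftBialgebroid k A U) {n : ℕ} {p : B.T (n + 1) → Prop}
    (z : B.T (n + 1)) (h : ∀ u x, p (B.cons u x)) (h0 : p 0)
    (hadd : ∀ x y, p x → p y → p (x + y)) : p z := by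
  obtain ⟨z, rfl⟩ := Submodule.mkQ_surjective _ z
  induction z with
  | zero => exact h0
  | add z z' hz hz' => rw [map_add]; exact hadd _ _ hz hz'
  | tmul u x => exact h u x

/-- Maps out of `U ⊗_A U^{⊗_A n}`. -/
def consLift (B : LeftBialgebroid k A U) {n : ℕ} {Q : Type*} [AddCommGroup Q] [Module k Q]
    (φ : U →ₗ[k] B.T n →ₗ[k] Q) (h : ∀ a u x, φ (B.t a * u) x = φ u (B.src a • x)) :
    B.T (n + 1) →ₗ[k] Q :=
  BalTensor.lift (fun a : A => Algebra.lsmul k k U (B.t a))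
    (fun a : A => Algebra.lsmul k k (B.T n) (B.src a)) φ h

theorem consLift_src_smul (B : LeftBialgebroid k A U) {n : ℕ} {Q : Type*} [AddCommGroup Q]
    [Module k Q] [Module U Q] (φ : U →ₗ[k] B.T n →ₗ[k] Q)
    (h : ∀ a u x, φ (B.t a * u) x = φ u (B.src a • x))
    (h' : ∀ a u x, φ (B.src a * u) x = B.src a • φ u x) (a : A) (z : B.T (n + 1)) :
    B.consLift φ h (B.src a • z) = B.src a • B.consLift φ h z := by
  refine B.T_succ_induction
    (p := fun z => B.consLift φ h (B.src a • z) = B.src a • B.consLift φ h z) z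
    (fun u x => ?_) ?_ ?_
  · rw [src_smul_cons]
    exact h' a u x
  · rw [smul_zero, map_zero, smul_zero]
  · intro x x' hx hx'
    rw [smul_add, map_add, map_add, hx, hx', smul_add]

/-- `a ↦ a ⊳ y = s(a) y` as a map on `A`. -/
def srcAct (B : LeftBialgebroid k A U) (N : LMod k U) (y : N.carrier) : A →ₗ[k] N.carrier where
  toFun a := B.src a • y
  map_add' a a' := by rw [map_add, add_smul]
  map_smul' c a := by rw [map_smul, smul_assoc, RingHom.id_apply]

/-- `x ↦ (x | y)`, by recursion on the degree of `x`: `(a | y) = a ⊳ y` for `a` in `A` and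
`((u | x) | y) = (u | (x | y))`. -/
def appendAux (B : LeftBialgebroid k A U) {b : ℕ} (y : B.T b) : (a : ℕ) →
    {φ : B.T a →ₗ[k] B.T (b + a) // ∀ c x, φ (B.src c • x) = B.src c • φ x}
  | 0 =>
    ⟨B.srcAct (B.tpow b) y, fun c (x : A) => by
      change B.src (B.counit (B.src c * B.src x)) • y = B.src c • B.src x • y
      rw [counit_src_mul, counit_src, map_mul, mul_smul]⟩
  | a + 1 =>
    ⟨B.consLift (LinearMap.mk₂ k (fun u x => B.cons u ((appendAux B y a).1 x))
        (fun u u' x => B.cons_add _ _ _)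
        (fun c u x => B.cons_smul _ _ _)
        (fun u x x' => by rw [map_add, map_add])
        (fun c u x => by rw [map_smul, map_smul]))
      (fun c u x => by
        rw [LinearMap.mk₂_apply, LinearMap.mk₂_apply, cons_balanced, (appendAux B y a).2]),
      B.consLift_src_smul _ _ fun c u x => by
        rw [LinearMap.mk₂_apply, LinearMap.mk₂_apply, src_smul_cons]⟩

/-- Concatenation `(x, y) ↦ (x | y)` from `U^{⊗_A a} × U^{⊗_A b}` to `U^{⊗_A (b + a)}`. -/
def append (B : LeftBialgebroid k A U) {a b : ℕ} (x : B.T a) (y : B.T b) : B.T (b + a) :=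
  (B.appendAux y a).1 x

theorem append_src_smul (B : LeftBialgebroid k A U) {a b : ℕ} (c : A) (x : B.T a) (y : B.T b) :
    B.append (B.src c • x) y = B.src c • B.append x y :=
  (B.appendAux y a).2 c x

theorem append_scalar (B : LeftBialgebroid k A U) {b : ℕ} (a : A) (y : B.T b) :
    B.append (B.scalar a) y = B.src a • y := rfl

theorem append_cons (B : LeftBialgebroid k A U) {a b : ℕ} (u : U) (x : B.T a) (y : B.T b) :
    B.append (B.cons u x) y = B.cons u (B.append x y) := rfl

/-- `y ↦ (y | 1)`, by recursion on the degree: `(a | 1) = a ⊳ 1 = (s(a) | 1_A)` for `a` in `A` and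
`((u | y) | 1) = (u | (y | 1))`. -/
def snocOneAux (B : LeftBialgebroid k A U) : (n : ℕ) →
    {φ : B.T n →ₗ[k] B.T (n + 1) // ∀ c x, φ (B.src c • x) = B.src c • φ x}
  | 0 => B.appendAux (B.cons 1 (B.scalar 1)) 0
  | n + 1 =>
    ⟨B.consLift (LinearMap.mk₂ k (fun u x => B.cons u ((snocOneAux B n).1 x))
        (fun u u' x => B.cons_add _ _ _)
        (fun c u x => B.cons_smul _ _ _)
        (fun u x x' => by rw [map_add, map_add])
        (fun c u x => by rw [map_smul, map_smul]))
      (fun c u x => by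
        rw [LinearMap.mk₂_apply, LinearMap.mk₂_apply, cons_balanced, (snocOneAux B n).2]),
      B.consLift_src_smul _ _ fun c u x => by
        rw [LinearMap.mk₂_apply, LinearMap.mk₂_apply, src_smul_cons]⟩

/-- `y ↦ (y | 1)`. -/
def snocOne (B : LeftBialgebroid k A U) {n : ℕ} (y : B.T n) : B.T (n + 1) := (B.snocOneAux n).1 y

theorem snocOne_cons (B : LeftBialgebroid k A U) {n : ℕ} (u : U) (y : B.T n) :
    B.snocOne (B.cons u y) = B.cons u (B.snocOne y) := rfl

/-- The element `Δ u = (u₍₁₎ | u₍₂₎)` of `U^{⊗_A 2}`. -/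
def comul₂ (B : LeftBialgebroid k A U) (u : U) : B.T 2 :=
  BalTensor.lift (fun a : A => Algebra.lsmul k k U (B.t a))
    (fun a : A => Algebra.lsmul k k U (B.src a))
    (LinearMap.mk₂ k (fun x y => B.cons x (B.cons y (B.scalar 1)))
      (fun x x' y => B.cons_add _ _ _) (fun c x y => B.cons_smul _ _ _)
      (fun x y y' => by rw [cons_add, map_add]) (fun c x y => by rw [cons_smul, map_smul]))
    (fun a x y => by
      simp only [LinearMap.mk₂_apply, Algebra.lsmul_coe, smul_eq_mul]
      rw [cons_balanced, src_smul_cons]) (B.comul u)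

end TensorPowers

/-! ### Left and right Hopf algebroids -/

/-- `U ⊗ U` modulo `u c(a) ⊗ v = u ⊗ c(a) v`. -/
abbrev TensMid (k : Type v) {A U : Type u} [CommRing k] [Ring U] [Algebra k U] (c : A → U) :
    Type u :=
  BalTensor (k := k) (fun a : A => LinearMap.mulRight k (c a))
    (fun a : A => LinearMap.mulLeft k (c a))

/-- The class of `u ⊗ v`. -/
abbrev TensMid.mk (k : Type v) {A U : Type u} [CommRing k] [Ring U] [Algebra k U] (c : A → U) :
    U ⊗[k] U →ₗ[k] TensMid k c :=
  BalTensor.mk (k := k) (fun a : A => LinearMap.mulRight k (c a))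
    (fun a : A => LinearMap.mulLeft k (c a))

theorem TensMid.balanced {k : Type v} {A U : Type u} [CommRing k] [Ring U] [Algebra k U]
    (c : A → U) (a : A) (x y : U) :
    TensMid.mk k c ((x * c a) ⊗ₜ y) = TensMid.mk k c (x ⊗ₜ (c a * y)) :=
  BalTensor.mk_balanced (k := k) (fun a : A => LinearMap.mulRight k (c a))
    (fun a : A => LinearMap.mulLeft k (c a)) a x y

/-- `x ⊗ y ↦ v x ⊗ y`. -/
def fstMul {k : Type v} {A U : Type u} [CommRing k] [Ring U] [Algebra k U]
    (c : A → U) (v : U) : TensMid k c →ₗ[k] TensMid k c :=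
  BalTensor.lift _ _ ((TensorProduct.mk k U U).compr₂ (TensMid.mk k c) ∘ₗ
    LinearMap.mulLeft k v) <| by
    intro b x y
    have := TensMid.balanced (k := k) c b (v * x) y
    rw [mul_assoc] at this
    exact this

/-- `x ⊗ y ↦ x ⊗ y v`. -/
def sndMul {k : Type v} {A U : Type u} [CommRing k] [Ring U] [Algebra k U]
    (c : A → U) (v : U) : TensMid k c →ₗ[k] TensMid k c :=
  BalTensor.lift _ _ (((TensorProduct.mk k U U).compr₂ (TensMid.mk k c)).compl₂
    (LinearMap.mulRight k v)) <| by
    intro b x y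
    have := TensMid.balanced (k := k) c b x (y * v)
    rw [← mul_assoc] at this
    exact this

theorem fstMul_mk {k : Type v} {A U : Type u} [CommRing k] [Ring U] [Algebra k U]
    (c : A → U) (v x y : U) :
    fstMul (k := k) c v (TensMid.mk k c (x ⊗ₜ y)) = TensMid.mk k c ((v * x) ⊗ₜ y) := by
  unfold fstMul
  exact (BalTensor.lift_mk _ _ _ _ _).trans (TensorProduct.lift.tmul _ _)

theorem sndMul_mk {k : Type v} {A U : Type u} [CommRing k] [Ring U] [Algebra k U]
    (c : A → U) (v x y : U) :
    sndMul (k := k) c v (TensMid.mk k c (x ⊗ₜ y)) = TensMid.mk k c (x ⊗ₜ (y * v)) := by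
  unfold sndMul
  exact (BalTensor.lift_mk _ _ _ _ _).trans (TensorProduct.lift.tmul _ _)

section Hopf

variable {k : Type v} {A U : Type u} [CommRing k] [Ring A] [Algebra k A] [Ring U] [Algebra k U]

/-- `U ⊗_{Aᵒᵖ} U` with `u t(a) ⊗ v = u ⊗ t(a) v`. -/
abbrev TensL (B : LeftBialgebroid k A U) : Type u := TensMid k B.t

/-- `U ⊗_A U` with `u s(a) ⊗ v = u ⊗ s(a) v`. -/
abbrev TensR (B : LeftBialgebroid k A U) : Type u := TensMid k B.src

theorem comul_mul_t (B : LeftBialgebroid k A U) (u : U) (X : U ⊗[k] U)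
    (hX : B.proj U U X = B.comul u) (a : A) :
    B.comul (u * B.t a) = B.proj U U (X * (1 ⊗ₜ B.t a)) :=
  B.comul_mul _ _ _ _ hX (B.comul_t a).symm

theorem comul_mul_src (B : LeftBialgebroid k A U) (u : U) (X : U ⊗[k] U)
    (hX : B.proj U U X = B.comul u) (a : A) :
    B.comul (u * B.src a) = B.proj U U (X * (B.src a ⊗ₜ 1)) :=
  B.comul_mul _ _ _ _ hX (B.comul_src a).symm

/-- The Hopf-Galois map `u ⊗ v ↦ u₍₁₎ ⊗_A u₍₂₎ v`. -/
def galL (B : LeftBialgebroid k A U) : B.TensL →ₗ[k] B.Tens U U :=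
  BalTensor.lift _ _ (LinearMap.mk₂ k (fun u v => B.mulOn (1 : U) v (B.comul u))
    (fun u u' v => by rw [map_add, map_add])
    (fun c u v => by rw [map_smul, map_smul])
    (fun u v v' => by
      obtain ⟨X, hX⟩ := B.exists_rep u
      simp only [← hX, mulOn_proj, TensorProduct.tmul_add, map_add])
    (fun c u v => by
      obtain ⟨X, hX⟩ := B.exists_rep u
      simp only [← hX, mulOn_proj, TensorProduct.tmul_smul, map_smul])) <| by
    intro a u v
    obtain ⟨X, hX⟩ := B.exists_rep u
    simp only [LinearMap.mk₂_apply, LinearMap.mulRight_apply, LinearMap.mulLeft_apply]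
    rw [B.comul_mul_t u X hX, ← hX, mulOn_proj, mulOn_proj, opOn_mul, opOn_tmul, one_smul,
      smul_eq_mul]

/-- The Hopf-Galois map `u ⊗ v ↦ u₍₁₎ v ⊗_A u₍₂₎`. -/
def galR (B : LeftBialgebroid k A U) : B.TensR →ₗ[k] B.Tens U U :=
  BalTensor.lift _ _ (LinearMap.mk₂ k (fun u v => B.mulOn v (1 : U) (B.comul u))
    (fun u u' v => by rw [map_add, map_add])
    (fun c u v => by rw [map_smul, map_smul])
    (fun u v v' => by
      obtain ⟨X, hX⟩ := B.exists_rep u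
      simp only [← hX, mulOn_proj, TensorProduct.add_tmul, map_add])
    (fun c u v => by
      obtain ⟨X, hX⟩ := B.exists_rep u
      simp only [← hX, mulOn_proj, ← TensorProduct.smul_tmul', map_smul])) <| by
    intro a u v
    obtain ⟨X, hX⟩ := B.exists_rep u
    simp only [LinearMap.mk₂_apply, LinearMap.mulRight_apply, LinearMap.mulLeft_apply]
    rw [B.comul_mul_src u X hX, ← hX, mulOn_proj, mulOn_proj, opOn_mul, opOn_tmul, one_smul,
      smul_eq_mul]

/-- `B` is a left Hopf algebroid. -/
def IsLeftHopf (B : LeftBialgebroid k A U) : Prop := Function.Bijective B.galL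

/-- `B` is a right Hopf algebroid. -/
def IsRightHopf (B : LeftBialgebroid k A U) : Prop := Function.Bijective B.galR

/-- The translation map `u ↦ u₊ ⊗ u₋`, the preimage of `u ⊗_A 1` under `galL`. -/
noncomputable def trL {B : LeftBialgebroid k A U} (hL : B.IsLeftHopf) : U →ₗ[k] B.TensL :=
  (LinearEquiv.ofBijective B.galL hL).symm.toLinearMap.comp
    ((B.proj U U).comp ((TensorProduct.mk k U U).flip 1))

/-- The translation map `u ↦ u₍₊₎ ⊗ u₍₋₎` (square brackets in the usual notation), the preimage of
`1 ⊗_A u` under `galR`. -/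
noncomputable def trR {B : LeftBialgebroid k A U} (hR : B.IsRightHopf) : U →ₗ[k] B.TensR :=
  (LinearEquiv.ofBijective B.galR hR).symm.toLinearMap.comp
    ((B.proj U U).comp (TensorProduct.mk k U U 1))

theorem galL_trL {B : LeftBialgebroid k A U} (hL : B.IsLeftHopf) (u : U) :
    B.galL (trL hL u) = B.proj U U (u ⊗ₜ 1) :=
  LinearEquiv.apply_symm_apply (LinearEquiv.ofBijective B.galL hL) _

theorem galR_trR {B : LeftBialgebroid k A U} (hR : B.IsRightHopf) (u : U) :
    B.galR (trR hR u) = B.proj U U (1 ⊗ₜ u) :=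
  LinearEquiv.apply_symm_apply (LinearEquiv.ofBijective B.galR hR) _

theorem galL_mk (B : LeftBialgebroid k A U) (u v : U) :
    B.galL (TensMid.mk k B.t (u ⊗ₜ v)) = B.mulOn (1 : U) v (B.comul u) := by
  unfold galL
  exact (BalTensor.lift_mk _ _ _ _ _).trans (TensorProduct.lift.tmul _ _)


theorem galR_mk (B : LeftBialgebroid k A U) (u v : U) :
    B.galR (TensMid.mk k B.src (u ⊗ₜ v)) = B.mulOn v (1 : U) (B.comul u) := by
  unfold galR
  exact (BalTensor.lift_mk _ _ _ _ _).trans (TensorProduct.lift.tmul _ _)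


theorem mulOn_comul_mul (B : LeftBialgebroid k A U) (x y u v : U) :
    B.mulOn (N := U) (P := U) x y (B.comul (u * v)) =
      B.diag (N := U) (P := U) u (B.mulOn (N := U) (P := U) x y (B.comul v)) := by
  obtain ⟨X, hX⟩ := B.exists_rep u
  obtain ⟨Y, hY⟩ := B.exists_rep v
  rw [B.comul_mul u v X Y hX hY, ← hY, mulOn_proj, mulOn_proj, opOn_mul, B.diag_proj u X hX]

theorem mulOn_mulOn (B : LeftBialgebroid k A U) (x y x' y' : U) (z : B.Tens U U) :
    B.mulOn x' y' (B.mulOn x y z) = B.mulOn (x * x') (y * y') z := by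
  obtain ⟨z, rfl⟩ := Submodule.mkQ_surjective _ z
  change B.mulOn x' y' (B.mulOn x y (B.proj U U z)) = B.mulOn (x * x') (y * y') (B.proj U U z)
  induction z with
  | zero => simp only [map_zero]
  | add z z' h h' => simp only [map_add, h, h']
  | tmul p q =>
    change B.proj U U (((p * x) * x') ⊗ₜ ((q * y) * y')) =
      B.proj U U ((p * (x * x')) ⊗ₜ (q * (y * y')))
    rw [mul_assoc, mul_assoc]

theorem galL_fstMul (B : LeftBialgebroid k A U) (v : U) (z : B.TensL) :
    B.galL (fstMul B.t v z) = B.diag (N := U) (P := U) v (B.galL z) := by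
  have h : B.galL ∘ₗ fstMul B.t v = B.diag (N := U) (P := U) v ∘ₗ B.galL :=
    BalTensor.hom_ext fun x y => by
      rw [LinearMap.comp_apply, LinearMap.comp_apply]
      exact (congrArg B.galL (fstMul_mk B.t v x y)).trans ((B.galL_mk _ _).trans
        ((B.mulOn_comul_mul (1 : U) y v x).trans
          (congrArg (B.diag (N := U) (P := U) v) (B.galL_mk x y).symm)))
  exact LinearMap.congr_fun h z

theorem galR_fstMul (B : LeftBialgebroid k A U) (v : U) (z : B.TensR) :
    B.galR (fstMul B.src v z) = B.diag (N := U) (P := U) v (B.galR z) := by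
  have h : B.galR ∘ₗ fstMul B.src v = B.diag (N := U) (P := U) v ∘ₗ B.galR :=
    BalTensor.hom_ext fun x y => by
      rw [LinearMap.comp_apply, LinearMap.comp_apply]
      exact (congrArg B.galR (fstMul_mk B.src v x y)).trans ((B.galR_mk _ _).trans
        ((B.mulOn_comul_mul y (1 : U) v x).trans
          (congrArg (B.diag (N := U) (P := U) v) (B.galR_mk x y).symm)))
  exact LinearMap.congr_fun h z

theorem galL_sndMul (B : LeftBialgebroid k A U) (v : U) (z : B.TensL) :
    B.galL (sndMul B.t v z) = B.mulOn (1 : U) v (B.galL z) := by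
  have h : B.galL ∘ₗ sndMul B.t v = B.mulOn (1 : U) v ∘ₗ B.galL :=
    BalTensor.hom_ext fun x y => by
      have h := B.mulOn_mulOn (1 : U) y 1 v (B.comul x)
      rw [mul_one] at h
      rw [LinearMap.comp_apply, LinearMap.comp_apply]
      exact (congrArg B.galL (sndMul_mk B.t v x y)).trans ((B.galL_mk _ _).trans
        (h.symm.trans (congrArg (B.mulOn (N := U) (P := U) (1 : U) v) (B.galL_mk x y).symm)))
  exact LinearMap.congr_fun h z

theorem galR_sndMul (B : LeftBialgebroid k A U) (v : U) (z : B.TensR) :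
    B.galR (sndMul B.src v z) = B.mulOn v (1 : U) (B.galR z) := by
  have h : B.galR ∘ₗ sndMul B.src v = B.mulOn v (1 : U) ∘ₗ B.galR :=
    BalTensor.hom_ext fun x y => by
      have h := B.mulOn_mulOn y (1 : U) v 1 (B.comul x)
      rw [mul_one] at h
      rw [LinearMap.comp_apply, LinearMap.comp_apply]
      exact (congrArg B.galR (sndMul_mk B.src v x y)).trans ((B.galR_mk _ _).trans
        (h.symm.trans (congrArg (B.mulOn (N := U) (P := U) v (1 : U)) (B.galR_mk x y).symm)))
  exact LinearMap.congr_fun h z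

/-- `s(a) u₍₊₎ ⊗ u₍₋₎ = u₍₊₎ ⊗ u₍₋₎ s(a)`. -/
theorem fstMul_src_trR {B : LeftBialgebroid k A U} (hR : B.IsRightHopf) (a : A) (u : U) :
    fstMul B.src (B.src a) (trR hR u) = sndMul B.src (B.src a) (trR hR u) := by
  apply hR.1
  rw [galR_fstMul, galR_sndMul, galR_trR, B.diag_proj _ _ (B.comul_src a).symm, mulOn_proj]
  simp

/-- `t(a) u₊ ⊗ u₋ = u₊ ⊗ u₋ t(a)`. -/
theorem fstMul_t_trL {B : LeftBialgebroid k A U} (hL : B.IsLeftHopf) (a : A) (u : U) :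
    fstMul B.t (B.t a) (trL hL u) = sndMul B.t (B.t a) (trL hL u) := by
  apply hL.1
  rw [galL_fstMul, galL_sndMul, galL_trL, B.diag_proj _ _ (B.comul_t a).symm, mulOn_proj]
  simp

theorem trR_t_mul {B : LeftBialgebroid k A U} (hR : B.IsRightHopf) (a : A) (u : U) :
    trR hR (B.t a * u) = fstMul B.src (B.t a) (trR hR u) := by
  apply hR.1
  rw [galR_fstMul, galR_trR, galR_trR, B.diag_proj _ _ (B.comul_t a).symm]
  simp

end Hopf

/-! ### Hom spaces -/

section Hom

variable {k : Type v} {A U : Type u} [CommRing k] [Ring A] [Algebra k A] [Ring U] [Algebra k U]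

section HomAop

variable {M : Type w} [AddCommGroup M] [Module k M] [Module Aᵐᵒᵖ M]

variable (M) in
/-- `Hom_{Aᵒᵖ}(U_⊲, M)` for a right `A`-module `M`: maps with `f(t(a) z) = f(z) a`. -/
def HomAop (B : LeftBialgebroid k A U) [IsScalarTower k Aᵐᵒᵖ M] : Submodule k (U →ₗ[k] M) where
  carrier := {f | ∀ a z, f (B.t a * z) = MulOpposite.op a • f z}
  add_mem' {f g} hf hg a z := by
    rw [LinearMap.add_apply, LinearMap.add_apply, hf, hg, smul_add]
  zero_mem' a z := by rw [LinearMap.zero_apply, LinearMap.zero_apply, smul_zero]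
  smul_mem' c f hf a z := by
    rw [LinearMap.smul_apply, LinearMap.smul_apply, hf, smul_comm]

variable [IsScalarTower k Aᵐᵒᵖ M]

/-- `f ↦ f(s(a) -)`. -/
def lmulSrc (B : LeftBialgebroid k A U) (a : A) (f : B.HomAop M) : B.HomAop M :=
  ⟨f.1.comp (LinearMap.mulLeft k (B.src a)), fun b z => by
    simp only [LinearMap.comp_apply, LinearMap.mulLeft_apply]
    rw [← mul_assoc, src_t, mul_assoc, f.2]⟩

/-- `(x, f) ↦ f(- x)`. -/
def rmul (B : LeftBialgebroid k A U) : U →ₗ[k] B.HomAop M →ₗ[k] B.HomAop M :=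
  LinearMap.mk₂ k (fun x f => ⟨f.1.comp (LinearMap.mulRight k x), fun b z => by
      simp only [LinearMap.comp_apply, LinearMap.mulRight_apply]
      rw [mul_assoc, f.2]⟩)
    (fun x x' f => Subtype.ext <| LinearMap.ext fun z => by
      change f.1 (z * (x + x')) = f.1 (z * x) + f.1 (z * x')
      rw [mul_add, map_add])
    (fun c x f => Subtype.ext <| LinearMap.ext fun z => by
      change f.1 (z * (c • x)) = c • f.1 (z * x)
      rw [mul_smul_comm, map_smul])
    (fun x f f' => rfl) (fun c x f => rfl)

/-- `m ε(-)`. -/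
def epsHom (B : LeftBialgebroid k A U) (m : M) : B.HomAop M :=
  ⟨{  toFun := fun z => MulOpposite.op (B.counit z) • m
      map_add' := fun z z' => by rw [map_add, MulOpposite.op_add, add_smul]
      map_smul' := fun c z => by
        rw [map_smul, MulOpposite.op_smul, smul_assoc, RingHom.id_apply] }, fun a z => by
    change MulOpposite.op (B.counit (B.t a * z)) • m =
      MulOpposite.op a • MulOpposite.op (B.counit z) • m
    rw [counit_t_mul, MulOpposite.op_mul, mul_smul]⟩

/-- `x ↦ g(x ⊗_A -)` for `g` in `Hom_{Aᵒᵖ}(U_⊲ ⊗_A U, M)`. -/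
def curryHom (B : LeftBialgebroid k A U) (g : B.Tens U U →ₗ[k] M)
    (hg : ∀ a x y, g (B.proj U U (x ⊗ₜ (B.t a * y))) =
      MulOpposite.op a • g (B.proj U U (x ⊗ₜ y))) : U →ₗ[k] B.HomAop M where
  toFun x := ⟨(g.comp (B.proj U U)).comp (TensorProduct.mk k U U x), fun a y => hg a x y⟩
  map_add' x x' := Subtype.ext <| LinearMap.ext fun y => by
    change g (B.proj U U ((x + x') ⊗ₜ y)) = g (B.proj U U (x ⊗ₜ y)) + g (B.proj U U (x' ⊗ₜ y))
    rw [TensorProduct.add_tmul, map_add, map_add]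
  map_smul' c x := Subtype.ext <| LinearMap.ext fun y => by
    change g (B.proj U U ((c • x) ⊗ₜ y)) = c • g (B.proj U U (x ⊗ₜ y))
    rw [← TensorProduct.smul_tmul', map_smul, map_smul]

/-- `x ↦ γ(g(x ⊗_A -))`. -/
def innerContra (B : LeftBialgebroid k A U) (γ : B.HomAop M →ₗ[k] M)
    (hγ : ∀ a f, γ (B.lmulSrc a f) = MulOpposite.op a • γ f) (g : B.Tens U U →ₗ[k] M)
    (hg : ∀ a x y, g (B.proj U U (x ⊗ₜ (B.t a * y))) =
      MulOpposite.op a • g (B.proj U U (x ⊗ₜ y))) : B.HomAop M :=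
  ⟨γ.comp (B.curryHom g hg), fun a x => by
    rw [LinearMap.comp_apply, LinearMap.comp_apply, ← hγ]
    congr 1
    refine Subtype.ext (LinearMap.ext fun y => ?_)
    exact congrArg g (BalTensor.mk_balanced (k := k) (fun a : A => Algebra.lsmul k k U (B.t a))
      (fun a : A => Algebra.lsmul k k U (B.src a)) a x y)⟩

/-- `z ↦ g(Δ z)`. -/
def comulHom (B : LeftBialgebroid k A U) (g : B.Tens U U →ₗ[k] M)
    (hg : ∀ a x y, g (B.proj U U (x ⊗ₜ (B.t a * y))) =
      MulOpposite.op a • g (B.proj U U (x ⊗ₜ y))) : B.HomAop M :=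
  ⟨g.comp B.comul, fun a z => by
    obtain ⟨X, hX⟩ := B.exists_rep z
    have h := B.comul_bimod 1 a z X hX
    rw [map_one, one_mul] at h
    rw [LinearMap.comp_apply, LinearMap.comp_apply, h, ← hX]
    clear h hX
    induction X with
    | zero => simp
    | add X X' h h' => simp only [mul_add, map_add, h, h', smul_add]
    | tmul x y =>
      rw [Algebra.TensorProduct.tmul_mul_tmul, one_mul]
      exact hg a x y⟩

end HomAop

section HomA

variable {N : Type*} [AddCommGroup N] [Module k N] [Module U N] [IsScalarTower k U N]
  {M : Type w} [AddCommGroup M] [Module k M] [Module U M] [IsScalarTower k U M]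

variable (N M) in
/-- `Hom_A(N, M)` for left `U`-modules `N` and `M`: maps with `f(a ⊳ x) = a ⊳ f(x)`. -/
def HomA (B : LeftBialgebroid k A U) : Submodule k (N →ₗ[k] M) where
  carrier := {f | ∀ a x, f (B.src a • x) = B.src a • f x}
  add_mem' {f g} hf hg a z := by
    rw [LinearMap.add_apply, LinearMap.add_apply, hf, hg, smul_add]
  zero_mem' a z := by rw [LinearMap.zero_apply, LinearMap.zero_apply, smul_zero]
  smul_mem' c f hf a z := by
    rw [LinearMap.smul_apply, LinearMap.smul_apply, hf, smul_comm]

/-- `x ⊗ y ↦ x g(y n)`. -/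
def evalR (B : LeftBialgebroid k A U) (g : B.HomA N M) (n : N) : B.TensR →ₗ[k] M :=
  BalTensor.lift _ _ (LinearMap.mk₂ k (fun x y => x • g.1 (y • n))
    (fun x x' y => by rw [add_smul]) (fun c x y => by rw [smul_assoc])
    (fun x y y' => by rw [add_smul, map_add, smul_add])
    (fun c x y => by rw [smul_assoc, map_smul, smul_comm])) <| by
    intro a x y
    simp only [LinearMap.mk₂_apply, LinearMap.mulRight_apply, LinearMap.mulLeft_apply]
    rw [mul_smul, mul_smul, g.2]

@[simp] theorem evalR_mk (B : LeftBialgebroid k A U) (g : B.HomA N M) (n : N) (x y : U) :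
    B.evalR g n (TensMid.mk k B.src (x ⊗ₜ y)) = x • g.1 (y • n) := rfl

/-- The left `U`-action `(u ▷ g)(n) = u₍₊₎ g(u₍₋₎ n)` on `Hom_A(N, M)` over a right Hopf algebroid. -/
noncomputable def rAct {B : LeftBialgebroid k A U} (hR : B.IsRightHopf) (u : U) (g : B.HomA N M) :
    B.HomA N M :=
  ⟨{  toFun := fun n => B.evalR g n (trR hR u)
      map_add' := fun n n' => by
        have h : B.evalR g (n + n') = B.evalR g n + B.evalR g n' :=
          BalTensor.hom_ext fun x y => by
            rw [LinearMap.add_apply]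
            simp only [evalR_mk, smul_add, map_add]
        rw [h, LinearMap.add_apply]
      map_smul' := fun c n => by
        have h : B.evalR g (c • n) = c • B.evalR g n :=
          BalTensor.hom_ext fun x y => by
            rw [LinearMap.smul_apply]
            simp only [evalR_mk]
            rw [smul_comm y c n, map_smul, smul_comm]
        rw [h, LinearMap.smul_apply, RingHom.id_apply] }, fun a n => by
    have h : B.evalR g (B.src a • n) = B.evalR g n ∘ₗ sndMul B.src (B.src a) :=
      BalTensor.hom_ext fun x y => by
        change x • g.1 (y • B.src a • n) = x • g.1 ((y * B.src a) • n)
        rw [mul_smul]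
    have h' : (Algebra.lsmul k k M (B.src a)) ∘ₗ B.evalR g n =
        B.evalR g n ∘ₗ fstMul B.src (B.src a) :=
      BalTensor.hom_ext fun x y => by
        change B.src a • x • g.1 (y • n) = (B.src a * x) • g.1 (y • n)
        rw [mul_smul]
    change B.evalR g (B.src a • n) (trR hR u) = B.src a • B.evalR g n (trR hR u)
    rw [h, LinearMap.comp_apply, ← fstMul_src_trR, ← LinearMap.comp_apply, ← h']
    rfl⟩

variable [Module Aᵐᵒᵖ M] [IsScalarTower k Aᵐᵒᵖ M]

/-- `u ↦ (u ▷ g)(n)` as an element of `Hom_{Aᵒᵖ}(U_⊲, M)`. -/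
noncomputable def rHom {B : LeftBialgebroid k A U} (hR : B.IsRightHopf)
    (hM : ∀ (a : A) (m : M), B.t a • m = MulOpposite.op a • m) (g : B.HomA N M) (n : N) :
    B.HomAop M :=
  ⟨B.evalR g n ∘ₗ trR hR, fun a u => by
    have h' : (Algebra.lsmul k k M (B.t a)) ∘ₗ B.evalR g n =
        B.evalR g n ∘ₗ fstMul B.src (B.t a) :=
      BalTensor.hom_ext fun x y => by
        change B.t a • x • g.1 (y • n) = (B.t a * x) • g.1 (y • n)
        rw [mul_smul]
    rw [LinearMap.comp_apply, LinearMap.comp_apply, trR_t_mul, ← hM, ← LinearMap.comp_apply, ← h']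
    rfl⟩

/-- `x ⊗ y ↦ x f(y z)`. -/
def evalL (B : LeftBialgebroid k A U)
    (hM : ∀ (a : A) (m : M), B.t a • m = MulOpposite.op a • m) (f : B.HomAop M) (z : U) :
    B.TensL →ₗ[k] M :=
  BalTensor.lift _ _ (LinearMap.mk₂ k (fun x y => x • f.1 (y * z))
    (fun x x' y => by rw [add_smul]) (fun c x y => by rw [smul_assoc])
    (fun x y y' => by rw [add_mul, map_add, smul_add])
    (fun c x y => by rw [smul_mul_assoc, map_smul, smul_comm])) <| by
    intro a x y
    simp only [LinearMap.mk₂_apply, LinearMap.mulRight_apply, LinearMap.mulLeft_apply]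
    rw [mul_smul, mul_assoc, f.2, hM]

@[simp] theorem evalL_mk (B : LeftBialgebroid k A U)
    (hM : ∀ (a : A) (m : M), B.t a • m = MulOpposite.op a • m) (f : B.HomAop M) (z x y : U) :
    B.evalL hM f z (TensMid.mk k B.t (x ⊗ₜ y)) = x • f.1 (y * z) := rfl

/-- The left `U`-action `(u ▷ f)(z) = u₊ f(u₋ z)` on `Hom_{Aᵒᵖ}(U_⊲, M)` over a left Hopf
algebroid, as a map `u ↦ u ▷ f`. -/
noncomputable def lAct {B : LeftBialgebroid k A U} (hL : B.IsLeftHopf)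
    (hM : ∀ (a : A) (m : M), B.t a • m = MulOpposite.op a • m) (f : B.HomAop M) :
    U →ₗ[k] B.HomAop M where
  toFun u := ⟨{  toFun := fun z => B.evalL hM f z (trL hL u)
                 map_add' := fun z z' => by
                  have h : B.evalL hM f (z + z') = B.evalL hM f z + B.evalL hM f z' :=
                    BalTensor.hom_ext fun x y => by
                      rw [LinearMap.add_apply]
                      simp only [evalL_mk, mul_add, smul_add, map_add]
                  rw [h, LinearMap.add_apply]
                 map_smul' := fun c z => by
                  have h : B.evalL hM f (c • z) = c • B.evalL hM f z :=
                    BalTensor.hom_ext fun x y => by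
                      rw [LinearMap.smul_apply]
                      simp only [evalL_mk]
                      rw [mul_smul_comm, map_smul, smul_comm]
                  rw [h, LinearMap.smul_apply, RingHom.id_apply] }, fun a z => by
    have h : B.evalL hM f (B.t a * z) = B.evalL hM f z ∘ₗ sndMul B.t (B.t a) :=
      BalTensor.hom_ext fun x y => by
        change x • f.1 (y * (B.t a * z)) = x • f.1 (y * B.t a * z)
        rw [mul_assoc]
    have h' : (Algebra.lsmul k k M (B.t a)) ∘ₗ B.evalL hM f z =
        B.evalL hM f z ∘ₗ fstMul B.t (B.t a) :=
      BalTensor.hom_ext fun x y => by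
        change B.t a • x • f.1 (y * z) = (B.t a * x) • f.1 (y * z)
        rw [mul_smul]
    change B.evalL hM f (B.t a * z) (trL hL u) = MulOpposite.op a • B.evalL hM f z (trL hL u)
    rw [h, LinearMap.comp_apply, ← fstMul_t_trL, ← LinearMap.comp_apply, ← h', ← hM]
    rfl⟩
  map_add' u u' := Subtype.ext <| LinearMap.ext fun z => by
    change B.evalL hM f z (trL hL (u + u')) =
      B.evalL hM f z (trL hL u) + B.evalL hM f z (trL hL u')
    rw [map_add, map_add]
  map_smul' c u := Subtype.ext <| LinearMap.ext fun z => by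
    change B.evalL hM f z (trL hL (c • u)) = c • B.evalL hM f z (trL hL u)
    rw [map_smul, map_smul]

end HomA

end Hom

end LeftBialgebroid

/-! ### Contramodules -/

/-- A right contramodule `(M, γ)` over a left bialgebroid. -/
structure Contramodule {k : Type v} {A U : Type u} [CommRing k] [Ring A] [Algebra k A] [Ring U]
    [Algebra k U] (B : LeftBialgebroid k A U) (M : Type w) [AddCommGroup M] [Module k M]
    [Module Aᵐᵒᵖ M] [IsScalarTower k Aᵐᵒᵖ M] where
  /-- the contraaction `γ : Hom_{Aᵒᵖ}(U_⊲, M) → M` -/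
  γ : B.HomAop M →ₗ[k] M
  /-- right `A`-linearity, `γ(f(s(a) -)) = γ(f) a` -/
  γ_right : ∀ a f, γ (B.lmulSrc a f) = MulOpposite.op a • γ f
  /-- contraassociativity, `γ(x ↦ γ(g(x ⊗_A -))) = γ(z ↦ g(Δ z))` -/
  γ_assoc : ∀ (g : B.Tens U U →ₗ[k] M)
    (hg : ∀ a x y, g (B.proj U U (x ⊗ₜ (B.t a * y))) =
      MulOpposite.op a • g (B.proj U U (x ⊗ₜ y))),
    γ (B.innerContra γ γ_right g hg) = γ (B.comulHom g hg)
  /-- contraunitality, `γ(m ε(-)) = m` -/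
  γ_unit : ∀ m, γ (B.epsHom m) = m

/-- An anti Yetter-Drinfel'd contramodule over a left Hopf algebroid. -/
structure AYDContramodule {k : Type v} {A U : Type u} [CommRing k] [Ring A] [Algebra k A] [Ring U]
    [Algebra k U] (B : LeftBialgebroid k A U) (hL : B.IsLeftHopf)
    (M : Type w) [AddCommGroup M] [Module k M]
    [Module U M] [IsScalarTower k U M] [Module Aᵐᵒᵖ M] [IsScalarTower k Aᵐᵒᵖ M]
    extends Contramodule B M where
  /-- the two right `A`-actions agree: `t(a) m = m a` -/
  right_eq : ∀ (a : A) (m : M), B.t a • m = MulOpposite.op a • m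
  /-- the two left `A`-actions agree: `s(a) m = γ(m ε(- s(a)))` -/
  left_eq : ∀ (a : A) (m : M), B.src a • m = γ (B.rmul (B.src a) (B.epsHom m))
  /-- compatibility of action and contraaction,
  `u γ(f) = γ(u₍₂₎₊ f(u₍₂₎₋ - u₍₁₎))`, that is, `u γ(f) = ∑ γ((y ▷ f)(- x))` whenever
  `Δ u = ∑ x ⊗_A y` and `(y ▷ f)(z) = y₊ f(y₋ z)`. Since
  `u₊₍₁₎ ⊗ u₊₍₂₎ ⊗ u₋ = u₍₁₎ ⊗ u₍₂₎₊ ⊗ u₍₂₎₋` this is `u γ(f) = γ(u₊₍₂₎ f(u₋ - u₊₍₁₎))`. -/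
  compat : ∀ (u : U) (f : B.HomAop M) (X : U ⊗[k] U), B.proj U U X = B.comul u →
    u • γ f = TensorProduct.lift ((B.rmul.compl₂ (LeftBialgebroid.lAct hL right_eq f)).compr₂ γ) X

section Coefficients

variable {k : Type v} {A U : Type u} [CommRing k] [Ring A] [Algebra k A] [Ring U] [Algebra k U]
  {B : LeftBialgebroid k A U} {hL : B.IsLeftHopf}
  {M : Type w} [AddCommGroup M] [Module k M] [Module U M] [IsScalarTower k U M]
  [Module Aᵐᵒᵖ M] [IsScalarTower k Aᵐᵒᵖ M]

/-- `u ↦ u m` as an element of `Hom_{Aᵒᵖ}(U_⊲, M)`. -/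
def AYDContramodule.actHom (Y : AYDContramodule B hL M) (m : M) : B.HomAop M :=
  ⟨(LinearMap.toSpanSingleton U M m).restrictScalars k, fun a z => by
    change (B.t a * z) • m = MulOpposite.op a • z • m
    rw [mul_smul, Y.right_eq]⟩

/-- Stability, `γ(u ↦ u m) = m`. -/
def AYDContramodule.IsStable (Y : AYDContramodule B hL M) : Prop := ∀ m, Y.γ (Y.actHom m) = m

/-- For a right Hopf algebroid, `Y.tr hR g x` is the map `u ↦ (u ▷ g)(x) = u₍₊₎ g(u₍₋₎ x)` in
`Hom_{Aᵒᵖ}(U_⊲, M)`, for `g` in `Hom_A(N, M)` and `x` in a left `U`-module `N`. -/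
noncomputable def AYDContramodule.tr {N : Type*} [AddCommGroup N] [Module k N] [Module U N]
    [IsScalarTower k U N] (Y : AYDContramodule B hL M) (hR : B.IsRightHopf) (g : B.HomA N M)
    (x : N) : B.HomAop M :=
  LeftBialgebroid.rHom hR Y.right_eq g x

end Coefficients

namespace LeftBialgebroid

section Chains

variable {k : Type v} {A U : Type u} [CommRing k] [Ring A] [Algebra k A] [Ring U] [Algebra k U]
  (M : Type w) [AddCommGroup M] [Module k M] [Module U M] [IsScalarTower k U M]

/-- The chain space `C_n(U, M) = Hom_A(U^{⊗_A n}, M)`. -/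
abbrev Chain (B : LeftBialgebroid k A U) (n : ℕ) : Type (max u w) := B.HomA (B.T n) M

variable {M}

/-- `x ↦ f(x | y)`. -/
def consHom (B : LeftBialgebroid k A U) {n : ℕ} (f : B.Chain M (n + 1)) (y : B.T n) : B.HomA U M :=
  ⟨{  toFun := fun x => f.1 (B.cons x y)
      map_add' := fun x x' => by rw [cons_add, map_add]
      map_smul' := fun c x => by rw [cons_smul, map_smul, RingHom.id_apply] }, fun a x => by
    change f.1 (B.cons (B.src a * x) y) = B.src a • f.1 (B.cons x y)
    rw [← src_smul_cons, f.2]⟩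

/-- `x ↦ f(x ⊳ w | y)`. -/
def fillHom (B : LeftBialgebroid k A U) {p n : ℕ} (f : B.Chain M (n + p)) (w : B.T p) (y : B.T n) :
    B.HomA U M :=
  ⟨{  toFun := fun x => f.1 (B.append (x • w) y)
      map_add' := fun x x' => by rw [add_smul, append, map_add, map_add]; rfl
      map_smul' := fun c x => by rw [smul_assoc, append, map_smul, map_smul]; rfl }, fun a x => by
    change f.1 (B.append ((B.src a * x) • w) y) = B.src a • f.1 (B.append (x • w) y)
    rw [mul_smul, append_src_smul, f.2]⟩

end Chains

end LeftBialgebroid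

/-! ### Operads, cyclic opposite modules, cyclic modules -/

/-- A non-symmetric unital operad with multiplication `(O, μ, e)` in `k`-modules. The partial
composition `comp i h : O(p) → O(q) → O(r)` is defined for all `p`, `q`, `r` with `p + q = r + 1`, so
that `r = p + q - 1`. -/
structure OperadWithMultiplication (k : Type*) [CommRing k] (O : ℕ → Type*)
    [∀ n, AddCommGroup (O n)] [∀ n, Module k (O n)] where
  /-- the partial composition `φ ∘_i ψ` -/
  comp : ∀ (i : ℕ) {p q r : ℕ}, p + q = r + 1 → O p →ₗ[k] O q →ₗ[k] O r
  comp_zero : ∀ (i : ℕ) {p q r : ℕ} (h : p + q = r + 1) (φ : O p) (ψ : O q),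
    ¬ (1 ≤ i ∧ i ≤ p) → comp i h φ ψ = 0
  /-- `(φ ∘_i ψ) ∘_j χ = (φ ∘_j χ) ∘_{i+r-1} ψ` for `j < i` -/
  comp_comp_lt : ∀ {p q r m m' n i j : ℕ} (h₁ : p + q = m + 1) (h₂ : m + r = n + 1)
    (h₃ : p + r = m' + 1) (h₄ : m' + q = n + 1) (φ : O p) (ψ : O q) (χ : O r),
    1 ≤ j → j < i → i ≤ p →
    comp j h₂ (comp i h₁ φ ψ) χ = comp (i + r - 1) h₄ (comp j h₃ φ χ) ψ
  /-- `(φ ∘_i ψ) ∘_j χ = φ ∘_i (ψ ∘_{j-i+1} χ)` for `i ≤ j < q + i` -/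
  comp_comp_mid : ∀ {p q r m m' n i j : ℕ} (h₁ : p + q = m + 1) (h₂ : m + r = n + 1)
    (h₃ : q + r = m' + 1) (h₄ : p + m' = n + 1) (φ : O p) (ψ : O q) (χ : O r),
    1 ≤ i → i ≤ p → i ≤ j → j < q + i →
    comp j h₂ (comp i h₁ φ ψ) χ = comp i h₄ φ (comp (j - i + 1) h₃ ψ χ)
  /-- `(φ ∘_i ψ) ∘_j χ = (φ ∘_{j-q+1} χ) ∘_i ψ` for `j ≥ q + i` -/
  comp_comp_ge : ∀ {p q r m m' n i j : ℕ} (h₁ : p + q = m + 1) (h₂ : m + r = n + 1)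
    (h₃ : p + r = m' + 1) (h₄ : m' + q = n + 1) (φ : O p) (ψ : O q) (χ : O r),
    1 ≤ i → i ≤ p → q + i ≤ j → j ≤ m →
    comp j h₂ (comp i h₁ φ ψ) χ = comp i h₄ (comp (j + 1 - q) h₃ φ χ) ψ
  /-- the identity `𝟙` -/
  one : O 1
  comp_one : ∀ {p i : ℕ} (φ : O p), 1 ≤ i → i ≤ p → comp i (q := 1) (r := p) rfl φ one = φ
  one_comp : ∀ {p : ℕ} (φ : O p), comp 1 (p := 1) (r := p) (Nat.add_comm 1 p) one φ = φ
  /-- the multiplication `μ` -/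
  mul : O 2
  /-- the unit `e` -/
  unit : O 0
  mul_assoc : comp 1 (p := 2) (q := 2) (r := 3) rfl mul mul = comp 2 (p := 2) (q := 2) (r := 3) rfl mul mul
  mul_unit_left : comp 1 (p := 2) (q := 0) (r := 1) rfl mul unit = one
  mul_unit_right : comp 2 (p := 2) (q := 0) (r := 1) rfl mul unit = one

/-- A cyclic unital opposite module `(N, t)` over an operad with multiplication. The operation
`bul i h : O(p) → N(n) → N(m)` is defined for all `p`, `n`, `m` with `m + p = n + 1`, so that
`m = n - p + 1`. The operations `•_i` with `1 ≤ i ≤ m` are those of the underlying unital opposite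
module, and `•_0`, defined for `0 ≤ p ≤ n + 1`, is the extra operation; all relations of an opposite
module are required for `•_0` as well. -/
structure CyclicUnitalOppositeModule {k : Type*} [CommRing k] {O : ℕ → Type*}
    [∀ n, AddCommGroup (O n)] [∀ n, Module k (O n)] (P : OperadWithMultiplication k O)
    (N : ℕ → Type*) [∀ n, AddCommGroup (N n)] [∀ n, Module k (N n)] where
  /-- the operation `φ •_i x` -/
  bul : ∀ (i : ℕ) {p n m : ℕ}, m + p = n + 1 → O p →ₗ[k] N n →ₗ[k] N m
  bul_zero : ∀ (i : ℕ) {p n m : ℕ} (h : m + p = n + 1) (φ : O p) (x : N n),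
    m < i → bul i h φ x = 0
  /-- `φ •_i (ψ •_j x) = ψ •_j (φ •_{i+q-1} x)` for `j < i` -/
  bul_bul_lt : ∀ {p q n m m' l i j : ℕ} (h₁ : m + q = n + 1) (h₂ : l + p = m + 1)
    (h₃ : m' + p = n + 1) (h₄ : l + q = m' + 1) (φ : O p) (ψ : O q) (x : N n),
    j < i → i ≤ l →
    bul i h₂ φ (bul j h₁ ψ x) = bul j h₄ ψ (bul (i + q - 1) h₃ φ x)
  /-- `φ •_i (ψ •_j x) = (φ ∘_{j-i+1} ψ) •_i x` for `j - p < i ≤ j` -/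
  bul_bul_mid : ∀ {p q r n m l i j : ℕ} (h₁ : m + q = n + 1) (h₂ : l + p = m + 1)
    (h₃ : p + q = r + 1) (h₄ : l + r = n + 1) (φ : O p) (ψ : O q) (x : N n),
    i ≤ j → j < i + p → j ≤ m → i ≤ l →
    bul i h₂ φ (bul j h₁ ψ x) = bul i h₄ (P.comp (j - i + 1) h₃ φ ψ) x
  /-- `φ •_i (ψ •_j x) = ψ •_{j-p+1} (φ •_i x)` for `i ≤ j - p` -/
  bul_bul_ge : ∀ {p q n m m' l i j : ℕ} (h₁ : m + q = n + 1) (h₂ : l + p = m + 1)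
    (h₃ : m' + p = n + 1) (h₄ : l + q = m' + 1) (φ : O p) (ψ : O q) (x : N n),
    i + p ≤ j → j ≤ m →
    bul i h₂ φ (bul j h₁ ψ x) = bul (j + 1 - p) h₄ ψ (bul i h₃ φ x)
  /-- unitality -/
  one_bul : ∀ {n i : ℕ} (x : N n), i ≤ n → bul i (p := 1) (n := n) (m := n) rfl P.one x = x
  /-- the cyclic operator -/
  t : ∀ n, N n →ₗ[k] N n
  t_pow : ∀ n, t n ^ (n + 1) = 1
  /-- `t(φ •_i x) = φ •_{i+1} t(x)` for `0 ≤ i ≤ n - p` -/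
  t_bul : ∀ {p n m i : ℕ} (h : m + p = n + 1) (φ : O p) (x : N n), i < m →
    t m (bul i h φ x) = bul (i + 1) h φ (t n x)

section Induced

variable {k : Type*} [CommRing k] {O : ℕ → Type*}
    [∀ n, AddCommGroup (O n)] [∀ n, Module k (O n)] {P : OperadWithMultiplication k O}
    {N : ℕ → Type*} [∀ n, AddCommGroup (N n)] [∀ n, Module k (N n)]

/-- The faces `d_i = μ •_i -` for `i < n`, `d_n = μ •_0 t(-)`, from degree `n` to degree `m = n - 1`,
of the induced cyclic module. -/
def CyclicUnitalOppositeModule.face (Z : CyclicUnitalOppositeModule P N) (i : ℕ) {n m : ℕ}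
    (h : n = m + 1) : N n →ₗ[k] N m :=
  if i = n then (Z.bul 0 (p := 2) (congrArg (· + 1) h.symm) P.mul).comp (Z.t n)
  else Z.bul i (p := 2) (congrArg (· + 1) h.symm) P.mul

/-- The degeneracies `s_j = e •_{j+1} -`, from degree `n` to degree `m = n + 1`, of the induced
cyclic module. -/
def CyclicUnitalOppositeModule.degen (Z : CyclicUnitalOppositeModule P N) (j : ℕ) {n m : ℕ}
    (h : m = n + 1) : N n →ₗ[k] N m :=
  Z.bul (j + 1) (p := 0) h P.unit

end Induced

/-- `(C, d, s, t)` is a cyclic `k`-module; `d n i : C (n + 1) → C n` is the face `d_i` for `i ≤ n + 1`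
and `s n j : C n → C (n + 1)` the degeneracy `s_j` for `j ≤ n`. -/
structure IsCyclicModule {k : Type*} [CommRing k] {C : ℕ → Type*}
    [∀ n, AddCommGroup (C n)] [∀ n, Module k (C n)]
    (d : ∀ n, ℕ → C (n + 1) →ₗ[k] C n) (s : ∀ n, ℕ → C n →ₗ[k] C (n + 1))
    (t : ∀ n, C n →ₗ[k] C n) : Prop where
  d_d : ∀ n i j x, i ≤ j → j ≤ n + 1 → d n i (d (n + 1) (j + 1) x) = d n j (d (n + 1) i x)
  s_s : ∀ n i j x, i ≤ j → j ≤ n → s (n + 1) i (s n j x) = s (n + 1) (j + 1) (s n i x)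
  d_s_lt : ∀ n i j x, i ≤ j → j ≤ n → d (n + 1) i (s (n + 1) (j + 1) x) = s n j (d n i x)
  d_s_self : ∀ n j x, j ≤ n → d n j (s n j x) = x
  d_s_succ : ∀ n j x, j ≤ n → d n (j + 1) (s n j x) = x
  d_s_gt : ∀ n i j x, j < i → i ≤ n + 1 → d (n + 1) (i + 1) (s (n + 1) j x) = s n j (d n i x)
  d_t : ∀ n i x, i ≤ n → d n (i + 1) (t (n + 1) x) = t n (d n i x)
  d_zero_t : ∀ n x, d n 0 (t (n + 1) x) = d n (n + 1) x
  s_t : ∀ n i x, i < n → s n (i + 1) (t n x) = t (n + 1) (s n i x)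
  s_zero_t : ∀ n x, s n 0 (t n x) = t (n + 1) (t (n + 1) (s n n x))
  t_pow : ∀ n, t n ^ (n + 1) = 1

end CycOpp

namespace CycOpp

/-! Hom_A(U^{⊗n}, M) hides a cyclic symmetry, because one of n + 1 tensor factors has been
normalised to 1. As U is right Hopf, F ↦ F(- | 1) is an isomorphism Hom_U(U^{⊗(n+1)}, M) ≅
Hom_A(U^{⊗n}, M) with inverse f ↦ ((y | u) ↦ u_[+] f(u_[-] y)) (`chainEquiv`, resting on
`evalR_slotA` and `extK_act`). The structure is built on the larger model, where all n + 1 factors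
are on an equal footing, and then transported.

For left U-modules N, P and F in Hom_U(N ⊗_A P, M), the rotated map is p ⊗ n ↦ γ(z ↦ F(n ⊗ z p))
(`trace`). It is balanced over A by `γ_srcSmul`, a consequence of contraassociativity, the formula
for s(a)m and the Takeuchi condition. It is U-linear by the aYD compatibility, because the left Hopf
action on z ↦ F(n ⊗ z p) just moves n (`lAct_slot`). The cyclic operator t is the case N = U^{⊗n}, P
= U. Contraassociativity shows that t^j rotates a block of j factors in one go (`cycT_pow_app`). For
j = n + 1 the other block is A, and stability gives t^{n+1} = id (`cycT_pow`).

The tensor powers form an operad under insertion, and w acts on Hom_U(U^{⊗(n+1)}, M) by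
precomposition with its insertion into a slot 1, …, m + 1. Rotation raises the slot by one
(`cycT_cycBul`). Hence w •_i F = t⁻¹(insertion of w in slot i + 1, applied to tF) makes sense for 0
≤ i ≤ m and is the plain insertion for 1 ≤ i ≤ m. Every relation, with index 0 or not, becomes an
operad relation at positive indices conjugated by t. The stated formulas for •_0 come from t⁻¹ =
t^m, block rotation and a merging of two contraactions (`cycBul₀_zero_cons`, `cycBul₀_zero_scalar`).
The cyclic module axioms are formal consequences of the relations of a cyclic unital opposite
module. -/

instance LMod.instCoeSort (k : Type v) (U : Type u) [CommRing k] [Ring U] [Algebra k U] :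
    CoeSort (LMod k U) (Type u) := ⟨LMod.carrier⟩

/-- The regular left `U`-module. -/
abbrev LMod.reg (k : Type v) (U : Type u) [CommRing k] [Ring U] [Algebra k U] : LMod k U where
  carrier := U

namespace LeftBialgebroid

/-! ### The monoidal category of left U-modules under ⊗_A. -/

section Monoidal

variable {k : Type v} {A U : Type u} [CommRing k] [Ring A] [Algebra k A] [Ring U] [Algebra k U]
  (B : LeftBialgebroid k A U)

/-- The tensor product `N ⊗_A P` of left `U`-modules with the diagonal action. -/
def tn (N P : LMod k U) : LMod k U :=
  letI := B.tensModule N P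
  { carrier := B.Tens N P
    tower := B.tens_isScalarTower N P }

variable {N P Q N' P' : LMod k U} {X : Type*} [AddCommGroup X] [Module k X]

/-- The elementary tensor `n ⊗_A p`. -/
def tm : N →ₗ[k] P →ₗ[k] B.tn N P :=
  (TensorProduct.mk k N P).compr₂ (B.proj N P)

theorem tm_balanced (a : A) (n : N) (p : P) : B.tm (B.t a • n) p = B.tm n (B.src a • p) :=
  BalTensor.mk_balanced (k := k) (fun a : A => Algebra.lsmul k k N (B.t a))
    (fun a : A => Algebra.lsmul k k P (B.src a)) a n p

theorem tm_induction {p : B.tn N P → Prop} (z : B.tn N P) (h : ∀ n m, p (B.tm n m))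
    (hadd : ∀ x y, p x → p y → p (x + y)) : p z := by
  obtain ⟨z, rfl⟩ := Submodule.mkQ_surjective _ z
  induction z with
  | zero =>
    have h0 := h 0 0
    rw [map_zero] at h0
    rw [map_zero]
    exact h0
  | add z z' hz hz' => rw [map_add]; exact hadd _ _ hz hz'
  | tmul n m => exact h n m

/-- The universal property of `N ⊗_A P`. -/
def tlift (φ : N →ₗ[k] P →ₗ[k] X) (h : ∀ a n p, φ (B.t a • n) p = φ n (B.src a • p)) :
    B.tn N P →ₗ[k] X :=
  BalTensor.lift (fun a : A => Algebra.lsmul k k N (B.t a))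
    (fun a : A => Algebra.lsmul k k P (B.src a)) φ h

@[simp] theorem tlift_tm (φ : N →ₗ[k] P →ₗ[k] X)
    (h : ∀ a n p, φ (B.t a • n) p = φ n (B.src a • p)) (n : N) (p : P) :
    B.tlift φ h (B.tm n p) = φ n p := rfl

variable {B} in
theorem tn_ext {f g : B.tn N P →ₗ[k] X} (h : ∀ n p, f (B.tm n p) = g (B.tm n p)) : f = g :=
  BalTensor.hom_ext h

/-- The coproduct with values in the module `U ⊗_A U`. -/
def cop : U →ₗ[k] B.tn (LMod.reg k U) (LMod.reg k U) := B.comul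

/-- `x ⊗_A y ↦ x n ⊗_A y p`. -/
def act (n : N) (p : P) : B.tn (LMod.reg k U) (LMod.reg k U) →ₗ[k] B.tn N P := B.mulOn n p

@[simp] theorem act_tm (n : N) (p : P) (x y : LMod.reg k U) :
    B.act n p (B.tm x y) = B.tm (x • n) (y • p) := rfl

theorem smul_tm (u : U) (n : N) (p : P) : u • B.tm n p = B.act n p (B.cop u) := rfl

/-- As Δ s(a) = s(a) ⊗ 1 and Δ t(a) = 1 ⊗ t(a), the outer left A-action on N ⊗_A P lives on the
first factor and the outer right one on the second (`t_smul_tm`), away from the inner balancing. -/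
theorem src_smul_tm (a : A) (n : N) (p : P) : B.src a • B.tm n p = B.tm (B.src a • n) p := by
  have h : B.cop (B.src a) = B.tm (N := LMod.reg k U) (P := LMod.reg k U) (B.src a) 1 :=
    B.comul_src a
  rw [smul_tm, h, act_tm, one_smul]

theorem t_smul_tm (a : A) (n : N) (p : P) : B.t a • B.tm n p = B.tm n (B.t a • p) := by
  have h : B.cop (B.t a) = B.tm (N := LMod.reg k U) (P := LMod.reg k U) 1 (B.t a) :=
    B.comul_t a
  rw [smul_tm, h, act_tm, one_smul]

/-- Upgrade a `k`-linear map on `N ⊗_A P` to a `U`-linear one. -/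
def tliftU [Module U X] [IsScalarTower k U X] (φ : B.tn N P →ₗ[k] X)
    (h : ∀ (u : U) n p, φ (u • B.tm n p) = u • φ (B.tm n p)) : B.tn N P →ₗ[U] X where
  toFun := φ
  map_add' := map_add φ
  map_smul' u z := by
    refine B.tm_induction (p := fun z => φ (u • z) = u • φ z) z (h u) fun x y hx hy => ?_
    simp only [smul_add, map_add, hx, hy]

variable {B} in
theorem tn_extU {X : Type*} [AddCommGroup X] [Module U X] {f g : B.tn N P →ₗ[U] X}
    (h : ∀ n p, f (B.tm n p) = g (B.tm n p)) : f = g := by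
  ext z
  refine B.tm_induction (p := fun z => f z = g z) z h fun x y hx hy => ?_
  simp only [map_add, hx, hy]

/-- The tensor product of two `U`-linear maps. -/
def tmap (f : N →ₗ[U] N') (g : P →ₗ[U] P') : B.tn N P →ₗ[U] B.tn N' P' :=
  B.tliftU (B.tlift ((B.tm (N := N') (P := P')).compl₁₂ (f.restrictScalars k)
      (g.restrictScalars k)) fun a n p => by
        simp only [LinearMap.compl₁₂_apply, LinearMap.coe_restrictScalars, map_smul, tm_balanced])
    fun u n p => by
      rw [tlift_tm, LinearMap.compl₁₂_apply, smul_tm]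
      refine Eq.trans ?_ (B.smul_tm u (f n) (g p)).symm
      rw [← LinearMap.comp_apply]
      -- Both sides depend on u only through Δ u and linearly so, hence elementary tensors x ⊗_A y
      -- in place of Δ u suffice.
      refine LinearMap.congr_fun (tn_ext fun x y => ?_) _
      have hf : f ((x : U) • n) = (x : U) • f n := map_smul f _ _
      have hg : g ((y : U) • p) = (y : U) • g p := map_smul g _ _
      change B.tm (f ((x : U) • n)) (g ((y : U) • p)) = B.tm ((x : U) • f n) ((y : U) • g p)
      rw [hf, hg]

@[simp] theorem tmap_tm (f : N →ₗ[U] N') (g : P →ₗ[U] P') (n : N) (p : P) :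
    B.tmap f g (B.tm n p) = B.tm (f n) (g p) := rfl

/-- Invertible `U`-linear maps tensor to invertible ones. -/
def tcongr (f : N ≃ₗ[U] N') (g : P ≃ₗ[U] P') : B.tn N P ≃ₗ[U] B.tn N' P' :=
  LinearEquiv.ofLinearMap (B.tmap f g) (B.tmap f.symm g.symm)
    (tn_extU fun n p => by simp) (tn_extU fun n p => by simp)

/-- `n ⊗_A p ↦ (q ↦ n ⊗_A (p ⊗_A q))`. -/
def assocAux : B.tn N P →ₗ[k] Q →ₗ[k] B.tn N (B.tn P Q) :=
  B.tlift
    { toFun := fun n => (B.tm (N := P) (P := Q)).compr₂ (B.tm (N := N) (P := B.tn P Q) n)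
      map_add' := fun n n' => by ext; simp
      map_smul' := fun c n => by ext; simp }
    fun a n p => by
      ext q
      change B.tm (B.t a • n) (B.tm p q) = B.tm n (B.tm (B.src a • p) q)
      rw [tm_balanced, src_smul_tm]

theorem assocAux_tm (n : N) (p : P) (q : Q) :
    B.assocAux (B.tm n p) q = B.tm n (B.tm p q) := rfl

variable (N P Q) in
/-- The associativity constraint as a `k`-linear map. -/
def assocK : B.tn (B.tn N P) Q →ₗ[k] B.tn N (B.tn P Q) :=
  B.tlift B.assocAux <| by
    intro a z q
    refine B.tm_induction (p := fun z => B.assocAux (B.t a • z) q = B.assocAux z (B.src a • q))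
      z (fun n p => ?_) fun x y hx hy => ?_
    · rw [t_smul_tm, assocAux_tm, assocAux_tm, tm_balanced]
    · simp only [smul_add, map_add, LinearMap.add_apply, hx, hy]

/-- `p ⊗_A q ↦ (n ⊗_A p) ⊗_A q`. -/
def assocInvAux (n : N) : B.tn P Q →ₗ[k] B.tn (B.tn N P) Q :=
  B.tlift ((B.tm (N := B.tn N P) (P := Q)) ∘ₗ (B.tm (N := N) (P := P) n))
    fun a p q => by
      change B.tm (B.tm n (B.t a • p)) q = B.tm (B.tm n p) (B.src a • q)
      rw [← t_smul_tm, tm_balanced]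

theorem assocInvAux_tm (n : N) (p : P) (q : Q) :
    B.assocInvAux n (B.tm p q) = B.tm (B.tm n p) q := rfl

variable (N P Q) in
/-- The inverse of the associativity constraint as a `k`-linear map. -/
def assocKinv : B.tn N (B.tn P Q) →ₗ[k] B.tn (B.tn N P) Q :=
  B.tlift
    { toFun := B.assocInvAux
      map_add' := fun n n' => tn_ext fun p q => by
        rw [LinearMap.add_apply, assocInvAux_tm, assocInvAux_tm, assocInvAux_tm]
        simp
      map_smul' := fun c n => tn_ext fun p q => by
        rw [LinearMap.smul_apply, assocInvAux_tm, RingHom.id_apply, assocInvAux_tm]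
        simp } <| by
    intro a n z
    change B.assocInvAux (B.t a • n) z = B.assocInvAux n (B.src a • z)
    refine B.tm_induction
      (p := fun z => B.assocInvAux (B.t a • n) z = B.assocInvAux n (B.src a • z))
      z (fun p q => ?_) fun x y hx hy => ?_
    · rw [src_smul_tm, assocInvAux_tm, assocInvAux_tm, tm_balanced]
    · rw [smul_add, map_add, map_add, hx, hy]

/-- `x ⊗_A y ⊗_A w ↦ x n ⊗_A (y p ⊗_A w q)`. -/
def act₃ (n : N) (p : P) (q : Q) : B.Tens₃ →ₗ[k] B.tn N (B.tn P Q) :=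
  B.rel₃.liftQ
    (TensorProduct.lift ((B.tm (N := N) (P := B.tn P Q)).compl₁₂
      ((LinearMap.toSpanSingleton U N n).restrictScalars k)
      (TensorProduct.lift ((B.tm (N := P) (P := Q)).compl₁₂
        ((LinearMap.toSpanSingleton U P p).restrictScalars k)
        ((LinearMap.toSpanSingleton U Q q).restrictScalars k))))) <| by
    refine Submodule.span_le.2 ?_
    rintro _ (⟨a, x, y, w, rfl⟩ | ⟨a, x, y, w, rfl⟩)
    · simp [mul_smul, tm_balanced, src_smul_tm]
    · simp [mul_smul, tm_balanced]

theorem act₃_insR (n : N) (p : P) (q : Q) (w : U) (z : B.Tens U U) :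
    B.act₃ n p q (B.insR w z) = B.assocAux (B.act n p z) (w • q) :=
  LinearMap.congr_fun (f := B.act₃ n p q ∘ₗ B.insR w)
    (g := B.assocAux.flip (w • q) ∘ₗ B.act n p) (BalTensor.hom_ext fun _ _ => rfl) z

theorem act₃_insL (n : N) (p : P) (q : Q) (x : U) (z : B.Tens U U) :
    B.act₃ n p q (B.insL x z) = B.tm (x • n) (B.act p q z) :=
  LinearMap.congr_fun (f := B.act₃ n p q ∘ₗ B.insL x)
    (g := B.tm (x • n) ∘ₗ B.act p q) (BalTensor.hom_ext fun _ _ => rfl) z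

/-- The projection `U ⊗ U → U ⊗_A U`. -/
def cls : U ⊗[k] U →ₗ[k] B.tn (LMod.reg k U) (LMod.reg k U) := B.proj U U

theorem exists_cls (u : U) : ∃ X : U ⊗[k] U, B.cls X = B.cop u := B.exists_rep u

/-- Both sides are images under `act₃` of elements of U ⊗_A U ⊗_A U, of (Δ ⊗ 1)Δ u on the left and
of (1 ⊗ Δ)Δ u on the right, so this is coassociativity. -/
theorem assocK_smul (u : U) (n : N) (p : P) (q : Q) :
    B.assocK N P Q (u • B.tm (B.tm n p) q) = u • B.tm n (B.tm p q) := by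
  obtain ⟨X, hX⟩ := B.exists_cls u
  have h := congrArg (B.act₃ n p q) (B.coassoc u X hX)
  rw [smul_tm, smul_tm, ← hX]
  clear hX
  refine Eq.trans ?_ (h.symm.trans ?_) <;> clear h
  · induction X with
    | zero => simp only [map_zero]
    | add X X' h h' => simp only [map_add, h, h']
    | tmul x y =>
      rw [TensorProduct.lift.tmul]
      exact (B.act₃_insR n p q y (B.comul x)).symm
  · induction X with
    | zero => simp only [map_zero]
    | add X X' h h' => simp only [map_add, h, h']
    | tmul x y =>
      rw [TensorProduct.lift.tmul]
      exact B.act₃_insL n p q x (B.comul y)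

variable (N P Q) in
/-- The associativity constraint `(N ⊗_A P) ⊗_A Q ≅ N ⊗_A (P ⊗_A Q)`. -/
def assoc : B.tn (B.tn N P) Q ≃ₗ[U] B.tn N (B.tn P Q) where
  toLinearMap := B.tliftU (B.assocK N P Q) fun u z q => by
    refine B.tm_induction (p := fun z => B.assocK N P Q (u • B.tm z q) =
      u • B.assocK N P Q (B.tm z q)) z (fun n p => B.assocK_smul u n p q) fun x y hx hy => ?_
    simp only [map_add, LinearMap.add_apply, smul_add, hx, hy]
  invFun := B.assocKinv N P Q
  left_inv z := by
    change B.assocKinv N P Q (B.assocK N P Q z) = z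
    refine B.tm_induction (p := fun z => B.assocKinv N P Q (B.assocK N P Q z) = z) z
      (fun z q => ?_) fun x y hx hy => by rw [map_add, map_add, hx, hy]
    refine B.tm_induction
      (p := fun z => B.assocKinv N P Q (B.assocK N P Q (B.tm z q)) = B.tm z q) z
      (fun _ _ => rfl) fun x y hx hy => by
        rw [map_add, LinearMap.add_apply, map_add, map_add, hx, hy]
  right_inv z := by
    change B.assocK N P Q (B.assocKinv N P Q z) = z
    refine B.tm_induction (p := fun z => B.assocK N P Q (B.assocKinv N P Q z) = z) z
      (fun n z => ?_) fun x y hx hy => by rw [map_add, map_add, hx, hy]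
    refine B.tm_induction
      (p := fun z => B.assocK N P Q (B.assocKinv N P Q (B.tm n z)) = B.tm n z) z
      (fun _ _ => rfl) fun x y hx hy => by rw [map_add, map_add, map_add, hx, hy]

theorem scalar_surjective : Function.Surjective B.scalar := fun a => ⟨a, rfl⟩

theorem t_smul_scalar (a b : A) : B.t a • B.scalar b = B.scalar (b * a) := by
  rw [smul_scalar, counit_t_mul, counit_src]

theorem src_smul_scalar (a b : A) : B.src a • B.scalar b = B.scalar (a * b) := by
  rw [smul_scalar, counit_src_mul, counit_src]

/-- `a ⊗ n ↦ s(a) n`. -/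
def lunitK (N : LMod k U) : B.tn (B.tpow 0) N →ₗ[k] N :=
  B.tlift ((Algebra.lsmul k k N).toLinearMap ∘ₗ B.src.toLinearMap :
      A →ₗ[k] N →ₗ[k] N) fun a b n => by
    obtain ⟨b, rfl⟩ := B.scalar_surjective b
    rw [t_smul_scalar]
    change B.src (b * a) • n = B.src b • B.src a • n
    rw [map_mul, mul_smul]

theorem lunitK_tm (a : A) (n : N) : B.lunitK N (B.tm (B.scalar a) n) = B.src a • n := rfl

/-- The counit axiom s(ε(x₍₁₎)) x₍₂₎ = x is used for x = u s(a), whose coproduct is u₍₁₎ s(a) ⊗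
u₍₂₎. -/
theorem lunitK_smul (u : U) (a : A) (n : N) :
    B.lunitK N (u • B.tm (B.scalar a) n) = u • B.lunitK N (B.tm (B.scalar a) n) := by
  obtain ⟨Y, hY⟩ := B.exists_cls u
  have hX : B.cls (Y * (B.src a ⊗ₜ 1)) = B.cop (u * B.src a) :=
    (B.comul_mul_src u Y hY a).symm
  have h := B.counit_left _ _ hX
  rw [lunitK_tm, smul_smul, ← h, smul_tm, ← hY]
  clear h hX hY
  induction Y with
  | zero => simp only [map_zero, zero_mul, zero_smul]
  | add x y hx hy => simp only [map_add, hx, hy, add_mul, add_smul]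
  | tmul x y =>
    rw [Algebra.TensorProduct.tmul_mul_tmul, mul_one]
    change B.src (B.counit (x * B.src a)) • y • n = (B.src (B.counit (x * B.src a)) * y) • n
    rw [mul_smul]

/-- The left unit constraint `A ⊗_A N ≅ N`. -/
def lunit (N : LMod k U) : B.tn (B.tpow 0) N ≃ₗ[U] N where
  toLinearMap := B.tliftU (B.lunitK N) fun u a n => by
    obtain ⟨a, rfl⟩ := B.scalar_surjective a
    exact B.lunitK_smul u a n
  invFun n := B.tm (B.scalar 1) n
  left_inv z := by
    change B.tm (B.scalar 1) (B.lunitK N z) = z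
    refine B.tm_induction (p := fun z => B.tm (B.scalar 1) (B.lunitK N z) = z) z
      (fun a n => ?_) fun x y hx hy => by rw [map_add, map_add, hx, hy]
    obtain ⟨a, rfl⟩ := B.scalar_surjective a
    rw [lunitK_tm, ← tm_balanced, t_smul_scalar, one_mul]
  right_inv n := by
    change B.lunitK N (B.tm (B.scalar 1) n) = n
    rw [lunitK_tm, map_one, one_smul]

/-- `n ⊗ a ↦ t(a) n`. -/
def runitK (N : LMod k U) : B.tn N (B.tpow 0) →ₗ[k] N :=
  B.tlift (P := B.tpow 0) (((Algebra.lsmul k k N).toLinearMap ∘ₗ B.tgt.toLinearMap ∘ₗ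
      (MulOpposite.opLinearEquiv k).toLinearMap : A →ₗ[k] N →ₗ[k] N).flip) fun a n b => by
    obtain ⟨b, rfl⟩ := B.scalar_surjective b
    rw [src_smul_scalar]
    change B.t b • B.t a • n = B.t (a * b) • n
    rw [t_mul, mul_smul]

theorem runitK_tm (a : A) (n : N) : B.runitK N (B.tm n (B.scalar a)) = B.t a • n := rfl

/-- The right unit constraint `N ≅ N ⊗_A A`. -/
def runit (N : LMod k U) : N ≃ₗ[U] B.tn N (B.tpow 0) where
  toFun n := B.tm n (B.scalar 1)
  map_add' n n' := by rw [map_add, LinearMap.add_apply]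
  map_smul' u n := by
    obtain ⟨X, hX⟩ := B.exists_cls u
    rw [RingHom.id_apply, smul_tm, ← hX]
    -- With u written as t(ε(u₍₂₎)) u₍₁₎, balancing moves the factor t(ε(u₍₂₎)) over to 1_A, where
    -- it gives ε(u₍₂₎) = u₍₂₎ · 1_A.
    nth_rw 1 [← B.counit_right u X hX]
    clear hX
    induction X with
    | zero => simp only [map_zero, zero_smul, LinearMap.zero_apply]
    | add x y hx hy => simp only [map_add, hx, hy, add_smul, LinearMap.add_apply]
    | tmul x y =>
      change B.tm ((B.t (B.counit y) * x) • n) (B.scalar 1) = B.tm (x • n) (y • B.scalar 1)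
      rw [mul_smul, tm_balanced, src_smul_scalar, smul_scalar, map_one, mul_one, mul_one]
  invFun := B.runitK N
  left_inv n := by
    change B.runitK N (B.tm n (B.scalar 1)) = n
    rw [runitK_tm, t_one, one_smul]
  right_inv z := by
    change B.tm (B.runitK N z) (B.scalar 1) = z
    refine B.tm_induction (p := fun z => B.tm (B.runitK N z) (B.scalar 1) = z) z
      (fun n a => ?_) fun x y hx hy => by rw [map_add, map_add, LinearMap.add_apply, hx, hy]
    obtain ⟨a, rfl⟩ := B.scalar_surjective a
    rw [runitK_tm, tm_balanced, src_smul_scalar, mul_one]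

end Monoidal

end LeftBialgebroid

end CycOpp

namespace CycOpp

namespace LeftBialgebroid

/-! ### Concatenation of tensors and the operad of tensor powers. -/

section TensorPowerMaps

variable {k : Type v} {A U : Type u} [CommRing k] [Ring A] [Algebra k A] [Ring U] [Algebra k U]
  (B : LeftBialgebroid k A U)

/-- The identification `U ⊗_A U^{⊗_A n} = U^{⊗_A (n + 1)}`. -/
def consEquiv (n : ℕ) : B.tn (LMod.reg k U) (B.tpow n) ≃ₗ[U] B.T (n + 1) :=
  LinearEquiv.refl U (B.T (n + 1))

theorem T_zero_induction {p : B.T 0 → Prop} (z : B.T 0) (h : ∀ a, p (B.scalar a)) : p z := by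
  obtain ⟨a, rfl⟩ := B.scalar_surjective z
  exact h a

theorem T_succ_induction' {n : ℕ} {p : B.T (n + 1) → Prop} (z : B.T (n + 1))
    (h : ∀ u x, p (B.cons u x)) (hadd : ∀ x y, p x → p y → p (x + y)) : p z := by
  refine B.T_succ_induction z h ?_ hadd
  have h0 := h 0 0
  rwa [map_zero] at h0

/-- A `U`-linear map out of `U^{⊗_A (n + 1)}` is determined on `(u | x)`. -/
theorem T_hom_ext {n : ℕ} {X : Type*} [AddCommGroup X] [Module U X] {f g : B.T (n + 1) →ₗ[U] X}
    (h : ∀ u x, f (B.cons u x) = g (B.cons u x)) : f = g := by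
  ext z
  refine B.T_succ_induction' (p := fun z => f z = g z) z h fun x y hx hy => ?_
  rw [map_add, map_add, hx, hy]

/-- Transport along an equality of degrees. -/
def castT {n m : ℕ} (h : n = m) : B.T n →ₗ[U] B.T m := h ▸ LinearMap.id

/-- Concatenation as a `U`-linear map. -/
def appendU : (a b : ℕ) → B.tn (B.tpow a) (B.tpow b) →ₗ[U] B.T (b + a)
  | 0, b => (B.lunit (B.tpow b)).toLinearMap
  | a + 1, b => (B.consEquiv (b + a)).toLinearMap ∘ₗ (B.tmap LinearMap.id (appendU a b)) ∘ₗ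
      (B.assoc (LMod.reg k U) (B.tpow a) (B.tpow b)).toLinearMap

/-- Concatenation `(x, y) ↦ (x | y)` with values in a prescribed degree. -/
def app {a b n : ℕ} (h : b + a = n) : B.T a →ₗ[k] B.T b →ₗ[k] B.T n :=
  (B.tm (N := B.tpow a) (P := B.tpow b)).compr₂
    ((B.castT h ∘ₗ B.appendU a b).restrictScalars k)

theorem app_eq {a b n : ℕ} (h : b + a = n) (x : B.T a) (y : B.T b) :
    B.app h x y = B.castT h (B.appendU a b (B.tm x y)) := rfl

theorem app_scalar {b : ℕ} (h : b + 0 = b) (c : A) (y : B.T b) :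
    B.app h (B.scalar c) y = B.src c • y := rfl

theorem app_cons {a b n : ℕ} (h : b + (a + 1) = n + 1) (u : U) (x : B.T a) (y : B.T b) :
    B.app h (B.cons u x) y = B.cons u (B.app (Nat.succ.inj h) x y) := by
  obtain rfl : b + a = n := Nat.succ.inj h
  rfl

theorem app_append {a b : ℕ} (x : B.T a) (y : B.T b) : B.app rfl x y = B.append x y := by
  induction a with
  | zero => exact B.T_zero_induction (p := fun x => B.app rfl x y = B.append x y) x fun _ => rfl
  | succ a ih =>
    refine B.T_succ_induction' (p := fun x => B.app rfl x y = B.append x y) x (fun u x => ?_)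
      fun x x' hx hx' => ?_
    · rw [app_cons, append_cons, ih]
    · rw [map_add, LinearMap.add_apply, hx, hx', append, append, append, map_add]

theorem app_src_smul {a b n : ℕ} (h : b + a = n) (c : A) (x : B.T a) (y : B.T b) :
    B.app h (B.src c • x) y = B.src c • B.app h x y := by
  rw [app_eq, app_eq, ← src_smul_tm, map_smul, map_smul]

/-- The leading factors of x peel off unchanged; in degree 0 the claim is left A-linearity of
concatenation in its first block. -/
theorem app_assoc {a b c n m l : ℕ} (h₁ : b + a = n) (h₂ : c + n = m) (h₃ : c + b = l)
    (h₄ : l + a = m) (x : B.T a) (y : B.T b) (z : B.T c) :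
    B.app h₂ (B.app h₁ x y) z = B.app h₄ x (B.app h₃ y z) := by
  induction a generalizing n m with
  | zero =>
    obtain rfl : b = n := by omega
    obtain rfl : l = m := by omega
    refine B.T_zero_induction (p := fun x => B.app h₂ (B.app h₁ x y) z =
      B.app h₄ x (B.app h₃ y z)) x fun a => ?_
    rw [app_scalar, app_scalar, app_src_smul]
  | succ a ih =>
    obtain rfl : b + a + 1 = n := by omega
    obtain rfl : l + a + 1 = m := by omega
    refine B.T_succ_induction' (p := fun x => B.app h₂ (B.app h₁ x y) z =
      B.app h₄ x (B.app h₃ y z)) x (fun u x => ?_) fun x x' hx hx' => ?_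
    · rw [app_cons, app_cons, app_cons, ih]
    · simp only [map_add, LinearMap.add_apply, hx, hx']

theorem app_scalar_one {a : ℕ} (h : 0 + a = a) (x : B.T a) : B.app h x (B.scalar 1) = x := by
  induction a with
  | zero =>
    refine B.T_zero_induction (p := fun x => B.app h x (B.scalar 1) = x) x fun a => ?_
    rw [app_scalar, src_smul_scalar, mul_one]
  | succ a ih =>
    refine B.T_succ_induction' (p := fun x => B.app h x (B.scalar 1) = x) x (fun u x => ?_)
      fun x x' hx hx' => ?_
    · rw [app_cons, ih]
    · rw [map_add, LinearMap.add_apply, hx, hx']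

/-- Appending one tensor factor, as a `U`-linear isomorphism. -/
def snocEquiv : (n : ℕ) → B.tn (B.tpow n) (LMod.reg k U) ≃ₗ[U] B.T (n + 1)
  | 0 => (B.lunit (LMod.reg k U)).trans ((B.runit (LMod.reg k U)).trans (B.consEquiv 0))
  | n + 1 => (B.assoc (LMod.reg k U) (B.tpow n) (LMod.reg k U)).trans
      ((B.tcongr (LinearEquiv.refl U (LMod.reg k U)) (snocEquiv n)).trans (B.consEquiv (n + 1)))

/-- `(y, u) ↦ (y | u)`. -/
def snoc {n : ℕ} : B.T n →ₗ[k] U →ₗ[k] B.T (n + 1) :=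
  (B.tm (N := B.tpow n) (P := LMod.reg k U)).compr₂
    ((B.snocEquiv n).toLinearMap.restrictScalars k)

theorem snocEquiv_tm {n : ℕ} (y : B.T n) (u : U) :
    B.snocEquiv n (B.tm (P := LMod.reg k U) y u) = B.snoc y u := rfl

theorem snoc_scalar (c : A) (u : U) : B.snoc (B.scalar c) u = B.cons (B.src c * u) (B.scalar 1) :=
  rfl

theorem snoc_cons {n : ℕ} (v : U) (y : B.T n) (u : U) :
    B.snoc (B.cons v y) u = B.cons v (B.snoc y u) := rfl

theorem snoc_one {n : ℕ} (y : B.T n) : B.snoc y 1 = B.snocOne y := by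
  induction n with
  | zero =>
    refine B.T_zero_induction (p := fun y => B.snoc y 1 = B.snocOne y) y fun c => ?_
    rw [snoc_scalar]
    exact (B.src_smul_cons c 1 (B.scalar 1)).symm
  | succ n ih =>
    refine B.T_succ_induction' (p := fun y => B.snoc y 1 = B.snocOne y) y (fun u x => ?_)
      fun x x' hx hx' => ?_
    · rw [snoc_cons, snocOne_cons, ih]
    · rw [map_add, LinearMap.add_apply, hx, hx', snocOne, snocOne, snocOne, map_add]

theorem app_snoc {a b n : ℕ} (h : b + 1 + a = n + 1) (h' : b + a = n) (x : B.T a) (y : B.T b)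
    (u : U) : B.app h x (B.snoc y u) = B.snoc (B.app h' x y) u := by
  induction a generalizing n with
  | zero =>
    obtain rfl : b = n := by omega
    refine B.T_zero_induction (p := fun x => B.app h x (B.snoc y u) = B.snoc (B.app h' x y) u) x
      fun c => ?_
    rw [app_scalar, app_scalar, ← snocEquiv_tm, ← snocEquiv_tm, ← src_smul_tm, map_smul]
  | succ a ih =>
    obtain rfl : b + a + 1 = n := by omega
    refine B.T_succ_induction' (p := fun x => B.app h x (B.snoc y u) = B.snoc (B.app h' x y) u) x
      (fun v x => ?_) fun x x' hx hx' => ?_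
    · rw [app_cons, app_cons, snoc_cons, ih]
    · simp only [map_add, LinearMap.add_apply, hx, hx']

/-- The cut between two blocks moves past one factor. This is what splits a rotation by j + 1
factors into a rotation by j and a rotation by one. -/
theorem snoc_app {a b n : ℕ} (h : a + (b + 1) = n) (h' : a + 1 + b = n) (y : B.T b) (u : U)
    (x : B.T a) : B.app h (B.snoc y u) x = B.app h' y (B.cons u x) := by
  induction b generalizing n with
  | zero =>
    obtain rfl : a + 1 = n := by omega
    refine B.T_zero_induction (p := fun y => B.app h (B.snoc y u) x = B.app h' y (B.cons u x)) y
      fun c => ?_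
    rw [snoc_scalar, app_cons, app_scalar, app_scalar, src_smul_cons, map_one, one_smul]
  | succ b ih =>
    obtain rfl : a + (b + 1) + 1 = n := by omega
    refine B.T_succ_induction' (p := fun y => B.app h (B.snoc y u) x = B.app h' y (B.cons u x)) y
      (fun v y => ?_) fun y y' hy hy' => ?_
    · rw [snoc_cons, app_cons, app_cons, ih]
    · simp only [map_add, LinearMap.add_apply, hy, hy']

/-! ### Partial compositions: insertion of a tensor into a slot. -/

/-- The map `φ ↦ φ ∘_i w` on tensor powers, which is zero for `i` out of range. -/
def ins {q : ℕ} (w : B.T q) : (i p r : ℕ) → p + q = r + 1 → B.T p →ₗ[U] B.T r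
  -- The map v ↦ v · w is U-linear on the regular module. Thus every insertion is U-linear, and
  -- precomposition with it preserves Hom_U.
  | 1, p + 1, r, h => B.castT (by omega) ∘ₗ B.appendU q p ∘ₗ
      B.tmap (N := LMod.reg k U) (LinearMap.toSpanSingleton U (B.T q) w) LinearMap.id
  | i + 2, p + 2, r + 1, h => (B.consEquiv r).toLinearMap ∘ₗ
      B.tmap (N := LMod.reg k U) (P := B.tpow (p + 1)) (P' := B.tpow r) LinearMap.id
        (ins w (i + 1) (p + 1) r (by omega))
  -- What remains is slot 0, the empty tensor, and slots i ≥ 2 for p = 1. The pattern i ≥ 2, p ≥ 2,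
  -- r = 0 also lands here but contradicts p + q = r + 1.
  | _, _, _, _ => 0

theorem ins_one_cons {p q r : ℕ} (w : B.T q) (h : p + 1 + q = r + 1) (v : U) (y : B.T p) :
    B.ins w 1 (p + 1) r h (B.cons v y) = B.app (by omega) (v • w) y := by
  obtain rfl : p + q = r := by omega
  rfl

theorem ins_zero_degree {q r : ℕ} (w : B.T q) (i : ℕ) (h : 0 + q = r + 1) : B.ins w i 0 r h = 0 := by
  rcases i with _ | _ | i <;> rfl

/-- Unlike the defining clause, this also covers p = 0, where both sides vanish, so later inductions
need no case distinction at the end of the range. -/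
theorem ins_succ_cons {p q r i : ℕ} (w : B.T q) (hi : 1 ≤ i) (h : p + 1 + q = r + 1 + 1) (v : U)
    (y : B.T p) :
    B.ins w (i + 1) (p + 1) (r + 1) h (B.cons v y) = B.cons v (B.ins w i p r (by omega) y) := by
  obtain ⟨i, rfl⟩ := Nat.exists_eq_add_of_le' hi
  cases p with
  | zero => rw [ins_zero_degree, LinearMap.zero_apply, map_zero]; rfl
  | succ p => rfl

theorem ins_eq_zero {p q r i : ℕ} (w : B.T q) (h : p + q = r + 1) (hi : ¬ (1 ≤ i ∧ i ≤ p)) :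
    B.ins w i p r h = 0 := by
  induction i generalizing p r with
  | zero => unfold ins; rfl
  | succ i ih =>
    cases p with
    | zero => exact B.ins_zero_degree w _ h
    | succ p =>
      have hi' : 1 ≤ i := by omega
      cases r with
      | zero =>
        obtain ⟨i, rfl⟩ := Nat.exists_eq_add_of_le' hi'
        obtain rfl : p = 0 := by omega
        rfl
      | succ r =>
        refine B.T_hom_ext fun v y => ?_
        rw [ins_succ_cons B w hi', ih _ (by omega), LinearMap.zero_apply, LinearMap.zero_apply,
          map_zero]

theorem ins_add {p q r i : ℕ} (w w' : B.T q) (h : p + q = r + 1) :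
    B.ins (w + w') i p r h = B.ins w i p r h + B.ins w' i p r h := by
  by_cases hr : 1 ≤ i ∧ i ≤ p
  swap
  · rw [ins_eq_zero B _ h hr, ins_eq_zero B _ h hr, ins_eq_zero B _ h hr, add_zero]
  obtain ⟨i, rfl⟩ := Nat.exists_eq_add_of_le' hr.1
  induction i generalizing p r with
  | zero =>
    obtain ⟨p, rfl⟩ := Nat.exists_eq_add_of_le' hr.2
    refine B.T_hom_ext fun v y => ?_
    rw [LinearMap.add_apply, ins_one_cons, ins_one_cons, ins_one_cons, smul_add, map_add,
      LinearMap.add_apply]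
  | succ i ih =>
    obtain ⟨p, rfl⟩ : ∃ p', p = p' + 1 := ⟨p - 1, by omega⟩
    obtain ⟨r, rfl⟩ : ∃ r', r = r' + 1 := ⟨r - 1, by omega⟩
    refine B.T_hom_ext fun v y => ?_
    rw [LinearMap.add_apply, ins_succ_cons B _ (by omega), ins_succ_cons B _ (by omega),
      ins_succ_cons B _ (by omega), ih _ (by omega), LinearMap.add_apply, map_add]

theorem ins_smul {p q r i : ℕ} (c : k) (w : B.T q) (h : p + q = r + 1) (x : B.T p) :
    B.ins (c • w) i p r h x = c • B.ins w i p r h x := by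
  by_cases hr : 1 ≤ i ∧ i ≤ p
  swap
  · rw [ins_eq_zero B _ h hr, ins_eq_zero B _ h hr, LinearMap.zero_apply, smul_zero]
  obtain ⟨i, rfl⟩ := Nat.exists_eq_add_of_le' hr.1
  obtain ⟨p, rfl⟩ : ∃ p', p = p' + 1 := ⟨p - 1, by omega⟩
  induction i generalizing p r with
  | zero =>
    refine B.T_succ_induction' (p := fun x => B.ins (c • w) _ _ r h x = c • B.ins w _ _ r h x) x
      (fun v y => ?_) fun y y' hy hy' => ?_
    · rw [zero_add, ins_one_cons, ins_one_cons, smul_comm, map_smul, LinearMap.smul_apply]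
    · rw [map_add, map_add, hy, hy', smul_add]
  | succ i ih =>
    obtain ⟨p, rfl⟩ : ∃ p', p = p' + 1 := ⟨p - 1, by omega⟩
    obtain ⟨r, rfl⟩ : ∃ r', r = r' + 1 := ⟨r - 1, by omega⟩
    refine B.T_succ_induction' (p := fun x => B.ins (c • w) _ _ (r + 1) h x =
      c • B.ins w _ _ (r + 1) h x) x (fun v y => ?_) fun y y' hy hy' => ?_
    · rw [ins_succ_cons B _ (by omega), ins_succ_cons B _ (by omega), ih _ _ _ (by omega), map_smul]
    · rw [map_add, map_add, hy, hy', smul_add]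

/-- An insertion into one of the first p slots does not see the last factor. This compares
operations on F with operations on F(- | 1), and insertions before and after a rotation. -/
theorem ins_snoc {p q r i : ℕ} (w : B.T q) (h : p + q = r + 1) (h' : p + 1 + q = r + 1 + 1)
    (hi : 1 ≤ i) (hi' : i ≤ p) (y : B.T p) (u : U) :
    B.ins w i (p + 1) (r + 1) h' (B.snoc y u) = B.snoc (B.ins w i p r h y) u := by
  obtain ⟨i, rfl⟩ := Nat.exists_eq_add_of_le' hi
  obtain ⟨p, rfl⟩ : ∃ p', p = p' + 1 := ⟨p - 1, by omega⟩
  induction i generalizing p r with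
  | zero =>
    refine B.T_succ_induction' (p := fun y => B.ins w _ _ _ h' (B.snoc y u) =
      B.snoc (B.ins w _ _ r h y) u) y (fun v y => ?_) fun y y' hy hy' => ?_
    · rw [snoc_cons, zero_add, ins_one_cons, ins_one_cons]
      exact B.app_snoc _ _ _ _ _
    · simp only [map_add, LinearMap.add_apply, hy, hy']
  | succ i ih =>
    obtain ⟨p, rfl⟩ : ∃ p', p = p' + 1 := ⟨p - 1, by omega⟩
    obtain ⟨r, rfl⟩ : ∃ r', r = r' + 1 := ⟨r - 1, by omega⟩
    refine B.T_succ_induction' (p := fun y => B.ins w _ _ _ h' (B.snoc y u) =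
      B.snoc (B.ins w _ _ (r + 1) h y) u) y (fun v y => ?_) fun y y' hy hy' => ?_
    · rw [snoc_cons, ins_succ_cons B _ (by omega), ins_succ_cons B _ (by omega), snoc_cons,
        ih (by omega) _ _ _ _ (by omega)]
    · simp only [map_add, LinearMap.add_apply, hy, hy']

theorem ins_app_left {a p q r n m i j : ℕ} (w : B.T q) (h : p + q = r + 1) (h₁ : p + a = n)
    (h₂ : n + q = m + 1) (h₃ : r + a = m) (hi : 1 ≤ i) (hj : j = i + a) (x : B.T a) (y : B.T p) :
    B.ins w j n m h₂ (B.app h₁ x y) = B.app h₃ x (B.ins w i p r h y) := by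
  subst hj
  induction a generalizing n m with
  | zero =>
    obtain rfl : p = n := by omega
    obtain rfl : r = m := by omega
    refine B.T_zero_induction (p := fun x => B.ins w _ _ _ h₂ (B.app h₁ x y) =
      B.app h₃ x (B.ins w i _ _ h y)) x fun c => ?_
    rw [app_scalar, app_scalar, map_smul, add_zero]
  | succ a ih =>
    obtain rfl : p + a + 1 = n := by omega
    obtain rfl : r + a + 1 = m := by omega
    refine B.T_succ_induction' (p := fun x => B.ins w _ _ _ h₂ (B.app h₁ x y) =
      B.app h₃ x (B.ins w i _ _ h y)) x (fun v x => ?_) fun x x' hx hx' => ?_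
    · rw [app_cons, app_cons, ← add_assoc, ins_succ_cons B _ (by omega), ih]
    · simp only [map_add, LinearMap.add_apply, hx, hx']

/-- Stripping leading factors reduces this to slot 1, where it is associativity of concatenation.
Together with `ins_app_left` it describes an insertion into either block of (x | y). -/
theorem ins_app_right {a a' b q n m j : ℕ} (w : B.T q) (h : a + q = a' + 1) (h₁ : b + a = n)
    (h₂ : n + q = m + 1) (h₃ : b + a' = m) (hj : 1 ≤ j) (hj' : j ≤ a) (x : B.T a) (y : B.T b) :
    B.ins w j n m h₂ (B.app h₁ x y) = B.app h₃ (B.ins w j a a' h x) y := by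
  obtain ⟨j, rfl⟩ := Nat.exists_eq_add_of_le' hj
  induction j generalizing a a' n m with
  | zero =>
    obtain ⟨a, rfl⟩ : ∃ p', a = p' + 1 := ⟨a - 1, by omega⟩
    obtain rfl : b + a + 1 = n := by omega
    refine B.T_succ_induction' (p := fun x => B.ins w _ _ _ h₂ (B.app h₁ x y) =
      B.app h₃ (B.ins w _ _ a' h x) y) x (fun v x => ?_) fun x x' hx hx' => ?_
    · rw [app_cons, zero_add, ins_one_cons, ins_one_cons]
      exact (B.app_assoc _ _ _ _ _ _ _).symm
    · simp only [map_add, LinearMap.add_apply, hx, hx']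
  | succ j ih =>
    obtain ⟨a, rfl⟩ : ∃ p', a = p' + 1 := ⟨a - 1, by omega⟩
    obtain ⟨a', rfl⟩ : ∃ p', a' = p' + 1 := ⟨a' - 1, by omega⟩
    obtain rfl : b + a + 1 = n := by omega
    obtain rfl : b + a' + 1 = m := by omega
    refine B.T_succ_induction' (p := fun x => B.ins w _ _ _ h₂ (B.app h₁ x y) =
      B.app h₃ (B.ins w _ _ _ h x) y) x (fun v x => ?_) fun x x' hx hx' => ?_
    · rw [app_cons, ins_succ_cons B _ (by omega), ins_succ_cons B _ (by omega), app_cons,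
        ih _ _ _ _ _ (by omega) (by omega)]
    · simp only [map_add, LinearMap.add_apply, hx, hx']

/-- Common leading factors are stripped until χ enters slot 1. The tensor then starts with the block
v · χ, and ψ is inserted behind it, which is `ins_app_left`. The index is given by l + 1 = i + r to
avoid truncated subtraction. -/
theorem ins_ins_lt {p q r m m' n i j l : ℕ} (h₁ : p + q = m + 1) (h₂ : m + r = n + 1)
    (h₃ : p + r = m' + 1) (h₄ : m' + q = n + 1) (φ : B.T p) (ψ : B.T q) (χ : B.T r)
    (hj : 1 ≤ j) (hi : j < i) (hl : l + 1 = i + r) (hip : i ≤ p) :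
    B.ins χ j m n h₂ (B.ins ψ i p m h₁ φ) = B.ins ψ l m' n h₄ (B.ins χ j p m' h₃ φ) := by
  obtain ⟨j, rfl⟩ := Nat.exists_eq_add_of_le' hj
  obtain ⟨i, rfl⟩ : ∃ p', i = p' + 1 := ⟨i - 1, by omega⟩
  obtain ⟨p, rfl⟩ : ∃ p', p = p' + 1 := ⟨p - 1, by omega⟩
  obtain ⟨m, rfl⟩ : ∃ p', m = p' + 1 := ⟨m - 1, by omega⟩
  induction j generalizing p m m' n i l with
  | zero =>
    refine B.T_succ_induction' (p := fun φ => B.ins χ _ _ n h₂ (B.ins ψ _ _ _ h₁ φ) =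
      B.ins ψ _ _ n h₄ (B.ins χ _ _ m' h₃ φ)) φ (fun v x => ?_) fun x x' hx hx' => ?_
    · rw [ins_succ_cons B _ (by omega), zero_add, ins_one_cons, ins_one_cons,
        B.ins_app_left ψ _ _ _ _ (by omega : 1 ≤ i) (by omega)]
    · simp only [map_add, hx, hx']
  | succ j ih =>
    obtain ⟨m', rfl⟩ : ∃ p', m' = p' + 1 := ⟨m' - 1, by omega⟩
    obtain ⟨n, rfl⟩ : ∃ p', n = p' + 1 := ⟨n - 1, by omega⟩
    obtain ⟨i, rfl⟩ : ∃ p', i = p' + 1 := ⟨i - 1, by omega⟩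
    obtain ⟨p, rfl⟩ : ∃ p', p = p' + 1 := ⟨p - 1, by omega⟩
    obtain ⟨m, rfl⟩ : ∃ p', m = p' + 1 := ⟨m - 1, by omega⟩
    obtain ⟨l, rfl⟩ : ∃ p', l = p' + 1 := ⟨l - 1, by omega⟩
    refine B.T_succ_induction' (p := fun φ => B.ins χ _ _ _ h₂ (B.ins ψ _ _ _ h₁ φ) =
      B.ins ψ _ _ _ h₄ (B.ins χ _ _ _ h₃ φ)) φ (fun v x => ?_) fun x x' hx hx' => ?_
    · rw [ins_succ_cons B _ (by omega), ins_succ_cons B _ (by omega), ins_succ_cons B _ (by omega),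
        ins_succ_cons B _ (by omega)]
      congr 1
      apply ih <;> omega
    · simp only [map_add, hx, hx']

/-- Leading factors are stripped until ψ enters slot 1. Then χ is inserted into the block v · ψ, and
U-linearity of the insertion takes it past v. -/
theorem ins_ins_mid {p q r m m' n i j l : ℕ} (h₁ : p + q = m + 1) (h₂ : m + r = n + 1)
    (h₃ : q + r = m' + 1) (h₄ : p + m' = n + 1) (φ : B.T p) (ψ : B.T q) (χ : B.T r)
    (hi : 1 ≤ i) (hip : i ≤ p) (hij : i ≤ j) (hj : j < q + i) (hl : l + i = j + 1) :
    B.ins χ j m n h₂ (B.ins ψ i p m h₁ φ) = B.ins (B.ins χ l q m' h₃ ψ) i p n h₄ φ := by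
  obtain ⟨i, rfl⟩ := Nat.exists_eq_add_of_le' hi
  obtain ⟨p, rfl⟩ : ∃ p', p = p' + 1 := ⟨p - 1, by omega⟩
  induction i generalizing p m n j with
  | zero =>
    obtain rfl : l = j := by omega
    refine B.T_succ_induction' (p := fun φ => B.ins χ _ _ n h₂ (B.ins ψ _ _ _ h₁ φ) =
      B.ins (B.ins χ l q m' h₃ ψ) _ _ n h₄ φ) φ (fun v x => ?_) fun x x' hx hx' => ?_
    · rw [zero_add, ins_one_cons, ins_one_cons, ← map_smul,
        B.ins_app_right χ h₃ _ _ (by omega) (by omega) (by omega)]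
    · simp only [map_add, hx, hx']
  | succ i ih =>
    obtain ⟨n, rfl⟩ : ∃ p', n = p' + 1 := ⟨n - 1, by omega⟩
    obtain ⟨p, rfl⟩ : ∃ p', p = p' + 1 := ⟨p - 1, by omega⟩
    obtain ⟨m, rfl⟩ : ∃ p', m = p' + 1 := ⟨m - 1, by omega⟩
    obtain ⟨j, rfl⟩ : ∃ p', j = p' + 1 := ⟨j - 1, by omega⟩
    refine B.T_succ_induction' (p := fun φ => B.ins χ _ _ _ h₂ (B.ins ψ _ _ _ h₁ φ) =
      B.ins (B.ins χ l q m' h₃ ψ) _ _ _ h₄ φ) φ (fun v x => ?_) fun x x' hx hx' => ?_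
    · rw [ins_succ_cons B _ (by omega), ins_succ_cons B _ (by omega), ins_succ_cons B _ (by omega)]
      congr 1
      apply ih <;> omega
    · simp only [map_add, hx, hx']

/-- The right unit constraint v ↦ v ⊗ 1_A is U-linear; the claim is its value at u · 1. -/
theorem smul_one_tensor (u : U) : u • B.cons 1 (B.scalar 1) = B.cons u (B.scalar 1) := by
  have h := (B.runit (LMod.reg k U)).map_smul u (1 : U)
  rw [smul_eq_mul, mul_one] at h
  exact h.symm

theorem ins_one_tensor {p i : ℕ} (hi : 1 ≤ i) (hip : i ≤ p) (h : p + 1 = p + 1) (φ : B.T p) :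
    B.ins (B.cons 1 (B.scalar 1)) i p p h φ = φ := by
  obtain ⟨i, rfl⟩ := Nat.exists_eq_add_of_le' hi
  obtain ⟨p, rfl⟩ : ∃ p', p = p' + 1 := ⟨p - 1, by omega⟩
  induction i generalizing p with
  | zero =>
    refine B.T_succ_induction' (p := fun φ => B.ins (B.cons 1 (B.scalar 1)) _ _ _ h φ = φ) φ
      (fun v x => ?_) fun x x' hx hx' => ?_
    · rw [ins_one_cons, smul_one_tensor, app_cons, app_scalar, map_one, one_smul]
    · rw [map_add, hx, hx']
  | succ i ih =>
    obtain ⟨p, rfl⟩ : ∃ p', p = p' + 1 := ⟨p - 1, by omega⟩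
    refine B.T_succ_induction' (p := fun φ => B.ins (B.cons 1 (B.scalar 1)) _ _ _ h φ = φ) φ
      (fun v x => ?_) fun x x' hx hx' => ?_
    · rw [ins_succ_cons B _ (by omega), ih (by omega) _ _ _ (by omega)]
    · rw [map_add, hx, hx']

theorem one_tensor_ins {p : ℕ} (h : 1 + p = p + 1) (φ : B.T p) :
    B.ins φ 1 1 p h (B.cons 1 (B.scalar 1)) = φ := by
  rw [ins_one_cons, one_smul, app_scalar_one]

theorem ins_append {a b q : ℕ} (w : B.T q) (h : b + 1 + a + q = b + q + a + 1) (x : B.T a) (u : U)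
    (y : B.T b) :
    B.ins w (a + 1) (b + 1 + a) (b + q + a) h (B.append x (B.cons u y)) =
      B.append x (B.append (u • w) y) := by
  rw [← app_append, ← app_append, ← app_append,
    B.ins_app_left w (by omega : b + 1 + q = b + q + 1) rfl h rfl le_rfl (by omega), ins_one_cons]

theorem mul_ins_one_mul : B.ins (B.cons 1 (B.cons 1 (B.scalar 1))) 1 2 3 rfl
      (B.cons 1 (B.cons 1 (B.scalar 1))) = B.cons 1 (B.cons 1 (B.cons 1 (B.scalar 1))) := by
  rw [ins_one_cons, one_smul, app_cons, app_cons, app_scalar, map_one, one_smul]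

theorem mul_ins_two_mul : B.ins (B.cons 1 (B.cons 1 (B.scalar 1))) 2 2 3 rfl
      (B.cons 1 (B.cons 1 (B.scalar 1))) = B.cons 1 (B.cons 1 (B.cons 1 (B.scalar 1))) := by
  have h := B.ins_succ_cons (p := 1) (r := 2) (B.cons 1 (B.cons 1 (B.scalar 1))) le_rfl rfl 1
    (B.cons 1 (B.scalar 1))
  refine h.trans ?_
  rw [ins_one_cons, one_smul, app_scalar_one]

theorem mul_ins_one_unit : B.ins (B.scalar 1) 1 2 1 rfl (B.cons 1 (B.cons 1 (B.scalar 1))) =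
    B.cons 1 (B.scalar 1) := by
  rw [ins_one_cons, one_smul, app_scalar, map_one, one_smul]

theorem mul_ins_two_unit : B.ins (B.scalar 1) 2 2 1 rfl (B.cons 1 (B.cons 1 (B.scalar 1))) =
    B.cons 1 (B.scalar 1) := by
  have h := B.ins_succ_cons (p := 1) (r := 0) (B.scalar 1) le_rfl rfl 1 (B.cons 1 (B.scalar 1))
  refine h.trans ?_
  rw [ins_one_cons, one_smul, app_scalar, map_one, one_smul]

/-- The operad of tensor powers of a left bialgebroid. -/
def tensorOperad : OperadWithMultiplication k (fun p => B.T p) where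
  comp i p q r h := LinearMap.mk₂ k (fun φ w => B.ins w i p r h φ)
    (fun φ φ' w => map_add _ _ _)
    (fun c φ w => (B.ins w i p r h).map_smul_of_tower c φ)
    (fun φ w w' => by rw [ins_add, LinearMap.add_apply])
    (fun c φ w => by rw [ins_smul])
  comp_zero i p q r h φ ψ hi := by rw [LinearMap.mk₂_apply, ins_eq_zero B _ _ hi]; rfl
  comp_comp_lt h₁ h₂ h₃ h₄ φ ψ χ hj hi hip :=
    B.ins_ins_lt h₁ h₂ h₃ h₄ φ ψ χ hj hi (by omega) hip
  comp_comp_mid h₁ h₂ h₃ h₄ φ ψ χ hi hip hij hj :=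
    B.ins_ins_mid h₁ h₂ h₃ h₄ φ ψ χ hi hip hij hj (by omega)
  -- Insertions into two different factors of φ commute: this is the first relation read backwards,
  -- with ψ and χ exchanged.
  comp_comp_ge h₁ h₂ h₃ h₄ φ ψ χ hi hip hij hj :=
    (B.ins_ins_lt h₃ h₄ h₁ h₂ φ χ ψ hi (by omega) (by omega) (by omega)).symm
  one := B.cons 1 (B.scalar 1)
  comp_one φ hi hip := B.ins_one_tensor hi hip _ φ
  one_comp φ := B.one_tensor_ins (Nat.add_comm _ _) φ
  mul := B.cons 1 (B.cons 1 (B.scalar 1))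
  unit := B.scalar 1
  mul_assoc := B.mul_ins_one_mul.trans B.mul_ins_two_mul.symm
  mul_unit_left := B.mul_ins_one_unit
  mul_unit_right := B.mul_ins_two_unit

theorem tensorOperad_comp {p q r : ℕ} (i : ℕ) (h : p + q = r + 1) (φ : B.T p) (w : B.T q) :
    B.tensorOperad.comp i h φ w = B.ins w i p r h φ := rfl

end TensorPowerMaps

end LeftBialgebroid

end CycOpp

namespace CycOpp

/-! ### Rotation of U-linear maps by means of the contraaction. -/

section Trace

variable {k : Type v} {A U : Type u} [CommRing k] [Ring A] [Algebra k A] [Ring U] [Algebra k U]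
  {B : LeftBialgebroid k A U} {hL : B.IsLeftHopf}
  {M : Type w} [AddCommGroup M] [Module k M] [Module U M] [IsScalarTower k U M]
  [Module Aᵐᵒᵖ M] [IsScalarTower k Aᵐᵒᵖ M]
  {N P : LMod k U}

namespace LeftBialgebroid

theorem mulOn_takeuchi (a : A) (u : U) :
    B.mulOn (B.t a) (1 : U) (B.comul u) = B.mulOn (1 : U) (B.src a) (B.comul u) := by
  obtain ⟨X, hX⟩ := B.exists_rep u
  have h := congrArg (B.mulOn (1 : U) (1 : U)) (B.takeuchi a u X hX)
  simpa only [mulOn_proj, opOn_mul, opOn_tmul, one_smul, smul_eq_mul, mul_one, ← hX] using h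

/-- `x ⊗_A y ↦ f(x) ε(y)`. -/
def counitPair (B : LeftBialgebroid k A U) (f : B.HomAop M) : B.Tens U U →ₗ[k] M :=
  BalTensor.lift _ _ (LinearMap.mk₂ k (fun x y => MulOpposite.op (B.counit y) • f.1 x)
    (fun x x' y => by rw [map_add, smul_add])
    (fun c x y => by rw [map_smul, smul_comm])
    (fun x y y' => by rw [map_add, MulOpposite.op_add, add_smul])
    (fun c x y => by rw [map_smul, MulOpposite.op_smul, smul_assoc])) <| by
    intro a x y
    simp only [LinearMap.mk₂_apply, Algebra.lsmul_coe, smul_eq_mul]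
    rw [f.2, counit_src_mul, MulOpposite.op_mul, mul_smul]

omit [Module U M] [IsScalarTower k U M] in
theorem counitPair_comul (f : B.HomAop M) (u : U) : B.counitPair f (B.comul u) = f.1 u := by
  obtain ⟨X, hX⟩ := B.exists_rep u
  nth_rw 2 [← B.counit_right u X hX]
  rw [← hX]
  clear hX
  induction X with
  | zero => simp only [map_zero]
  | add x y hx hy => simp only [map_add, hx, hy]
  | tmul x y => exact (f.2 (B.counit y) x).symm

omit [Module U M] [IsScalarTower k U M] in
theorem counitPair_mulOn (f : B.HomAop M) (v : U) (z : B.Tens U U) :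
    B.counitPair f (B.mulOn v (1 : U) z) = B.counitPair (B.rmul v f) z := by
  refine LinearMap.congr_fun (f := B.counitPair f ∘ₗ B.mulOn v (1 : U))
    (g := B.counitPair (B.rmul v f)) (BalTensor.hom_ext fun x y => ?_) z
  change MulOpposite.op (B.counit (y * 1)) • f.1 (x * v) = MulOpposite.op (B.counit y) • f.1 (x * v)
  rw [mul_one]

theorem act_mulOn (n : N) (p : P) (x y : U) (z : B.Tens U U) :
    B.act n p (B.mulOn x y z) = B.act (x • n) (y • p) z := by
  refine LinearMap.congr_fun (f := B.act n p ∘ₗ B.mulOn x y)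
    (g := B.act (x • n) (y • p)) (BalTensor.hom_ext fun x' y' => ?_) z
  change B.tm ((x' * x) • n) ((y' * y) • p) = B.tm (x' • x • n) (y' • y • p)
  rw [mul_smul, mul_smul]

end LeftBialgebroid

open LeftBialgebroid

variable (Y : AYDContramodule B hL M)

namespace AYDContramodule

/-- `f ↦ s(a) f(-)`. -/
def srcSmul (a : A) (f : B.HomAop M) : B.HomAop M :=
  ⟨(Algebra.lsmul k k M (B.src a)) ∘ₗ f.1, fun b z => by
    change B.src a • f.1 (B.t b * z) = MulOpposite.op b • B.src a • f.1 z
    rw [f.2, ← Y.right_eq, ← Y.right_eq, smul_smul, smul_smul, src_t]⟩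

/-- Since s(a)f(x) = γ(y ↦ f(x) ε(y s(a))), the left side is a double contraaction.
Contraassociativity turns it into γ(z ↦ f(z₍₁₎) ε(z₍₂₎ s(a))). The Takeuchi condition trades s(a) on
the second leg for t(a) on the first, and the counit axiom leaves f(z t(a)). -/
theorem γ_srcSmul (a : A) (f : B.HomAop M) :
    Y.γ (Y.srcSmul a f) = Y.γ (B.rmul (B.t a) f) := by
  have h := Y.γ_assoc (B.counitPair f ∘ₗ B.mulOn (1 : U) (B.src a)) fun b x y => by
    change MulOpposite.op (B.counit (B.t b * y * B.src a)) • f.1 (x * 1) =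
      MulOpposite.op b • MulOpposite.op (B.counit (y * B.src a)) • f.1 (x * 1)
    rw [mul_assoc, counit_t_mul, MulOpposite.op_mul, mul_smul]
  refine Eq.trans (congrArg Y.γ ?_) (h.trans (congrArg Y.γ ?_))
  · refine Subtype.ext (LinearMap.ext fun x => ?_)
    change B.src a • f.1 x = Y.γ _
    rw [Y.left_eq]
    congr 1
    refine Subtype.ext (LinearMap.ext fun y => ?_)
    change MulOpposite.op (B.counit (y * B.src a)) • f.1 x =
      MulOpposite.op (B.counit (y * B.src a)) • f.1 (x * 1)
    rw [mul_one]
  · refine Subtype.ext (LinearMap.ext fun z => ?_)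
    change B.counitPair f (B.mulOn (1 : U) (B.src a) (B.comul z)) = (B.rmul (B.t a) f).1 z
    rw [← mulOn_takeuchi, counitPair_mulOn, counitPair_comul]

/-- `z ↦ F(n ⊗_A z p)`. -/
def slot (F : B.tn N P →ₗ[U] M) (n : N) (p : P) : B.HomAop M :=
  ⟨(F.restrictScalars k) ∘ₗ (B.tm n) ∘ₗ ((LinearMap.toSpanSingleton U P p).restrictScalars k),
    fun a z => by
      change F (B.tm n ((B.t a * z) • p)) = MulOpposite.op a • F (B.tm n (z • p))
      rw [mul_smul, ← t_smul_tm, map_smul, Y.right_eq]⟩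

@[simp] theorem slot_apply (F : B.tn N P →ₗ[U] M) (n : N) (p : P) (z : U) :
    (Y.slot F n p).1 z = F (B.tm n (z • p)) := rfl

/-- `p ⊗_A n ↦ γ(z ↦ F(n ⊗_A z p))` as a `k`-linear map. -/
def traceK (F : B.tn N P →ₗ[U] M) : B.tn P N →ₗ[k] M :=
  B.tlift (LinearMap.mk₂ k (fun p n => Y.γ (Y.slot F n p))
    (fun p p' n => by
      rw [← map_add]
      congr 1
      refine Subtype.ext (LinearMap.ext fun z => ?_)
      change F (B.tm n (z • (p + p'))) = F (B.tm n (z • p)) + F (B.tm n (z • p'))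
      rw [smul_add, map_add, map_add])
    (fun c p n => by
      rw [← map_smul]
      congr 1
      refine Subtype.ext (LinearMap.ext fun z => ?_)
      change F (B.tm n (z • c • p)) = c • F (B.tm n (z • p))
      rw [smul_comm, map_smul, F.map_smul_of_tower])
    (fun p n n' => by
      rw [← map_add]
      congr 1
      refine Subtype.ext (LinearMap.ext fun z => ?_)
      change F (B.tm (n + n') (z • p)) = F (B.tm n (z • p)) + F (B.tm n' (z • p))
      rw [map_add, LinearMap.add_apply, map_add])
    (fun c p n => by
      rw [← map_smul]
      congr 1
      refine Subtype.ext (LinearMap.ext fun z => ?_)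
      change F (B.tm (c • n) (z • p)) = c • F (B.tm n (z • p))
      rw [(B.tm (N := N) (P := P)).map_smul, LinearMap.smul_apply, F.map_smul_of_tower])) fun a p n => by
    rw [LinearMap.mk₂_apply, LinearMap.mk₂_apply]
    -- Replacing p by t(a)p multiplies z by t(a) on the right. `γ_srcSmul` trades this for s(a) in
    -- front of F, which U-linearity moves onto n.
    refine Eq.trans (congrArg Y.γ ?_)
      ((Y.γ_srcSmul a (Y.slot F n p)).symm.trans (congrArg Y.γ ?_))
    · refine Subtype.ext (LinearMap.ext fun z => ?_)
      change F (B.tm n (z • B.t a • p)) = F (B.tm n ((z * B.t a) • p))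
      rw [mul_smul]
    · refine Subtype.ext (LinearMap.ext fun z => ?_)
      change B.src a • F (B.tm n (z • p)) = F (B.tm (B.src a • n) (z • p))
      rw [← src_smul_tm, F.map_smul]

/-- By U-linearity u₊ F(n ⊗ u₋ z p) = F(u₊₍₁₎ n ⊗ u₊₍₂₎ u₋ z p), and u₊₍₁₎ ⊗ u₊₍₂₎ u₋ = u ⊗ 1 by
definition of the translation map. -/
theorem lAct_slot (F : B.tn N P →ₗ[U] M) (n : N) (p : P) (u : U) :
    lAct hL Y.right_eq (Y.slot F n p) u = Y.slot F (u • n) p := by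
  refine Subtype.ext (LinearMap.ext fun z => ?_)
  change B.evalL Y.right_eq (Y.slot F n p) z (trL hL u) = F (B.tm (u • n) (z • p))
  have h : B.evalL Y.right_eq (Y.slot F n p) z =
      (F.restrictScalars k) ∘ₗ B.act n (z • p) ∘ₗ B.galL := BalTensor.hom_ext fun x y => by
    refine Eq.trans (?_ : _ = F (x • B.tm n (y • z • p)))
      (?_ : _ = F (B.act n (z • p) (B.galL (TensMid.mk k B.t (x ⊗ₜ y)))))
    · change x • F (B.tm n ((y * z) • p)) = _
      rw [F.map_smul, mul_smul]
    · rw [galL_mk, act_mulOn, one_smul]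
      rfl
  refine (LinearMap.congr_fun h _).trans ?_
  change F (B.act n (z • p) (B.galL (trL hL u))) = _
  rw [galL_trL]
  change F (B.tm (u • n) ((1 : U) • z • p)) = _
  rw [one_smul]

/-- By `lAct_slot` the aYD compatibility reads u γ(z ↦ F(n ⊗ z p)) = γ(z ↦ F(u₍₂₎ n ⊗ z u₍₁₎ p)),
and the right side is the rotated map at u₍₁₎ p ⊗ u₍₂₎ n. -/
theorem traceK_smul (F : B.tn N P →ₗ[U] M) (u : U) (p : P) (n : N) :
    Y.traceK F (u • B.tm p n) = u • Y.traceK F (B.tm p n) := by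
  obtain ⟨X, hX⟩ := B.exists_cls u
  have h := Y.compat u (Y.slot F n p) X hX
  refine Eq.trans ?_ h.symm
  rw [smul_tm, ← hX]
  clear h hX
  induction X with
  | zero => simp only [map_zero]
  | add x y hx hy => simp only [map_add, hx, hy]
  | tmul x y =>
    rw [TensorProduct.lift.tmul]
    change Y.γ (Y.slot F (y • n) (x • p)) =
      Y.γ (B.rmul x (lAct hL Y.right_eq (Y.slot F n p) y))
    rw [lAct_slot]
    congr 1
    refine Subtype.ext (LinearMap.ext fun z => ?_)
    change F (B.tm (y • n) (z • x • p)) = F (B.tm (y • n) ((z * x) • p))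
    rw [mul_smul]

/-- The cyclic rotation `Hom_U(N ⊗_A P, M) → Hom_U(P ⊗_A N, M)`. -/
def trace (F : B.tn N P →ₗ[U] M) : B.tn P N →ₗ[U] M :=
  B.tliftU (Y.traceK F) fun u p n => Y.traceK_smul F u p n

theorem trace_tm (F : B.tn N P →ₗ[U] M) (p : P) (n : N) :
    Y.trace F (B.tm p n) = Y.γ (Y.slot F n p) := rfl

end AYDContramodule

/-! ### Right Hopf structure: extending A-linear maps on N to U-linear maps on N ⊗_A U. -/

namespace LeftBialgebroid

/-- `x ↦ F(x ⊗_A p)`. -/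
def slotA (F : B.tn N P →ₗ[U] M) (p : P) : B.HomA N M :=
  ⟨(F.restrictScalars k) ∘ₗ (B.tm (N := N) (P := P)).flip p, fun a x => by
    change F (B.tm (B.src a • x) p) = B.src a • F (B.tm x p)
    rw [← src_smul_tm, F.map_smul]⟩

variable (hR : B.IsRightHopf)

-- Here u_[+] F(u_[-] n ⊗ p) = F(u_[+](1) u_[-] n ⊗ u_[+](2) p), and the Galois map sends u_[+] ⊗
-- u_[-] to 1 ⊗ u. For P = U and p = 1 this recovers F from its restriction to N ⊗ 1.
omit [Module Aᵐᵒᵖ M] [IsScalarTower k Aᵐᵒᵖ M] in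
theorem evalR_slotA (F : B.tn N P →ₗ[U] M) (p : P) (n : N) (u : U) :
    B.evalR (slotA F p) n (trR hR u) = F (B.tm n (u • p)) := by
  have h : B.evalR (slotA F p) n =
      (F.restrictScalars k) ∘ₗ B.act n p ∘ₗ B.galR := BalTensor.hom_ext fun x y => by
    refine Eq.trans (?_ : _ = F (x • B.tm (y • n) p))
      (?_ : _ = F (B.act n p (B.galR (TensMid.mk k B.src (x ⊗ₜ y)))))
    · change x • F (B.tm (y • n) p) = _
      rw [F.map_smul]
    · rw [galR_mk, act_mulOn, one_smul]
      rfl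
  refine (LinearMap.congr_fun h _).trans ?_
  change F (B.act n p (B.galR (trR hR u))) = _
  rw [galR_trR]
  change F (B.tm ((1 : U) • n) (u • p)) = _
  rw [one_smul]

theorem trR_one : trR hR 1 = TensMid.mk k B.src (1 ⊗ₜ 1) := by
  apply hR.1
  rw [galR_trR, galR_mk, B.comul_one, mulOn_proj, opOn_tmul, one_smul]

/-- Both sides have Galois image t(a) ⊗ u = 1 ⊗ s(a)u. This makes n ⊗ u ↦ u_[+] f(u_[-] n) balanced
over A. -/
theorem trR_src_mul (a : A) (u : U) :
    trR hR (B.src a * u) = sndMul B.src (B.t a) (trR hR u) := by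
  apply hR.1
  rw [galR_sndMul, galR_trR, galR_trR, mulOn_proj, opOn_tmul, one_smul, smul_eq_mul, mul_one]
  have h := BalTensor.mk_balanced (k := k) (fun a : A => Algebra.lsmul k k U (B.t a))
    (fun a : A => Algebra.lsmul k k U (B.src a)) a (1 : U) u
  simp only [Algebra.lsmul_coe, smul_eq_mul, mul_one] at h
  exact h.symm

omit [Module Aᵐᵒᵖ M] [IsScalarTower k Aᵐᵒᵖ M] in
theorem evalR_smul (f : B.HomA N M) (v : U) (n : N) (z : B.TensR) :
    B.evalR f (v • n) z = B.evalR f n (sndMul B.src v z) := by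
  refine LinearMap.congr_fun (f := B.evalR f (v • n)) (g := B.evalR f n ∘ₗ sndMul B.src v)
    (BalTensor.hom_ext fun x y => ?_) z
  change x • f.1 (y • v • n) = x • f.1 ((y * v) • n)
  rw [mul_smul]

omit [Module Aᵐᵒᵖ M] [IsScalarTower k Aᵐᵒᵖ M] in
theorem smul_evalR (f : B.HomA N M) (v : U) (n : N) (z : B.TensR) :
    v • B.evalR f n z = B.evalR f n (fstMul B.src v z) := by
  refine LinearMap.congr_fun (f := (Algebra.lsmul k k M v) ∘ₗ B.evalR f n)
    (g := B.evalR f n ∘ₗ fstMul B.src v) (BalTensor.hom_ext fun x y => ?_) z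
  change v • x • f.1 (y • n) = (v * x) • f.1 (y • n)
  rw [mul_smul]

/-- `n ⊗_A u ↦ u₍₊₎ f(u₍₋₎ n)` as a `k`-linear map. -/
noncomputable def extK (f : B.HomA N M) : B.tn N (LMod.reg k U) →ₗ[k] M :=
  B.tlift (LinearMap.mk₂ k (fun n (u : LMod.reg k U) => (rAct hR u f).1 n)
    (fun n n' u => map_add _ _ _) (fun c n u => map_smul _ _ _)
    (fun n u u' => by
      change B.evalR f n (trR hR ((u : U) + u')) = _
      rw [map_add, map_add]
      rfl)
    (fun c n u => by
      change B.evalR f n (trR hR (c • (u : U))) = _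
      rw [map_smul, map_smul]
      rfl)) fun a n u => by
    change B.evalR f (B.t a • n) (trR hR u) = B.evalR f n (trR hR (B.src a * u))
    rw [trR_src_mul, evalR_smul]

-- For d = x ⊗ y the hypothesis forces z = (yu)_[+] ⊗ (yu)_[-] x, since the Galois map is injective,
-- and the claim is immediate; the general case is linear in d. With d = Δ v and z = v u_[+] ⊗ u_[-]
-- it gives U-linearity of the extension.
omit [Module Aᵐᵒᵖ M] [IsScalarTower k Aᵐᵒᵖ M] in
theorem extK_act (f : B.HomA N M) (n : N) (u : U) (z : B.TensR)
    (d : B.tn (LMod.reg k U) (LMod.reg k U))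
    (h : B.galR z = B.act (N := LMod.reg k U) (P := LMod.reg k U) (1 : U) u d) :
    extK hR f (B.act (P := LMod.reg k U) n u d) = B.evalR f n z := by
  have hz : z = (LinearEquiv.ofBijective B.galR hR).symm
      (B.act (N := LMod.reg k U) (P := LMod.reg k U) (1 : U) u d) := by
    rw [← h]
    exact ((LinearEquiv.ofBijective B.galR hR).symm_apply_apply z).symm
  rw [hz]
  refine LinearMap.congr_fun (f := extK hR f ∘ₗ B.act (P := LMod.reg k U) n u)
    (g := B.evalR f n ∘ₗ (LinearEquiv.ofBijective B.galR hR).symm.toLinearMap ∘ₗ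
      B.act (N := LMod.reg k U) (P := LMod.reg k U) (1 : U) u) (tn_ext fun x y => ?_) d
  change B.evalR f ((x : U) • n) (trR hR ((y : U) * u)) =
    B.evalR f n ((LinearEquiv.ofBijective B.galR hR).symm
      (B.proj U U (((x : U) * 1) ⊗ₜ ((y : U) * u))))
  rw [evalR_smul]
  congr 1
  rw [LinearEquiv.eq_symm_apply]
  change B.galR (sndMul B.src x (trR hR ((y : U) * u))) = _
  rw [galR_sndMul, galR_trR, mulOn_proj,
    opOn_tmul, one_smul, smul_eq_mul, mul_one, mul_one]

/-- The extension of `f` in `Hom_A(N, M)` to `Hom_U(N ⊗_A U, M)`. -/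
noncomputable def ext (f : B.HomA N M) : B.tn N (LMod.reg k U) →ₗ[U] M :=
  B.tliftU (extK hR f) fun v n u => by
    change _ = (v : U) • B.evalR f n (trR hR u)
    rw [smul_tm, smul_evalR]
    refine extK_act hR f n u _ _ ?_
    rw [galR_fstMul, galR_trR, diag_tmul]
    rfl

omit [Module Aᵐᵒᵖ M] [IsScalarTower k Aᵐᵒᵖ M] in
theorem ext_tm (f : B.HomA N M) (n : N) (u : U) :
    ext hR f (B.tm (P := LMod.reg k U) n u) = B.evalR f n (trR hR u) := rfl

end LeftBialgebroid

end Trace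

end CycOpp

namespace CycOpp

/-! ### Formal part: from cyclic unital opposite modules to cyclic modules. -/

namespace CyclicUnitalOppositeModule

variable {k : Type*} [CommRing k] {O : ℕ → Type*}
    [∀ n, AddCommGroup (O n)] [∀ n, Module k (O n)] {P : OperadWithMultiplication k O}
    {N : ℕ → Type*} [∀ n, AddCommGroup (N n)] [∀ n, Module k (N n)]
    (Z : CyclicUnitalOppositeModule P N)

theorem t_pow_bul_zero {p n m : ℕ} (h : m + p = n + 1) (φ : O p) (x : N n) (j : ℕ) (hj : j ≤ m) :
    (Z.t m ^ j) (Z.bul 0 h φ x) = Z.bul j h φ ((Z.t n ^ j) x) := by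
  induction j with
  | zero => rfl
  | succ j ih =>
    rw [pow_succ', pow_succ', Module.End.mul_apply, Module.End.mul_apply, ih (by omega),
      Z.t_bul h φ _ (by omega)]

/-- `t(φ •_m x) = φ •_0 t^p(x)` for the last index `m`. -/
theorem t_bul_last {p n m : ℕ} (h : m + p = n + 1) (φ : O p) (x : N n) :
    Z.t m (Z.bul m h φ x) = Z.bul 0 h φ ((Z.t n ^ p) x) := by
  -- Moving t^m through φ •_0 t^p(x) gives φ •_m t^{m+p}(x) = φ •_m x, as m + p = n + 1. One more t
  -- on the left completes the cycle there.
  have h₁ := Z.t_pow_bul_zero h φ ((Z.t n ^ p) x) m le_rfl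
  rw [← Module.End.mul_apply, ← pow_add, h, Z.t_pow, Module.End.one_apply] at h₁
  rw [← h₁, ← Module.End.mul_apply, ← pow_succ', Z.t_pow, Module.End.one_apply]

/-- Both sides are a composite of μ with itself acting on x, namely μ ∘₁ μ and μ ∘₂ μ. The index i =
0 is allowed, as needed for the last face. -/
theorem mul_bul_mul {n m l i j : ℕ} (h₁ : m + 2 = n + 1) (h₂ : l + 2 = m + 1) (x : N n)
    (hij : j = i + 1) (hi : i ≤ l) :
    Z.bul i h₂ P.mul (Z.bul i h₁ P.mul x) = Z.bul i h₂ P.mul (Z.bul j h₁ P.mul x) := by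
  subst hij
  rw [Z.bul_bul_mid h₁ h₂ (r := 3) rfl (by omega) P.mul P.mul x le_rfl (by omega) (by omega) hi,
    Z.bul_bul_mid h₁ h₂ (r := 3) rfl (by omega) P.mul P.mul x (by omega) (by omega) (by omega) hi,
    Nat.sub_self, Nat.add_sub_cancel_left]
  exact congrArg (fun φ => Z.bul i _ φ x) P.mul_assoc

theorem mul_bul_unit_self {n m i : ℕ} (h₁ : m + 0 = n + 1) (h₂ : n + 2 = m + 1) (x : N n)
    (hi : i ≤ n) : Z.bul i h₂ P.mul (Z.bul i h₁ P.unit x) = x := by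
  rw [Z.bul_bul_mid h₁ h₂ (r := 1) rfl rfl P.mul P.unit x le_rfl (by omega) (by omega) hi,
    Nat.sub_self]
  exact (congrArg (fun φ => Z.bul i _ φ x) P.mul_unit_left).trans (Z.one_bul x hi)

theorem mul_bul_unit_succ {n m i j : ℕ} (h₁ : m + 0 = n + 1) (h₂ : n + 2 = m + 1) (x : N n)
    (hi : i ≤ n) (hij : j = i + 1) : Z.bul i h₂ P.mul (Z.bul j h₁ P.unit x) = x := by
  subst hij
  rw [Z.bul_bul_mid h₁ h₂ (r := 1) rfl rfl P.mul P.unit x (by omega) (by omega) (by omega) hi,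
    Nat.add_sub_cancel_left]
  exact (congrArg (fun φ => Z.bul i _ φ x) P.mul_unit_right).trans (Z.one_bul x hi)

theorem face_of_lt {i n m : ℕ} (h : n = m + 1) (hi : i < n) (x : N n) :
    Z.face i h x = Z.bul i (p := 2) (congrArg (· + 1) h.symm) P.mul x := by
  rw [face, if_neg hi.ne]

theorem face_last {n m : ℕ} (h : n = m + 1) (x : N n) :
    Z.face n h x = Z.bul 0 (p := 2) (congrArg (· + 1) h.symm) P.mul (Z.t n x) := by
  rw [face, if_pos rfl]
  rfl

/-- The cyclic module induced by a cyclic unital opposite module. -/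
theorem isCyclicModule (h : ∀ n : ℕ, n + 1 = n + 1) :
    IsCyclicModule (fun n i => Z.face i (h n)) (fun n j => Z.degen j (h n)) Z.t where
  d_d n i j x hij hj := by
    rcases Nat.lt_or_ge j (n + 1) with hj' | hj'
    · rw [Z.face_of_lt _ (by omega), Z.face_of_lt _ (by omega), Z.face_of_lt _ (by omega),
        Z.face_of_lt _ (by omega)]
      rcases hij.lt_or_eq with h | rfl
      · exact Z.bul_bul_ge _ _ _ _ _ _ _ (by omega) (by omega)
      · exact (Z.mul_bul_mul _ _ x rfl (by omega)).symm
    -- Now last faces μ •_0 t(-) occur, and t is moved inwards. For i = 0 the operations μ •_0 and μ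
    -- •_1 meet; for i = n + 1 both sides wrap around and contain t². Both cases are associativity
    -- of μ.
    obtain rfl : j = n + 1 := by omega
    rw [Z.face_last, Z.face_last, Z.face_of_lt _ (by omega : i < n + 1 + 1)]
    rcases hij.lt_or_eq with h | rfl
    · rw [Z.face_of_lt _ h, Z.t_bul _ _ _ h]
      rcases Nat.eq_zero_or_pos i with rfl | hi
      · exact Z.mul_bul_mul _ _ _ rfl (by omega)
      · exact Z.bul_bul_lt _ _ _ _ _ _ _ hi (by omega)
    · rw [Z.face_last, Z.t_bul _ _ _ (by omega), Z.t_bul_last]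
      exact (Z.mul_bul_mul _ _ _ rfl (by omega)).symm
  s_s n i j x hij hj := (Z.bul_bul_ge _ _ _ _ _ _ _ (by omega) (by omega))
  d_s_lt n i j x hij hj := by
    rw [Z.face_of_lt _ (by omega), Z.face_of_lt _ (by omega)]
    exact Z.bul_bul_ge _ _ _ _ _ _ _ (by omega) (by omega)
  d_s_self n j x hj := by
    rw [Z.face_of_lt _ (by omega)]
    exact Z.mul_bul_unit_succ _ _ x hj rfl
  d_s_succ n j x hj := by
    rcases hj.lt_or_eq with h | rfl
    · rw [Z.face_of_lt _ (by omega)]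
      exact Z.mul_bul_unit_self _ _ x (by omega)
    -- The unit has arity 0, so t(e •_{n+1} x) = e •_0 t^0(x) = e •_0 x, and the unit law at index 0
    -- applies.
    · rw [Z.face_last, degen, Z.t_bul_last]
      exact Z.mul_bul_unit_self _ _ x (by omega)
  d_s_gt n i j x hij hi := by
    rcases hi.lt_or_eq with h | rfl
    · rw [Z.face_of_lt _ (by omega), Z.face_of_lt _ h]
      exact Z.bul_bul_lt _ _ _ _ _ _ _ (by omega) (by omega)
    · rw [Z.face_last, Z.face_last, degen, Z.t_bul _ _ _ (by omega)]
      exact Z.bul_bul_ge _ _ _ _ _ _ _ (by omega) (by omega)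
  d_t n i x hi := by
    rcases hi.lt_or_eq with h | rfl
    · rw [Z.face_of_lt _ (by omega), Z.face_of_lt _ (by omega), Z.t_bul _ _ _ h]
    · rw [Z.face_last, Z.face_of_lt _ (by omega), Z.t_bul_last]
      rfl
  d_zero_t n x := by
    rw [Z.face_last, Z.face_of_lt _ (by omega)]
  s_t n i x hi := (Z.t_bul _ _ _ (by omega)).symm
  s_zero_t n x := by
    rw [degen, degen, Z.t_bul_last, Z.t_bul _ _ _ (by omega)]
    rfl
  t_pow := Z.t_pow

end CyclicUnitalOppositeModule

/-! ### Transport of structure. -/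

section Transport

variable {k : Type*} [CommRing k] {O : ℕ → Type*}
    [∀ n, AddCommGroup (O n)] [∀ n, Module k (O n)] {P : OperadWithMultiplication k O}
    {N N' : ℕ → Type*} [∀ n, AddCommGroup (N n)] [∀ n, Module k (N n)]
    [∀ n, AddCommGroup (N' n)] [∀ n, Module k (N' n)]

/-- Transport of a cyclic unital opposite module along isomorphisms. -/
def CyclicUnitalOppositeModule.transport (Z : CyclicUnitalOppositeModule P N)
    (e : ∀ n, N n ≃ₗ[k] N' n) : CyclicUnitalOppositeModule P N' where
  bul i p n m h := LinearMap.mk₂ k (fun φ x => e m (Z.bul i h φ ((e n).symm x)))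
    (fun φ φ' x => by rw [map_add, LinearMap.add_apply, map_add])
    (fun c φ x => by rw [map_smul, LinearMap.smul_apply, map_smul])
    (fun φ x x' => by rw [map_add, map_add, map_add])
    (fun c φ x => by rw [map_smul, map_smul, map_smul])
  bul_zero i p n m h φ x hi := by
    rw [LinearMap.mk₂_apply, Z.bul_zero i h φ _ hi, map_zero]
  bul_bul_lt h₁ h₂ h₃ h₄ φ ψ x hj hi := by
    simp only [LinearMap.mk₂_apply, LinearEquiv.symm_apply_apply]
    rw [Z.bul_bul_lt h₁ h₂ h₃ h₄ φ ψ _ hj hi]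
  bul_bul_mid h₁ h₂ h₃ h₄ φ ψ x a b c d := by
    simp only [LinearMap.mk₂_apply, LinearEquiv.symm_apply_apply]
    rw [Z.bul_bul_mid h₁ h₂ h₃ h₄ φ ψ _ a b c d]
  bul_bul_ge h₁ h₂ h₃ h₄ φ ψ x hi hj := by
    simp only [LinearMap.mk₂_apply, LinearEquiv.symm_apply_apply]
    rw [Z.bul_bul_ge h₁ h₂ h₃ h₄ φ ψ _ hi hj]
  one_bul {n} {i} x hi := by
    rw [LinearMap.mk₂_apply, Z.one_bul _ hi, LinearEquiv.apply_symm_apply]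
  t n := (e n).toLinearMap ∘ₗ Z.t n ∘ₗ (e n).symm.toLinearMap
  t_pow n := by
    have h : ∀ j, ((e n).toLinearMap ∘ₗ Z.t n ∘ₗ (e n).symm.toLinearMap) ^ j =
        (e n).toLinearMap ∘ₗ (Z.t n ^ j) ∘ₗ (e n).symm.toLinearMap := by
      intro j
      induction j with
      | zero => ext x; simp
      | succ j ih => rw [pow_succ, ih, pow_succ]; ext x; simp
    rw [h, Z.t_pow]
    ext x
    simp
  t_bul h φ x hi := by
    simp only [LinearMap.mk₂_apply, LinearMap.comp_apply, LinearEquiv.coe_coe,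
      LinearEquiv.symm_apply_apply]
    rw [Z.t_bul h φ _ hi]

end Transport

end CycOpp

namespace CycOpp

open LeftBialgebroid

/-! ### The cyclic structure on Hom_U(U^{⊗(n+1)}, M). -/

section CyclicModel

variable {k : Type v} {A U : Type u} [CommRing k] [Ring A] [Algebra k A] [Ring U] [Algebra k U]
  {B : LeftBialgebroid k A U} {hL : B.IsLeftHopf}
  {M : Type w} [AddCommGroup M] [Module k M] [Module U M] [IsScalarTower k U M]
  [Module Aᵐᵒᵖ M] [IsScalarTower k Aᵐᵒᵖ M]

variable (M) in
/-- `Hom_U(U^{⊗_A (n + 1)}, M)`, the model of `Hom_A(U^{⊗_A n}, M)` on which all cyclic rotations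
are visible. -/
abbrev LeftBialgebroid.CycChain (B : LeftBialgebroid k A U) (n : ℕ) : Type (max u w) :=
  B.T (n + 1) →ₗ[U] M

namespace LeftBialgebroid

omit [Module Aᵐᵒᵖ M] [IsScalarTower k Aᵐᵒᵖ M] in
theorem ext_comp_snocEquiv_symm (hR : B.IsRightHopf) {n : ℕ} (f : B.Chain M n) (y : B.T n) (u : U) :
    (ext hR f ∘ₗ (B.snocEquiv n).symm.toLinearMap) (B.snoc y u) = B.evalR f y (trR hR u) := by
  rw [LinearMap.comp_apply, ← snocEquiv_tm, LinearEquiv.coe_coe, LinearEquiv.symm_apply_apply,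
    ext_tm]

variable (M) in
/-- The isomorphism `Hom_U(U^{⊗_A (n + 1)}, M) ≅ Hom_A(U^{⊗_A n}, M)`, `F ↦ F(- | 1)`. -/
noncomputable def chainEquiv (hR : B.IsRightHopf) (n : ℕ) : B.CycChain M n ≃ₗ[k] B.Chain M n where
  toFun F := slotA (P := LMod.reg k U) (F ∘ₗ (B.snocEquiv n).toLinearMap) (1 : U)
  map_add' F G := rfl
  map_smul' c F := rfl
  invFun f := ext hR f ∘ₗ (B.snocEquiv n).symm.toLinearMap
  left_inv F := by
    have h : ext hR (slotA (P := LMod.reg k U) (F ∘ₗ (B.snocEquiv n).toLinearMap) (1 : U)) =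
        F ∘ₗ (B.snocEquiv n).toLinearMap := tn_extU fun y u => by
      rw [ext_tm, evalR_slotA]
      congr 2
      exact mul_one (u : U)
    refine LinearMap.ext fun z => ?_
    refine (LinearMap.congr_fun h ((B.snocEquiv n).symm z)).trans ?_
    rw [LinearMap.comp_apply, LinearEquiv.coe_coe, LinearEquiv.apply_symm_apply]
  right_inv f := Subtype.ext <| LinearMap.ext fun y => by
    change (ext hR f ∘ₗ (B.snocEquiv n).symm.toLinearMap) (B.snoc y 1) = f.1 y
    rw [ext_comp_snocEquiv_symm, trR_one, evalR_mk, one_smul, one_smul]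

omit [Module Aᵐᵒᵖ M] [IsScalarTower k Aᵐᵒᵖ M] in
theorem chainEquiv_apply (hR : B.IsRightHopf) {n : ℕ} (F : B.CycChain M n) (y : B.T n) :
    (chainEquiv M hR n F).1 y = F (B.snoc y 1) := rfl

omit [Module Aᵐᵒᵖ M] [IsScalarTower k Aᵐᵒᵖ M] in
theorem chainEquiv_symm_snoc (hR : B.IsRightHopf) {n : ℕ} (f : B.Chain M n) (y : B.T n) (u : U) :
    (chainEquiv M hR n).symm f (B.snoc y u) = (rAct hR u f).1 y :=
  ext_comp_snocEquiv_symm hR f y u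

omit [Module Aᵐᵒᵖ M] [IsScalarTower k Aᵐᵒᵖ M] in
theorem chainEquiv_symm_snoc_one (hR : B.IsRightHopf) {n : ℕ} (f : B.Chain M n) (y : B.T n) :
    (chainEquiv M hR n).symm f (B.snoc y 1) = f.1 y := by
  rw [← chainEquiv_apply hR, LinearEquiv.apply_symm_apply]

/-- `F ↦ F(- ∘_i w)`. -/
def cycBul (i : ℕ) {p n m : ℕ} (h : m + p = n + 1) :
    B.T p →ₗ[k] B.CycChain M n →ₗ[k] B.CycChain M m :=
  LinearMap.mk₂ k (fun w F => F ∘ₗ B.ins w i (m + 1) (n + 1) (by omega))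
    (fun w w' F => by rw [ins_add, LinearMap.comp_add])
    (fun c w F => LinearMap.ext fun x => by
      rw [LinearMap.comp_apply, ins_smul, F.map_smul_of_tower]
      rfl)
    (fun w F F' => rfl) (fun c w F => rfl)

omit [Module Aᵐᵒᵖ M] [IsScalarTower k Aᵐᵒᵖ M] in
theorem cycBul_apply (i : ℕ) {p n m : ℕ} (h : m + p = n + 1) (w : B.T p) (F : B.CycChain M n)
    (x : B.T (m + 1)) :
    cycBul i h w F x = F (B.ins w i (m + 1) (n + 1) (by omega) x) := rfl

/-- Concatenation as a `U`-linear map with values in a prescribed degree. -/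
def appendT (B : LeftBialgebroid k A U) {a b n : ℕ} (h : b + a = n) :
    B.tn (B.tpow a) (B.tpow b) →ₗ[U] B.T n := B.castT h ∘ₗ B.appendU a b

theorem appendT_tm {a b n : ℕ} (h : b + a = n) (x : B.T a) (y : B.T b) :
    B.appendT h (B.tm x y) = B.app h x y := rfl

theorem app_scalar_right {a : ℕ} (h : 0 + a = a) (x : B.T a) (c : A) :
    B.app h x (B.scalar c) = B.t c • x := by
  have h₁ : B.tm x (B.scalar c) = B.tm (B.t c • x) (B.scalar 1) := by
    rw [tm_balanced, src_smul_scalar, mul_one]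
  rw [← appendT_tm, h₁, appendT_tm, app_scalar_one]

end LeftBialgebroid

namespace AYDContramodule

variable (Y : AYDContramodule B hL M)

theorem γ_congr {f g : B.HomAop M} (h : ∀ z, f.1 z = g.1 z) : Y.γ f = Y.γ g :=
  congrArg Y.γ (Subtype.ext (LinearMap.ext h))

/-- Contraassociativity for maps out of a tensor product. -/
theorem γ_γ {N P : LMod k U} (F : B.tn N P →ₗ[k] M)
    (hF : ∀ (a : A) z, F (B.t a • z) = MulOpposite.op a • F z) (n : N) (p : P)
    (φ : U → B.HomAop M) (f g : B.HomAop M) (hf : ∀ u, f.1 u = Y.γ (φ u))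
    (hφ : ∀ u z, (φ u).1 z = F (B.tm (u • n) (z • p))) (hg : ∀ u, g.1 u = F (u • B.tm n p)) :
    Y.γ f = Y.γ g := by
  have h := Y.γ_assoc (F ∘ₗ B.act n p) fun a x y => by
    change F (B.tm (x • n) ((B.t a * y) • p)) = MulOpposite.op a • F (B.tm (x • n) (y • p))
    rw [mul_smul, ← t_smul_tm, hF]
  refine Eq.trans (Y.γ_congr fun u => ?_) (h.trans (Y.γ_congr fun u => ?_))
  · rw [hf]
    exact Y.γ_congr fun z => hφ u z
  · rw [hg]
    rfl

/-- The cyclic operator on `Hom_U(U^{⊗_A (n + 1)}, M)`. -/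
def cycT (n : ℕ) : B.CycChain M n →ₗ[k] B.CycChain M n where
  toFun F := Y.trace (P := LMod.reg k U) (F ∘ₗ (B.snocEquiv n).toLinearMap) ∘ₗ
    (B.consEquiv n).symm.toLinearMap
  map_add' F G := B.T_hom_ext fun u x => by
    change Y.γ (Y.slot (P := LMod.reg k U) _ x u) = Y.γ (Y.slot (P := LMod.reg k U) _ x u) +
      Y.γ (Y.slot (P := LMod.reg k U) _ x u)
    rw [← map_add]
    rfl
  map_smul' c F := B.T_hom_ext fun u x => by
    change Y.γ (Y.slot (P := LMod.reg k U) _ x u) = c • Y.γ (Y.slot (P := LMod.reg k U) _ x u)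
    rw [← map_smul]
    rfl

theorem cycT_cons {n : ℕ} (F : B.CycChain M n) (u : U) (y : B.T n) :
    Y.cycT n F (B.cons u y) =
      Y.γ (Y.slot (P := LMod.reg k U) (F ∘ₗ (B.snocEquiv n).toLinearMap) y u) := rfl

/-- As i ≤ m, the last of the m + 1 factors is untouched by the insertion. Rotation exchanges a
first factor for a last one, so the slot number changes by one. -/
theorem cycT_cycBul {p n m i : ℕ} (h : m + p = n + 1) (w : B.T p) (F : B.CycChain M n) (hi : 1 ≤ i)
    (him : i ≤ m) : Y.cycT m (cycBul i h w F) = cycBul (i + 1) h w (Y.cycT n F) := by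
  refine B.T_hom_ext fun u y => ?_
  rw [cycT_cons, cycBul_apply, ins_succ_cons B w hi, cycT_cons]
  refine Y.γ_congr fun z => ?_
  change F (B.ins w i (m + 1) (n + 1) _ (B.snoc y (z * u))) =
    F (B.snoc (B.ins w i m n h y) (z * u))
  rw [ins_snoc B w h _ hi him]

/-- For j = 0 the block x is an element c of A and the claim is s(c)m = γ(m ε(- s(c))). In the step,
one rotation of (v | x | y) gives a contraaction over t^j F at (x | y | z v), which is itself a
contraaction by induction. Contraassociativity merges the two into the diagonal action on (v | x).
-/
theorem cycT_pow_app (j : ℕ) {b n : ℕ} (h : b + j = n + 1) (h' : j + b = n + 1) (F : B.CycChain M n)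
    (x : B.T j) (y : B.T b) :
    (Y.cycT n ^ j) F (B.app h x y) = Y.trace (F ∘ₗ B.appendT h') (B.tm x y) := by
  induction j generalizing b with
  | zero =>
    obtain rfl : b = n + 1 := by omega
    refine B.T_zero_induction (p := fun x => F (B.app h x y) =
      Y.trace (F ∘ₗ B.appendT h') (B.tm x y)) x fun c => ?_
    rw [app_scalar, F.map_smul, Y.left_eq, trace_tm]
    refine Y.γ_congr fun z => ?_
    change MulOpposite.op (B.counit (z * B.src c)) • F y =
      F (B.app h' y (z • B.scalar c))
    rw [smul_scalar, app_scalar_right, F.map_smul, Y.right_eq]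
  | succ j ih =>
    refine B.T_succ_induction' (p := fun x => (Y.cycT n ^ (j + 1)) F (B.app h x y) =
      Y.trace (F ∘ₗ B.appendT h') (B.tm x y)) x (fun v x => ?_) fun x x' hx hx' => ?_
    · rw [pow_succ', Module.End.mul_apply, app_cons, cycT_cons, trace_tm]
      have h₁ : b + 1 + j = n + 1 := by omega
      have h₂ : j + (b + 1) = n + 1 := by omega
      refine Y.γ_γ (N := LMod.reg k U) (P := B.tpow j) (((F ∘ₗ B.appendT h').restrictScalars k) ∘ₗ
          (B.tm (P := B.tpow (j + 1)) y) ∘ₗ (B.consEquiv j).toLinearMap.restrictScalars k)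
        (fun a z => ?_) v x
        (fun u => Y.slot (F ∘ₗ B.appendT h₂) (B.snoc y (u * v)) x) _ _ (fun u => ?_)
        (fun u z => ?_) fun u => ?_
      · change F (B.appendT h' (B.tm y (B.consEquiv j (B.t a • z)))) =
          MulOpposite.op a • F (B.appendT h' (B.tm y (B.consEquiv j z)))
        rw [map_smul (B.consEquiv j), ← t_smul_tm, map_smul (B.appendT h'), F.map_smul, Y.right_eq]
      · change (Y.cycT n ^ j) F (B.snoc (B.app _ x y) (u * v)) = _
        rw [← B.app_snoc h₁, ih h₁ h₂, trace_tm]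
      · change F (B.app h₂ (B.snoc y (u * v)) (z • x)) = F (B.app h' y (B.cons (u * v) (z • x)))
        rw [B.snoc_app h₂ h']
      · rfl
    · simp only [map_add, LinearMap.add_apply, hx, hx']

/-- All n + 1 factors rotate past the empty block 1_A, which yields γ(z ↦ F(z x)) = γ(z ↦ z F(x)).
Stability makes this F(x). -/
theorem cycT_pow (hY : Y.IsStable) (n : ℕ) : Y.cycT n ^ (n + 1) = 1 := by
  refine LinearMap.ext fun F => LinearMap.ext fun x => ?_
  have h : 0 + (n + 1) = n + 1 := by omega
  have h₁ := Y.cycT_pow_app (n + 1) h (by omega) F x (B.scalar 1)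
  rw [app_scalar_one] at h₁
  refine h₁.trans ((Y.γ_congr fun z => ?_).trans (hY (F x)))
  change F (B.app (by omega) (B.scalar 1) (z • x)) = z • F x
  rw [app_scalar, map_one, one_smul, F.map_smul]

theorem cycT_pow_cycT (hY : Y.IsStable) {n : ℕ} (F : B.CycChain M n) :
    (Y.cycT n ^ n) (Y.cycT n F) = F := by
  rw [← Module.End.mul_apply, ← pow_succ, Y.cycT_pow hY, Module.End.one_apply]

theorem cycT_cycT_pow (hY : Y.IsStable) {n : ℕ} (F : B.CycChain M n) :
    Y.cycT n ((Y.cycT n ^ n) F) = F := by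
  rw [← Module.End.mul_apply, ← pow_succ', Y.cycT_pow hY, Module.End.one_apply]

/-- The operations `F ↦ t⁻¹(w •_{i+1} t F)`, which extend `cycBul` to the index `0`. -/
def cycBul₀ (i : ℕ) {p n m : ℕ} (h : m + p = n + 1) :
    B.T p →ₗ[k] B.CycChain M n →ₗ[k] B.CycChain M m :=
  -- The power t^m stands for t⁻¹ in degree m, so the definition itself does not require stability.
  if i ≤ m then ((cycBul (i + 1) h).compl₂ (Y.cycT n)).compr₂ (Y.cycT m ^ m) else 0

theorem cycBul₀_of_le {i p n m : ℕ} (h : m + p = n + 1) (hi : i ≤ m) (w : B.T p)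
    (F : B.CycChain M n) :
    Y.cycBul₀ i h w F = (Y.cycT m ^ m) (cycBul (i + 1) h w (Y.cycT n F)) := by
  rw [cycBul₀, if_pos hi]
  rfl

/-- In this range t shifts the plain insertion in slot i to slot i + 1, and the outer t⁻¹ shifts it
back. -/
theorem cycBul₀_eq_cycBul (hY : Y.IsStable) {i p n m : ℕ} (h : m + p = n + 1) (hi : 1 ≤ i)
    (him : i ≤ m) (w : B.T p) (F : B.CycChain M n) : Y.cycBul₀ i h w F = cycBul i h w F := by
  rw [Y.cycBul₀_of_le h him, ← Y.cycT_cycBul h w F hi him, Y.cycT_pow_cycT hY]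

/-- The cyclic unital opposite module of the spaces `Hom_U(U^{⊗_A (n + 1)}, M)`. -/
def cycModule (hY : Y.IsStable) :
    CyclicUnitalOppositeModule B.tensorOperad (fun n => B.CycChain M n) where
  bul i p n m h := Y.cycBul₀ i h
  bul_zero i p n m h φ F hi := by
    rw [cycBul₀, if_neg (by omega)]
    rfl
  -- After t t⁻¹ cancels in the middle, both sides are t⁻¹ of a precomposition with two insertions.
  -- All slots are raised by one, so the operad relation applies even for j = 0.
  bul_bul_lt h₁ h₂ h₃ h₄ φ ψ F hj hi := by
    rw [Y.cycBul₀_of_le h₂ hi, Y.cycBul₀_of_le h₁ (by omega), Y.cycBul₀_of_le h₄ (by omega),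
      Y.cycBul₀_of_le h₃ (by omega), Y.cycT_cycT_pow hY, Y.cycT_cycT_pow hY]
    congr 1
    refine LinearMap.ext fun x => ?_
    simp only [cycBul_apply]
    exact congrArg _ (B.ins_ins_lt _ _ _ _ _ _ _ (by omega) (by omega) (by omega) (by omega))
  bul_bul_mid h₁ h₂ h₃ h₄ φ ψ F hij hj hjm hi := by
    rw [Y.cycBul₀_of_le h₂ hi, Y.cycBul₀_of_le h₁ hjm, Y.cycBul₀_of_le h₄ hi, Y.cycT_cycT_pow hY]
    congr 1
    refine LinearMap.ext fun x => ?_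
    simp only [cycBul_apply]
    rw [tensorOperad_comp]
    exact congrArg _ (B.ins_ins_mid _ _ _ _ _ _ _ (by omega) (by omega) (by omega) (by omega)
      (by omega))
  bul_bul_ge h₁ h₂ h₃ h₄ φ ψ F hi hj := by
    rw [Y.cycBul₀_of_le h₂ (by omega), Y.cycBul₀_of_le h₁ (by omega),
      Y.cycBul₀_of_le h₄ (by omega), Y.cycBul₀_of_le h₃ (by omega), Y.cycT_cycT_pow hY,
      Y.cycT_cycT_pow hY]
    congr 1
    refine LinearMap.ext fun x => ?_
    simp only [cycBul_apply]
    exact congrArg _ (B.ins_ins_lt _ _ _ _ _ _ _ (by omega) (by omega) (by omega) (by omega)).symm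
  one_bul {n} {i} F hi := by
    rw [Y.cycBul₀_of_le _ hi]
    refine Eq.trans (congrArg (Y.cycT n ^ n) ?_) (Y.cycT_pow_cycT hY F)
    refine LinearMap.ext fun x => ?_
    rw [cycBul_apply]
    exact congrArg _ (B.ins_one_tensor (by omega) (by omega) _ x)
  t := Y.cycT
  t_pow := Y.cycT_pow hY
  t_bul {p n m i} h φ F hi := by
    rw [Y.cycBul₀_of_le h (by omega), Y.cycBul₀_of_le h (by omega), Y.cycT_cycT_pow hY,
      ← Y.cycT_cycBul (i := i + 1) h φ _ (by omega) (by omega), Y.cycT_pow_cycT hY]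

/-- Here t⁻¹ = t^m rotates the block y, giving γ(z ↦ tF(u | w | z y)) = γ(z ↦ γ(z' ↦ F(w | z y | z'
u))). Contraassociativity merges this into γ(z ↦ F(w | z · (y | u))). -/
theorem cycBul₀_zero_cons {p n m : ℕ} (h : m + (p + 1) = n + 1) (h' : m + 1 + p = n + 1) (u : U)
    (w : B.T p) (F : B.CycChain M n) (y : B.T m) :
    Y.cycBul₀ 0 h (B.cons u w) F (B.snoc y 1) =
      Y.γ (Y.slot (F ∘ₗ B.appendT h') w (B.snoc y u)) := by
  have h₁ : 0 + (m + 1) = m + 1 := by omega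
  have h₂ : 1 + m = m + 1 := by omega
  have h₃ : m + p = n := by omega
  -- Appending 1_A to (y | 1) allows `snoc_app` to read it as the block y followed by the block
  -- consisting of the single factor 1.
  rw [Y.cycBul₀_of_le h (Nat.zero_le m), ← B.app_scalar_one h₁ (B.snoc y 1),
    B.snoc_app h₁ h₂, Y.cycT_pow_app m h₂ rfl, trace_tm]
  refine Y.γ_γ (N := B.tpow m) (P := LMod.reg k U) (((F ∘ₗ B.appendT h').restrictScalars k) ∘ₗ
      (B.tm (P := B.tpow (m + 1)) w) ∘ₗ (B.snocEquiv m).toLinearMap.restrictScalars k)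
    (fun a z => ?_) y u
    (fun z => Y.slot (P := LMod.reg k U) (F ∘ₗ (B.snocEquiv n).toLinearMap) (B.app h₃ w (z • y)) u)
    _ _ (fun z => ?_) (fun z z' => ?_) fun z => ?_
  · change F (B.appendT h' (B.tm w (B.snocEquiv m (B.t a • z)))) =
      MulOpposite.op a • F (B.appendT h' (B.tm w (B.snocEquiv m z)))
    rw [map_smul (B.snocEquiv m), ← t_smul_tm, map_smul (B.appendT h'), F.map_smul, Y.right_eq]
  · change Y.cycT n F (B.ins (B.cons u w) 1 (m + 1) (n + 1) _
      (B.app (by omega) (B.cons 1 (B.scalar 1)) (z • y))) = _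
    rw [app_cons, app_scalar, map_one, one_smul, ins_one_cons, one_smul, app_cons, cycT_cons]
  · change F (B.snoc (B.app h₃ w (z • y)) (z' * u)) =
      F (B.app h' w (B.snoc (z • y) (z' * u)))
    rw [B.app_snoc h' h₃]
  · change F (B.app h' w (z • B.snoc y u)) = F (B.app h' w (B.snocEquiv m (z • B.tm y u)))
    rw [map_smul (B.snocEquiv m)]
    rfl

/-- Rotating back all factors but the final 1 gives γ(z ↦ s(a) z m) with m = tF(v | y). By
`γ_srcSmul` this is γ(z ↦ z t(a) m), and stability gives t(a) m = tF(v | t(a) y). -/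
theorem cycBul₀_zero_scalar (hY : Y.IsStable) {n : ℕ} (h : n + 1 + 0 = n + 1) (a : A)
    (F : B.CycChain M n) (v : U) (y : B.T n) :
    Y.cycBul₀ 0 h (B.scalar a) F (B.snoc (B.cons v y) 1) = Y.cycT n F (B.cons v (B.t a • y)) := by
  have h₁ : 0 + (n + 1 + 1) = n + 1 + 1 := by omega
  have h₂ : 1 + (n + 1) = n + 1 + 1 := by omega
  rw [Y.cycBul₀_of_le h (Nat.zero_le _), ← B.app_scalar_one h₁ (B.snoc (B.cons v y) 1),
    B.snoc_app h₁ h₂, Y.cycT_pow_app (n + 1) h₂ rfl, trace_tm]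
  have h₃ : B.cons v (B.t a • y) = B.t a • B.cons v y :=
    (B.t_smul_tm (N := LMod.reg k U) (P := B.tpow n) a v y).symm
  rw [h₃, LinearMap.map_smul, ← hY (B.t a • Y.cycT n F (B.cons v y))]
  refine Eq.trans (Y.γ_congr fun z => ?_)
    ((Y.γ_srcSmul a (Y.actHom (Y.cycT n F (B.cons v y)))).trans (Y.γ_congr fun z => ?_))
  · change Y.cycT n F (B.ins (B.scalar a) 1 (n + 1 + 1) (n + 1) _
      (B.app (by omega) (B.cons 1 (B.scalar 1)) (z • B.cons v y))) =
        B.src a • z • Y.cycT n F (B.cons v y)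
    rw [app_cons, app_scalar, map_one, one_smul, ins_one_cons, one_smul, app_scalar,
      LinearMap.map_smul, LinearMap.map_smul]
  · change (z * B.t a) • Y.cycT n F (B.cons v y) = z • B.t a • Y.cycT n F (B.cons v y)
    rw [mul_smul]

/-- This is the last face. The formula for •_0 produces γ(z ↦ γ(z' ↦ F(z · (y | 1) | z'))), which
merges to γ(z ↦ z F(y | 1 | 1)), and stability removes γ. -/
theorem cycBul₀_zero_mul_cycT (hY : Y.IsStable) {n : ℕ} (h : n + 2 = n + 1 + 1)
    (F : B.CycChain M (n + 1)) (y : B.T n) :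
    Y.cycBul₀ 0 h (B.cons 1 (B.cons 1 (B.scalar 1))) (Y.cycT (n + 1) F) (B.snoc y 1) =
      F (B.snoc (B.snoc y 1) 1) := by
  refine (Y.cycBul₀_zero_cons h rfl 1 (B.cons 1 (B.scalar 1)) _ y).trans ?_
  rw [← hY (F (B.snoc (B.snoc y 1) 1))]
  refine Y.γ_γ (N := B.tpow (n + 1)) (P := LMod.reg k U)
    ((F ∘ₗ (B.snocEquiv (n + 1)).toLinearMap).restrictScalars k)
    (fun a z => ?_) (B.snoc y 1) (1 : U)
    (fun z => Y.slot (P := LMod.reg k U) (F ∘ₗ (B.snocEquiv (n + 1)).toLinearMap)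
      (z • B.snoc y 1) (1 : U)) _ _ (fun z => ?_) (fun z z' => rfl) fun z => ?_
  · change F (B.snocEquiv (n + 1) (B.t a • z)) = MulOpposite.op a • F (B.snocEquiv (n + 1) z)
    rw [map_smul (B.snocEquiv (n + 1)), F.map_smul, Y.right_eq]
  · have h₁ := B.app_cons (a := 0) (b := n + 1) (n := n + 1) rfl 1 (B.scalar 1) (z • B.snoc y 1)
    refine (congrArg (Y.cycT (n + 1) F) h₁).trans ?_
    rw [app_scalar, map_one, one_smul, cycT_cons]
  · change z • F (B.snoc (B.snoc y 1) 1) = F (B.snocEquiv (n + 1) (z • B.tm (B.snoc y 1) (1 : U)))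
    rw [map_smul (B.snocEquiv (n + 1)), F.map_smul]
    rfl

end AYDContramodule

end CyclicModel

end CycOpp

namespace CycOpp

open LeftBialgebroid

/-! ### Transfer to Hom_A(U^{⊗n}, M) and the explicit formulas. -/

section ChainModule

variable {k : Type v} {A U : Type u} [CommRing k] [Ring A] [Algebra k A] [Ring U] [Algebra k U]
  {B : LeftBialgebroid k A U} {hL : B.IsLeftHopf}
  {M : Type w} [AddCommGroup M] [Module k M] [Module U M] [IsScalarTower k U M]
  [Module Aᵐᵒᵖ M] [IsScalarTower k Aᵐᵒᵖ M]
  (Y : AYDContramodule B hL M) (hR : B.IsRightHopf) (hY : Y.IsStable)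

namespace AYDContramodule

/-- The cyclic unital opposite module of the chain spaces `Hom_A(U^{⊗_A n}, M)`. -/
noncomputable def chainModule :
    CyclicUnitalOppositeModule B.tensorOperad (fun n => B.Chain M n) :=
  (Y.cycModule hY).transport (chainEquiv M hR)

theorem chainModule_bul {i p n m : ℕ} (h : m + p = n + 1) (w : B.T p) (f : B.Chain M n)
    (x : B.T m) : ((Y.chainModule hR hY).bul i h w f).1 x =
      Y.cycBul₀ i h w ((chainEquiv M hR n).symm f) (B.snoc x 1) := rfl

theorem chainModule_t {n : ℕ} (f : B.Chain M n) (x : B.T n) :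
    ((Y.chainModule hR hY).t n f).1 x =
      Y.cycT n ((chainEquiv M hR n).symm f) (B.snoc x 1) := rfl

theorem chainModule_bul_of_pos {i p n m : ℕ} (h : m + p = n + 1) (hi : 1 ≤ i) (him : i ≤ m)
    (w : B.T p) (f : B.Chain M n) (x : B.T m) :
    ((Y.chainModule hR hY).bul i h w f).1 x = f.1 (B.ins w i m n h x) := by
  rw [chainModule_bul, Y.cycBul₀_eq_cycBul hY h hi him, cycBul_apply, ins_snoc B w h _ hi him,
    chainEquiv_symm_snoc_one]

theorem slot_chainEquiv_symm {n : ℕ} (f : B.Chain M n) (v : U) (y : B.T n) :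
    Y.slot (P := LMod.reg k U) ((chainEquiv M hR n).symm f ∘ₗ (B.snocEquiv n).toLinearMap) y v =
      B.rmul v (Y.tr hR f y) :=
  Subtype.ext (LinearMap.ext fun z => chainEquiv_symm_snoc hR f y (z * v))

theorem chainModule_t_cons {n : ℕ} (f : B.Chain M (n + 1)) (v : U) (y : B.T n) :
    ((Y.chainModule hR hY).t (n + 1) f).1 (B.cons v y) =
      Y.γ (B.rmul v (Y.tr hR f (B.snocOne y))) := by
  rw [chainModule_t, snoc_cons, cycT_cons, slot_chainEquiv_symm, snoc_one]

theorem chainModule_bul_zero_scalar {n : ℕ} (h : n + 1 + 0 = n + 1) (a : A) (f : B.Chain M n)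
    (v : U) (y : B.T n) :
    ((Y.chainModule hR hY).bul 0 h (B.scalar a) f).1 (B.cons v y) =
      Y.γ (B.rmul v (Y.tr hR f (B.t a • y))) := by
  rw [chainModule_bul, Y.cycBul₀_zero_scalar hY, cycT_cons, slot_chainEquiv_symm]

/-- With F the extension of f, `evalR_slotA` read backwards turns F(w | z · (y | u)) into z_[+]
F(z_[-] · w | y | u), and F(- | u) is the action of u on f. -/
theorem chainModule_bul_zero_cons {n p : ℕ} (h : n + (p + 1) = n + p + 1) (u : U) (w : B.T p)
    (f : B.Chain M (n + p)) (y : B.T n) :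
    ((Y.chainModule hR hY).bul 0 h (B.cons u w) f).1 y =
      Y.γ (Y.tr hR (B.fillHom (rAct hR u f) w y) 1) := by
  have h' : n + 1 + p = n + p + 1 := by omega
  rw [chainModule_bul, Y.cycBul₀_zero_cons h h']
  refine Y.γ_congr fun z => ?_
  rw [slot_apply, ← evalR_slotA hR]
  change _ = B.evalR _ _ _
  refine LinearMap.congr_fun (BalTensor.hom_ext fun x x' => ?_) _
  change x • (chainEquiv M hR (n + p)).symm f (B.app h' (x' • w) (B.snoc y u)) =
    x • (rAct hR u f).1 (B.append ((x' * 1) • w) y)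
  rw [B.app_snoc h' rfl, chainEquiv_symm_snoc, app_append, mul_one]

theorem face_zero_apply {n : ℕ} (h : n + 1 = n + 1) (f : B.Chain M (n + 1)) (y : B.T n) :
    ((Y.chainModule hR hY).face 0 h f).1 y = Y.γ (Y.tr hR (B.consHom f y) 1) := by
  rw [(Y.chainModule hR hY).face_of_lt h (by omega)]
  refine (Y.chainModule_bul_zero_cons hR hY (p := 1) rfl 1 (B.cons 1 (B.scalar 1)) f y).trans ?_
  congr 2
  refine Subtype.ext (LinearMap.ext fun x => ?_)
  change (rAct hR 1 f).1 (B.append (x • B.cons 1 (B.scalar 1)) y) = f.1 (B.cons x y)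
  rw [smul_one_tensor, append_cons, append_scalar, map_one, one_smul]
  change B.evalR f _ (trR hR 1) = _
  rw [trR_one, evalR_mk, one_smul, one_smul]

theorem face_last_apply {n : ℕ} (h : n + 1 = n + 1) (f : B.Chain M (n + 1)) (y : B.T n) :
    ((Y.chainModule hR hY).face (n + 1) h f).1 y = f.1 (B.snocOne y) := by
  rw [(Y.chainModule hR hY).face_last h, chainModule_bul]
  change Y.cycBul₀ 0 _ (B.cons 1 (B.cons 1 (B.scalar 1)))
    ((chainEquiv M hR (n + 1)).symm (chainEquiv M hR (n + 1)
      (Y.cycT (n + 1) ((chainEquiv M hR (n + 1)).symm f)))) (B.snoc y 1) = _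
  rw [LinearEquiv.symm_apply_apply, Y.cycBul₀_zero_mul_cycT hY, chainEquiv_symm_snoc_one, snoc_one]

end AYDContramodule

namespace LeftBialgebroid

/-- Acting diagonally on (1 | 1) reproduces the coproduct, which is why the inner faces μ •_i insert
Δ. -/
theorem smul_mul_tensor (v : U) : v • B.cons 1 (B.cons 1 (B.scalar 1)) = B.comul₂ v := by
  refine LinearMap.congr_fun (f := B.act (N := LMod.reg k U) (P := B.tpow 1) (1 : U)
    (B.cons 1 (B.scalar 1))) (BalTensor.hom_ext fun x y => ?_) (B.comul v)
  change B.cons (x * 1) (y • B.cons 1 (B.scalar 1)) = B.cons x (B.cons y (B.scalar 1))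
  rw [mul_one, smul_one_tensor]

end LeftBialgebroid

end ChainModule

end CycOpp

/-! ### The main theorem. -/

theorem theorem5p2 {k : Type v} {A U : Type u} {M : Type w}
    [CommRing k] [Ring A] [Algebra k A] [Ring U] [Algebra k U]
    [AddCommGroup M] [Module k M] [Module U M] [IsScalarTower k U M]
    [Module Aᵐᵒᵖ M] [IsScalarTower k Aᵐᵒᵖ M]
    (B : CycOpp.LeftBialgebroid k A U) (hL : B.IsLeftHopf) (hR : B.IsRightHopf)
    (Y : CycOpp.AYDContramodule B hL M) (hY : Y.IsStable) :
    -- the operad with multiplication `O(p) = U^{⊗_A p}`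
    ∃ P : CycOpp.OperadWithMultiplication k (fun p => B.T p),
      (∀ {a b q : ℕ} (x : B.T a) (u : U) (y : B.T b) (w : B.T q),
        P.comp (a + 1) (p := (b + 1) + a) (q := q) (r := (b + q) + a) (by omega)
            (B.append x (B.cons u y)) w =
          B.append x (B.append (u • w) y)) ∧
      P.one = B.cons 1 (B.scalar 1) ∧
      P.mul = B.cons 1 (B.cons 1 (B.scalar 1)) ∧
      P.unit = B.scalar 1 ∧
      -- the cyclic unital opposite module `M(n) = Hom_A(U^{⊗_A n}, M)`
      ∃ Z : CycOpp.CyclicUnitalOppositeModule P (fun n => B.Chain M n),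
        -- `w •_i f` for `i = a + 1 ≥ 1`
        (∀ {a b p : ℕ} (w : B.T p) (f : B.Chain M ((b + p) + a)) (x : B.T a) (v : U) (y : B.T b),
          (Z.bul (a + 1) (p := p) (n := (b + p) + a) (m := (b + 1) + a) (by omega) w f).1
              (B.append x (B.cons v y)) =
            f.1 (B.append x (B.append (v • w) y))) ∧
        -- `(u | w) •_0 f`
        (∀ {n p : ℕ} (u : U) (w : B.T p) (f : B.Chain M (n + p)) (y : B.T n),
          (Z.bul 0 (p := p + 1) (n := n + p) (m := n) (by omega) (B.cons u w) f).1 y =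
            Y.γ (Y.tr hR (B.fillHom (CycOpp.LeftBialgebroid.rAct hR u f) w y) 1)) ∧
        -- `a •_0 f` for `a` in `O(0) = A`
        (∀ {n : ℕ} (a : A) (f : B.Chain M n) (v : U) (y : B.T n),
          (Z.bul 0 (p := 0) (n := n) (m := n + 1) (by omega) (B.scalar a) f).1 (B.cons v y) =
            Y.γ (B.rmul v (Y.tr hR f (B.t a • y)))) ∧
        -- the cyclic operator
        (∀ {n : ℕ} (f : B.Chain M (n + 1)) (v : U) (y : B.T n),
          (Z.t (n + 1) f).1 (B.cons v y) = Y.γ (B.rmul v (Y.tr hR f (B.snocOne y)))) ∧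
        -- the induced cyclic module
        CycOpp.IsCyclicModule (fun n i => Z.face i (n := n + 1) (m := n) (by omega))
          (fun n j => Z.degen j (n := n) (m := n + 1) (by omega)) Z.t ∧
        (∀ {n : ℕ} (f : B.Chain M (n + 1)) (y : B.T n),
          (Z.face 0 (n := n + 1) (m := n) (by omega) f).1 y = Y.γ (Y.tr hR (B.consHom f y) 1)) ∧
        (∀ {a b : ℕ} (f : B.Chain M ((b + 2) + a)) (x : B.T a) (v : U) (y : B.T b),
          (Z.face (a + 1) (n := (b + 2) + a) (m := (b + 1) + a) (by omega) f).1
              (B.append x (B.cons v y)) =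
            f.1 (B.append x (B.append (B.comul₂ v) y))) ∧
        (∀ {n : ℕ} (f : B.Chain M (n + 1)) (y : B.T n),
          (Z.face (n + 1) (n := n + 1) (m := n) (by omega) f).1 y = f.1 (B.snocOne y)) ∧
        (∀ {a b : ℕ} (f : B.Chain M (b + a)) (x : B.T a) (v : U) (y : B.T b),
          (Z.degen a (n := b + a) (m := (b + 1) + a) (by omega) f).1 (B.append x (B.cons v y)) =
            f.1 (B.append x (B.append (B.scalar (B.counit v)) y))) := by
  refine ⟨B.tensorOperad, fun x u y w => B.ins_append w _ x u y, rfl, rfl, rfl,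
    Y.chainModule hR hY, fun {a b p} w f x v y => ?_,
    fun u w f y => Y.chainModule_bul_zero_cons hR hY _ u w f y,
    fun a f v y => Y.chainModule_bul_zero_scalar hR hY _ a f v y,
    fun f v y => Y.chainModule_t_cons hR hY f v y,
    (Y.chainModule hR hY).isCyclicModule fun _ => rfl,
    fun f y => Y.face_zero_apply hR hY _ f y,
    fun {a b} f x v y => ?_, fun f y => Y.face_last_apply hR hY _ f y, fun {a b} f x v y => ?_⟩
  · rw [Y.chainModule_bul_of_pos hR hY _ (by omega) (by omega), B.ins_append]
  -- Since a + 1 < b + 2 + a, this is never the last face and t does not enter.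
  · rw [(Y.chainModule hR hY).face_of_lt _ (by omega)]
    refine (Y.chainModule_bul_of_pos hR hY (by omega) (by omega) (by omega)
      (B.cons 1 (B.cons 1 (B.scalar 1))) f _).trans ?_
    rw [B.ins_append, CycOpp.LeftBialgebroid.smul_mul_tensor]
  · refine (Y.chainModule_bul_of_pos hR hY (by omega) (by omega) (by omega)
      (B.scalar 1) f _).trans ?_
    refine congrArg f.1 ((B.ins_append (B.scalar 1) (by omega) x v y).trans ?_)
    -- The factor v acts on the unit 1_A by v · 1_A = ε(v), so e •_{a+1} inserts the counit.
    rw [B.smul_scalar, map_one, mul_one]
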